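/- Let $k$ be a field of characteristic different from $2$, let $\bar k$ be an algebraically closed field containing $k$, and let $F(X)=f_0+f_1X+\dots+f_5X^5+X^6\in k[X]$ have six distinct roots $\theta_1,\dots,\theta_6\in\bar k$. All varieties and morphisms below are taken over $\bar k$. **The surfaces.** Put $F_0(x,u)=2f_0+f_1(x+u)+2f_2xu+f_3xu(x+u)+2f_4(xu)^2+f_5(xu)^2(x+u)+2(xu)^3$. The Kummer surface $\mathcal K\subset\mathbb P^3$ of the curve $\mathcal C: Y^2=F(X)$ is the Zariski closure of the set of points $\xi=(1:x+u:xu:\beta_0)$, $\beta_0=\frac{F_0(x,u)-2yv}{(x-u)^2}$, attached to pairs of points $(x,y),(u,v)$ of $Y^2=F(X)$ with $x\ne u$. Its projective dual $\mathcal K^*\subset(\mathbb P^3)^\vee=\mathbb P^3$ is the closure of the set of tangent planes to $\mathcal K$ at smooth points. The surface $\mathcal S\subset\mathbb P^5$ is the set of $(p_0:\dots:p_5)$ such that, for $P(X)=\sum_j p_jX^j$, the square $P(X)^2$ is congruent modulo $F(X)$ to a polynomial of degree at most $2$. **The blow-downs.** For a general $\xi\in\mathcal K$, attached to $(x,y),(u,v)$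 with $yv\neq0$, $x\ne u$, let $M(X)$ be the polynomial of degree at most $3$ such that $Y-M(X)$ vanishes doubly on $\mathcal C$ at $(x,y)$ and at $(u,v)$, and let $\kappa(\xi)\in\mathcal S$ be given by the polynomial $P$ of degree at most $5$ with $(X-x)(X-u)P\equiv M \bmod F$. If $\eta\in\mathcal K^*$ is the tangent plane to $\mathcal K$ at $\xi$, put $\kappa^*(\eta)=\kappa(\xi)$. There is exactly one morphism $\kappa^{-1}:\mathcal S\to\mathcal K$ with $\kappa^{-1}(\kappa(\xi))=\xi$ for all such $\xi$, and exactly one morphism ${\kappa^*}^{-1}:\mathcal S\to\mathcal K^*$ with ${\kappa^*}^{-1}(\kappa(\xi))=\eta$ for all such $\xi$, $\eta$. **The maps.** For $i=1,\dots,6$ let $P_i(X)=\prod_{j\ne i}(X-\theta_j)$ and $g_i(X)=1-2P_i(X)/P_i(\theta_i)$, and let $\varepsilon^{(i)}:\mathcal S\to\mathcal S$ be $P\mapsto g_iP\bmod F$. Let $W_i:\mathbb P^3\to(\mathbb P^3)^\vee$ be the linear map with the antisymmetric matrix $$\begin{pmatrix}0&a_{12}&a_{13}&\theta^2\\-a_{12}&0&a_{23}&-\theta\\-a_{13}&-a_{23}&0&1\\-\theta^2&\theta&-1&0\end{pmatrix},\qquad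 \theta=\theta_i,$$ where $a_{12}=f_1+2f_2\theta+2f_3\theta^2+2f_4\theta^3+2f_5\theta^4+2\theta^5$ (this is $-f_1-2f_0/\theta$ if $\theta\ne0$), $a_{13}=\theta(f_3+2f_4\theta+2f_5\theta^2+2\theta^3)$ and $a_{23}=\theta^2(f_5+2\theta)$. It is the map induced by the addition of the Weierstrass point $(\theta_i,0)$. **Statement.** For each $i$: 1. $W_i$ is defined over $k(\theta_i)$ and is a linear isomorphism which maps $\mathcal K$ onto $\mathcal K^*$. It takes the node $N_0=(0:0:0:1)$ to the trope $T_i$, the node $N_{ij}$ to $T_j$ for $j\neq i$, and the node $N_{jl}$ to $T_{ijl}$ for distinct $j,l\ne i$. Here $N_{jl}$ is the point attached to $(\theta_j,0),(\theta_l,0)$; $T_j$ is the plane through $N_0$ and all $N_{jm}$, $m\ne j$; and $T_{ijl}$ is the plane through the $N_{mn}$ with $\{m,n\}\subset\{i,j,l\}$ or $\{m,n\}\cap\{i,j,l\}=\emptyset$. 2. $\varepsilon^{(i)}$ is defined over $k(\theta_i)$ and is an automorphism of $\mathcal S$ of order $2$, and $\varepsilon^{(i)}\varepsilon^{(j)}=\varepsilon^{(j)}\varepsilon^{(i)}$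 for all $j$. 3. ${\kappa^*}^{-1}\circ\varepsilon^{(i)}=W_i\circ\kappa^{-1}$ on all of $\mathcal S$, and $\varepsilon^{(i)}$ is the only automorphism $\varphi$ of $\mathcal S$ with ${\kappa^*}^{-1}\circ\varphi=W_i\circ\kappa^{-1}$. Thus the projective duality isomorphisms $W_i:\mathcal K\to\mathcal K^*$ lift to the commuting involutions $\varepsilon^{(i)}$ of $\mathcal S$. -/

import Mathlib

namespace KummerDuality

open Polynomial

/-! ## Projective varieties over an algebraically closed field, as sets of points -/

/-- The points of projective `n`-space over `K`. -/
abbrev PSpace (K : Type*) [Field K] (n : ℕ) : Type _ := Projectivization K (Fin (n + 1) → K)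

section Projective

variable {K : Type*} [Field K] {m n : ℕ}

/-- The polynomial `g` vanishes at the chosen representatives of all points of `X`.
It is used for homogeneous `g` only, where the choice does not matter. -/
def VanishesOn (g : MvPolynomial (Fin (n + 1)) K) (X : Set (PSpace K n)) : Prop :=
  ∀ x ∈ X, MvPolynomial.eval x.rep g = 0

/-- Zariski closure of a set of points in projective space. -/
def zariskiClosure (X : Set (PSpace K n)) : Set (PSpace K n) :=
  {x | ∀ (d : ℕ) (g : MvPolynomial (Fin (n + 1)) K), g.IsHomogeneous d → VanishesOn g X →
    MvPolynomial.eval x.rep g = 0}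

/-- A map between sets of points of projective spaces is regular (a morphism) if near every point
`x` it is given by forms `f₀, …, fₙ` of one common degree. The forms are not all zero at `x`, and
they give the map wherever they are not all zero. (Multiplying the `fⱼ` by a form that
cuts out the complement of a given neighbourhood of `x`, one sees that this is the usual local
condition.) -/
def IsRegularMap {X : Set (PSpace K m)} {Y : Set (PSpace K n)} (φ : X → Y) : Prop :=
  ∀ x : X, ∃ (d : ℕ) (f : Fin (n + 1) → MvPolynomial (Fin (m + 1)) K),
    (∀ j, (f j).IsHomogeneous d) ∧
    (fun j => MvPolynomial.eval x.1.rep (f j)) ≠ 0 ∧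
    ∀ (z : X) (hz : (fun j => MvPolynomial.eval z.1.rep (f j)) ≠ 0),
      (φ z : PSpace K n) = Projectivization.mk K _ hz

/-- An automorphism of a variety: a bijection that is regular together with its inverse. -/
def IsAutomorphism {X : Set (PSpace K m)} (φ : Equiv.Perm X) : Prop :=
  IsRegularMap (φ : X → X) ∧ IsRegularMap (φ.symm : X → X)

/-- The point `η` of the dual space (identified with `ℙⁿ` by coordinates: `η` stands for the
hyperplane `∑ ηⱼ ξⱼ = 0`) is the tangent hyperplane to the hypersurface `X` at its point `ξ`:
the gradients at `ξ` of the forms vanishing on `X` span the line `K η`.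
In particular they are not all zero, so `ξ` is a smooth point. -/
def IsTangentHyperplane (X : Set (PSpace K n)) (ξ η : PSpace K n) : Prop :=
  ξ ∈ X ∧
  Submodule.span K {w : Fin (n + 1) → K | ∃ (d : ℕ) (g : MvPolynomial (Fin (n + 1)) K),
    g.IsHomogeneous d ∧ VanishesOn g X ∧
    w = fun j => MvPolynomial.eval ξ.rep (MvPolynomial.pderiv j g)} = η.submodule

/-- The projective dual of a hypersurface: the closure of the set of its tangent hyperplanes. -/
def projectiveDual (X : Set (PSpace K n)) : Set (PSpace K n) :=
  zariskiClosure {η | ∃ ξ, IsTangentHyperplane X ξ η}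

end Projective

section Kummer

variable {K : Type*} [Field K]

/-- `F(X) = ∏ᵢ (X - θᵢ) = f₀ + f₁ X + ⋯ + f₅ X⁵ + X⁶`. -/
noncomputable def sextic (θ : Fin 6 → K) : K[X] := ∏ i, (X - C (θ i))

/-- `F₀(x,u) = 2f₀ + f₁(x+u) + 2f₂xu + f₃xu(x+u) + 2f₄(xu)² + f₅(xu)²(x+u) + 2f₆(xu)³`. -/
noncomputable def F₀ (F : K[X]) (x u : K) : K :=
  2 * F.coeff 0 + F.coeff 1 * (x + u) + 2 * F.coeff 2 * (x * u)
    + F.coeff 3 * (x * u) * (x + u) + 2 * F.coeff 4 * (x * u) ^ 2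
    + F.coeff 5 * (x * u) ^ 2 * (x + u) + 2 * F.coeff 6 * (x * u) ^ 3

/-- The coordinates `(1, x + u, x u, β₀)` attached to the divisor `(x,y) + (u,v)`, `x ≠ u`. -/
noncomputable def kummerCoord (F : K[X]) (x y u v : K) : Fin 4 → K :=
  ![1, x + u, x * u, (F₀ F x u - 2 * y * v) / (x - u) ^ 2]

theorem kummerCoord_ne_zero (F : K[X]) (x y u v : K) : kummerCoord F x y u v ≠ 0 := by
  intro h
  have := congrFun h 0
  simp [kummerCoord] at this

/-- The point of `ℙ³` attached to the divisor `(x,y) + (u,v)`, `x ≠ u`. -/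
noncomputable def kummerPoint (F : K[X]) (x y u v : K) : PSpace K 3 :=
  Projectivization.mk K (kummerCoord F x y u v) (kummerCoord_ne_zero F x y u v)

/-- The Kummer surface belonging to the curve `Y² = F(X)`: the projective locus (Zariski closure)
of the points attached to pairs of points of the curve. -/
def kummer (θ : Fin 6 → K) : Set (PSpace K 3) :=
  zariskiClosure {ξ | ∃ x y u v : K, y ^ 2 = (sextic θ).eval x ∧ v ^ 2 = (sextic θ).eval u ∧
    x ≠ u ∧ ξ = kummerPoint (sextic θ) x y u v}

/-- The dual Kummer surface. -/
def kummerDual (θ : Fin 6 → K) : Set (PSpace K 3) := projectiveDual (kummer θ)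

/-- The polynomial `p₀ + p₁ X + ⋯ + p₅ X⁵`. -/
noncomputable def toPoly : (Fin 6 → K) →ₗ[K] K[X] where
  toFun p := ∑ j : Fin 6, C (p j) * X ^ (j : ℕ)
  map_add' p q := by simp [add_mul, Finset.sum_add_distrib]
  map_smul' c p := by simp [Finset.smul_sum, smul_eq_C_mul, mul_assoc]

/-- The surface `𝒮 ⊂ ℙ⁵`: the `p` for which `P(X)²` is congruent to a polynomial of degree at
most `2` modulo `F`. -/
def desingKummer (θ : Fin 6 → K) : Set (PSpace K 5) :=
  {s | ((toPoly s.rep ^ 2) %ₘ sextic θ).degree ≤ 2}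

/-- `s = κ(ξ)` for a general point `ξ` of the Kummer surface, attached to `(x,y) + (u,v)` with
`y v ≠ 0` and `x ≠ u`. The cubic `Y = M(X)` meets the curve twice at `(x,y)` and at `(u,v)`, and
`P` is determined by `(X - x)(X - u) P ≡ M mod F`. -/
def IsKappa (θ : Fin 6 → K) (ξ : PSpace K 3) (s : PSpace K 5) : Prop :=
  ∃ (x y u v : K) (M : K[X]) (p : Fin 6 → K) (hp : p ≠ 0),
    y ^ 2 = (sextic θ).eval x ∧ v ^ 2 = (sextic θ).eval u ∧ y * v ≠ 0 ∧ x ≠ u ∧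
    M.natDegree ≤ 3 ∧ M.eval x = y ∧ M.eval u = v ∧
    (X - C x) ^ 2 ∣ M ^ 2 - sextic θ ∧ (X - C u) ^ 2 ∣ M ^ 2 - sextic θ ∧
    sextic θ ∣ (X - C x) * (X - C u) * toPoly p - M ∧
    ξ = kummerPoint (sextic θ) x y u v ∧ s = Projectivization.mk K p hp

/-- `f` is the blow-down `κ⁻¹ : 𝒮 → 𝒦`: a morphism on all of `𝒮` that extends the inverse of the
birational map `κ`. -/
def IsBlowDown (θ : Fin 6 → K) (f : desingKummer θ → kummer θ) : Prop :=
  IsRegularMap f ∧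
  ∀ (ξ : kummer θ) (s : desingKummer θ), IsKappa θ ξ s → f s = ξ

/-- `f` is the blow-down `κ*⁻¹ : 𝒮 → 𝒦*`: a morphism on all of `𝒮` that extends the inverse of the
birational map `κ*`, where `κ*(η) = κ(ξ)` if `η` is the tangent plane to `𝒦` at `ξ`. -/
def IsDualBlowDown (θ : Fin 6 → K) (f : desingKummer θ → kummerDual θ) : Prop :=
  IsRegularMap f ∧
  ∀ (ξ : kummer θ) (η : kummerDual θ) (s : desingKummer θ),
    IsTangentHyperplane (kummer θ) ξ η → IsKappa θ ξ s → f s = η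

/-! ### The involutions `ε⁽ⁱ⁾` -/

/-- `Pᵢ(X) = ∏_{j ≠ i} (X - θⱼ)`. -/
noncomputable def cofactor (θ : Fin 6 → K) (i : Fin 6) : K[X] :=
  ∏ j ∈ Finset.univ.erase i, (X - C (θ j))

/-- `gᵢ(X) = 1 - 2 Pᵢ(X) / Pᵢ(θᵢ)`. -/
noncomputable def gPoly (θ : Fin 6 → K) (i : Fin 6) : K[X] :=
  1 - C (2 / (cofactor θ i).eval (θ i)) * cofactor θ i

/-- The linear map `P ↦ gᵢ P mod F` on coefficient vectors. -/
noncomputable def epsLin (θ : Fin 6 → K) (i : Fin 6) : (Fin 6 → K) →ₗ[K] (Fin 6 → K) :=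
  LinearMap.pi fun j =>
    (lcoeff K (j : ℕ)) ∘ₗ (modByMonicHom (sextic θ)) ∘ₗ (LinearMap.mulLeft K (gPoly θ i)) ∘ₗ toPoly

theorem epsLin_apply (θ : Fin 6 → K) (i : Fin 6) (p : Fin 6 → K) (j : Fin 6) :
    epsLin θ i p j = ((gPoly θ i * toPoly p) %ₘ sextic θ).coeff j := rfl

theorem sextic_monic (θ : Fin 6 → K) : (sextic θ).Monic :=
  monic_prod_of_monic _ _ fun i _ => monic_X_sub_C (θ i)

theorem sextic_natDegree (θ : Fin 6 → K) : (sextic θ).natDegree = 6 := by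
  simp [sextic, natDegree_prod_of_monic _ _ fun i _ => monic_X_sub_C (θ i)]

theorem coeff_toPoly (p : Fin 6 → K) (j : Fin 6) : (toPoly p).coeff j = p j := by
  simp [toPoly, coeff_C_mul, coeff_X_pow, Fin.val_inj]

theorem toPoly_coeff (Q : K[X]) (hQ : Q.degree < 6) : toPoly (fun j => Q.coeff j) = Q := by
  have h : Q.natDegree < 6 := by
    by_cases h0 : Q = 0
    · simp [h0]
    · exact (natDegree_lt_iff_degree_lt h0).2 (by exact_mod_cast hQ)
  rw [Q.as_sum_range' 6 h]
  simp only [toPoly, LinearMap.coe_mk, AddHom.coe_mk]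
  rw [← Q.as_sum_range' 6 h, Fin.sum_univ_eq_sum_range (fun j => C (Q.coeff j) * X ^ j) 6]
  conv_rhs => rw [Q.as_sum_range' 6 h]
  simp [C_mul_X_pow_eq_monomial]

theorem toPoly_epsLin (θ : Fin 6 → K) (i : Fin 6) (p : Fin 6 → K) :
    toPoly (epsLin θ i p) = (gPoly θ i * toPoly p) %ₘ sextic θ := by
  refine toPoly_coeff _ ?_
  have h := degree_modByMonic_lt (gPoly θ i * toPoly p) (sextic_monic θ)
  rwa [degree_eq_natDegree (sextic_monic θ).ne_zero, sextic_natDegree] at h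

theorem sextic_dvd (θ : Fin 6 → K) (i : Fin 6) : sextic θ = (X - C (θ i)) * cofactor θ i :=
  (Finset.mul_prod_erase _ _ (Finset.mem_univ i)).symm

theorem cofactor_eval_ne_zero {θ : Fin 6 → K} (hθ : Function.Injective θ) (i : Fin 6) :
    (cofactor θ i).eval (θ i) ≠ 0 := by
  rw [cofactor, eval_prod, Finset.prod_ne_zero_iff]
  intro j hj
  simpa [sub_eq_zero] using fun h => (Finset.ne_of_mem_erase hj) (hθ h).symm

theorem sextic_dvd_gPoly_sq {θ : Fin 6 → K} (hθ : Function.Injective θ) (i : Fin 6) :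
    sextic θ ∣ gPoly θ i ^ 2 - 1 := by
  set c := (cofactor θ i).eval (θ i) with hc
  have hc0 : c ≠ 0 := cofactor_eval_ne_zero hθ i
  have h1 : X - C (θ i) ∣ cofactor θ i - C c := by
    rw [hc]; exact X_sub_C_dvd_sub_C_eval
  obtain ⟨q, hq⟩ := h1
  have e : gPoly θ i ^ 2 - 1 = C (4 / c ^ 2) * (cofactor θ i * (cofactor θ i - C c)) := by
    have h4 : (C (4 / c ^ 2) : K[X]) = C (2 / c) ^ 2 := by
      rw [← C_pow]; congr 1; ring
    have h5 : (C (2 / c) * C c : K[X]) = 2 := by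
      rw [← C_mul, div_mul_cancel₀ _ hc0]; rfl
    rw [gPoly, ← hc, h4]
    linear_combination (C (2 / c) * cofactor θ i) * h5
  rw [e, hq, sextic_dvd θ i]
  exact ⟨C (4 / c ^ 2) * q, by ring⟩

theorem epsLin_epsLin {θ : Fin 6 → K} (hθ : Function.Injective θ) (i : Fin 6) (p : Fin 6 → K) :
    epsLin θ i (epsLin θ i p) = p := by
  have h : toPoly (epsLin θ i (epsLin θ i p)) = toPoly p := by
    have hp : toPoly p = toPoly p %ₘ sextic θ := by
      refine ((modByMonic_eq_self_iff (sextic_monic θ)).2 ?_).symm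
      rw [degree_eq_natDegree (sextic_monic θ).ne_zero, sextic_natDegree]
      simp only [toPoly, LinearMap.coe_mk, AddHom.coe_mk]
      exact degree_sum_fin_lt p
    rw [hp, toPoly_epsLin, toPoly_epsLin]
    refine modByMonic_eq_of_dvd_sub (sextic_monic θ) ?_
    obtain ⟨q, hq⟩ := sextic_dvd_gPoly_sq hθ i
    have hm := modByMonic_add_div (gPoly θ i * toPoly p) (sextic θ)
    refine ⟨q * toPoly p - gPoly θ i * ((gPoly θ i * toPoly p) /ₘ sextic θ), ?_⟩
    linear_combination (gPoly θ i) * hm + (toPoly p) * hq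
  funext j
  rw [← coeff_toPoly (epsLin θ i (epsLin θ i p)) j, h, coeff_toPoly]

theorem epsLin_injective {θ : Fin 6 → K} (hθ : Function.Injective θ) (i : Fin 6) :
    Function.Injective (epsLin θ i) :=
  Function.LeftInverse.injective (epsLin_epsLin hθ i)

/-- `ε⁽ⁱ⁾` on `ℙ⁵`. -/
noncomputable def epsProj {θ : Fin 6 → K} (hθ : Function.Injective θ) (i : Fin 6) :
    PSpace K 5 → PSpace K 5 :=
  Projectivization.map (epsLin θ i) (epsLin_injective hθ i)

theorem epsProj_epsProj {θ : Fin 6 → K} (hθ : Function.Injective θ) (i : Fin 6)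
    (s : PSpace K 5) : epsProj hθ i (epsProj hθ i s) = s := by
  induction s using Projectivization.ind with
  | h v hv =>
    rw [epsProj, Projectivization.map_mk, Projectivization.map_mk]
    exact (Projectivization.mk_eq_mk_iff' K _ _ _ _).2 ⟨1, by rw [one_smul, epsLin_epsLin hθ]⟩

theorem mk_mem_desingKummer (θ : Fin 6 → K) (p : Fin 6 → K) (hp : p ≠ 0) :
    (Projectivization.mk K p hp : PSpace K 5) ∈ desingKummer θ ↔
      ((toPoly p ^ 2) %ₘ sextic θ).degree ≤ 2 := by
  obtain ⟨a, ha⟩ := Projectivization.exists_smul_eq_mk_rep K p hp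
  have ha' : (a : K) ^ 2 ≠ 0 := pow_ne_zero _ a.ne_zero
  change ((toPoly (Projectivization.mk K p hp).rep ^ 2) %ₘ sextic θ).degree ≤ 2 ↔ _
  rw [← ha, Units.smul_def, map_smul, _root_.smul_pow, smul_modByMonic,
    degree_smul_of_smul_regular _ (IsSMulRegular.of_ne_zero ha')]

theorem epsProj_mem {θ : Fin 6 → K} (hθ : Function.Injective θ) (i : Fin 6) {s : PSpace K 5}
    (hs : s ∈ desingKummer θ) : epsProj hθ i s ∈ desingKummer θ := by
  induction s using Projectivization.ind with
  | h v hv =>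
    rw [mk_mem_desingKummer] at hs
    rw [epsProj, Projectivization.map_mk, mk_mem_desingKummer, toPoly_epsLin]
    convert hs using 2
    refine modByMonic_eq_of_dvd_sub (sextic_monic θ) ?_
    obtain ⟨q, hq⟩ := sextic_dvd_gPoly_sq hθ i
    have hm := modByMonic_add_div (gPoly θ i * toPoly v) (sextic θ)
    set r := (gPoly θ i * toPoly v) %ₘ sextic θ
    set t := (gPoly θ i * toPoly v) /ₘ sextic θ
    refine ⟨q * toPoly v ^ 2 - t * (r + gPoly θ i * toPoly v), ?_⟩
    linear_combination (r + gPoly θ i * toPoly v) * hm + (toPoly v ^ 2) * hq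

/-- The map `ε⁽ⁱ⁾ : 𝒮 → 𝒮`, `P ↦ gᵢ P mod F`. -/
noncomputable def epsilon {θ : Fin 6 → K} (hθ : Function.Injective θ) (i : Fin 6) :
    Equiv.Perm (desingKummer θ) where
  toFun s := ⟨epsProj hθ i s, epsProj_mem hθ i s.2⟩
  invFun s := ⟨epsProj hθ i s, epsProj_mem hθ i s.2⟩
  left_inv s := Subtype.ext (epsProj_epsProj hθ i s)
  right_inv s := Subtype.ext (epsProj_epsProj hθ i s)

/-! ### The linear maps `Wᵢ` -/

/-- The antisymmetric matrix of the map `Wᵢ : ℙ³ → (ℙ³)^∨` induced by the addition of the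
Weierstrass point `(t, 0)`, `t = θᵢ`. The upper left entry `a₁₂` is the polynomial form of
`-f₁ - 2 f₀ / t`, which makes sense for `t = 0` too. -/
noncomputable def weierstrassMatrix (F : K[X]) (t : K) : Matrix (Fin 4) (Fin 4) K :=
  let a₁₂ := F.coeff 1 + 2 * F.coeff 2 * t + 2 * F.coeff 3 * t ^ 2 + 2 * F.coeff 4 * t ^ 3
    + 2 * F.coeff 5 * t ^ 4 + 2 * t ^ 5
  let a₁₃ := t * (F.coeff 3 + 2 * F.coeff 4 * t + 2 * F.coeff 5 * t ^ 2 + 2 * t ^ 3)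
  let a₂₃ := t ^ 2 * (F.coeff 5 + 2 * t)
  !![0, a₁₂, a₁₃, t ^ 2;
     -a₁₂, 0, a₂₃, -t;
     -a₁₃, -a₂₃, 0, 1;
     -t ^ 2, t, -1, 0]

theorem sextic_expand (θ : Fin 6 → K) :
    sextic θ = C ((sextic θ).coeff 0) + C ((sextic θ).coeff 1) * X
      + C ((sextic θ).coeff 2) * X ^ 2 + C ((sextic θ).coeff 3) * X ^ 3
      + C ((sextic θ).coeff 4) * X ^ 4 + C ((sextic θ).coeff 5) * X ^ 5 + X ^ 6 := by
  have h6 : (sextic θ).coeff 6 = 1 := by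
    have := (sextic_monic θ).coeff_natDegree
    rwa [sextic_natDegree] at this
  conv_lhs => rw [(sextic θ).as_sum_range_C_mul_X_pow, sextic_natDegree]
  simp [Finset.sum_range_succ, h6]

/-- The entry `a₁₂` in the form with a division, for a nonzero root. -/
theorem weierstrassMatrix_zero_one (θ : Fin 6 → K) (i : Fin 6) (h : θ i ≠ 0) :
    weierstrassMatrix (sextic θ) (θ i) 0 1
      = -(sextic θ).coeff 1 - 2 * ((sextic θ).coeff 0 / θ i) := by
  have h0 : (sextic θ).eval (θ i) = 0 := by rw [sextic_dvd θ i]; simp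
  rw [sextic_expand θ] at h0
  simp only [eval_add, eval_mul, eval_C, eval_X, eval_pow] at h0
  simp only [weierstrassMatrix, Matrix.of_apply, Matrix.cons_val', Matrix.cons_val_zero,
    Matrix.cons_val_one]
  field_simp
  linear_combination 2 * h0

theorem weierstrassMatrix_injective {θ : Fin 6 → K} (hθ : Function.Injective θ) (i : Fin 6) :
    Function.Injective (Matrix.toLin' (weierstrassMatrix (sextic θ) (θ i))) := by
  have hd : (derivative (sextic θ)).eval (θ i) ≠ 0 := by
    rw [sextic_dvd θ i]
    simpa [derivative_mul] using cofactor_eval_ne_zero hθ i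
  rw [sextic_expand θ] at hd
  simp only [derivative_add, derivative_mul, derivative_C, derivative_X, derivative_X_pow,
    eval_add, eval_mul, eval_C, eval_X, eval_pow, eval_zero, eval_one, map_natCast,
    eval_natCast] at hd
  rw [← LinearMap.ker_eq_bot, LinearMap.ker_eq_bot']
  intro w hw
  rw [Matrix.toLin'_apply] at hw
  have e0 := congrFun hw 0
  have e1 := congrFun hw 1
  have e2 := congrFun hw 2
  have e3 := congrFun hw 3
  simp [weierstrassMatrix, Matrix.mulVec, dotProduct, Fin.sum_univ_four] at e0 e1 e2 e3
  set t := θ i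
  set f1 := (sextic θ).coeff 1
  set f2 := (sextic θ).coeff 2
  set f3 := (sextic θ).coeff 3
  set f4 := (sextic θ).coeff 4
  set f5 := (sextic θ).coeff 5
  push_cast at hd
  have k0 : w 0 = 0 := by
    refine (mul_eq_zero.1 ?_).resolve_left hd
    linear_combination -e1 - t * e2 + (-(t ^ 2 * (f5 + 2 * t))) * e3
  have k1 : w 1 = 0 := by
    refine (mul_eq_zero.1 ?_).resolve_left hd
    linear_combination e0 - t ^ 2 * e2
      + (t * (f3 + 2 * f4 * t + 2 * f5 * t ^ 2 + 2 * t ^ 3)) * e3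
  rw [k0, k1] at e3
  have k2 : w 2 = 0 := by simpa using e3
  rw [k0, k1] at e2
  have k3 : w 3 = 0 := by simpa using e2
  funext j
  fin_cases j <;> assumption

/-- The projective linear map `Wᵢ : ℙ³ → (ℙ³)^∨ = ℙ³`. -/
noncomputable def weierstrassMap {θ : Fin 6 → K} (hθ : Function.Injective θ) (i : Fin 6) :
    PSpace K 3 → PSpace K 3 :=
  Projectivization.map (Matrix.toLin' (weierstrassMatrix (sextic θ) (θ i)))
    (weierstrassMatrix_injective hθ i)

/-- The point `ξ` lies in the plane with dual coordinates `η`. -/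
def Incident (ξ η : PSpace K 3) : Prop := ∑ a, η.rep a * ξ.rep a = 0

/-- The node `N₀ = (0 : 0 : 0 : 1)`. -/
def node₀ : PSpace K 3 :=
  Projectivization.mk K ![0, 0, 0, 1] (fun h => by simpa using congrFun h 3)

/-- The node `Nᵢⱼ` attached to the divisor `(θᵢ, 0) + (θⱼ, 0)`, `i ≠ j`. -/
noncomputable def node (θ : Fin 6 → K) (i j : Fin 6) : PSpace K 3 :=
  kummerPoint (sextic θ) (θ i) 0 (θ j) 0

/-- The plane `η` is the trope `Tᵢ`: it contains `N₀` and the `Nᵢⱼ`, `j ≠ i`. -/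
def IsTrope₁ (θ : Fin 6 → K) (i : Fin 6) (η : PSpace K 3) : Prop :=
  Incident node₀ η ∧ ∀ j, j ≠ i → Incident (node θ i j) η

/-- The plane `η` is the trope `Tᵢⱼₖ`: it contains the `Nₘₙ` with `{m,n} ⊂ {i,j,k}` or
`{m,n} ∩ {i,j,k} = ∅`. -/
def IsTrope₃ (θ : Fin 6 → K) (i j k : Fin 6) (η : PSpace K 3) : Prop :=
  ∀ m n, m ≠ n →
    (({m, n} : Set (Fin 6)) ⊆ {i, j, k} ∨ Disjoint ({m, n} : Set (Fin 6)) {i, j, k}) →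
    Incident (node θ m n) η

end Kummer

end KummerDuality

open KummerDuality

/-!
The theorem is an instance of the Klein correspondence. Describe a polynomial `P` by its values
`tᵢ = P(θᵢ)`. The point `P` lies on `𝒮` if and only if `tᵢ² = q(θᵢ)` for a quadratic polynomial
`q`, and then the sums `∑ θᵢᵐ tᵢ² / F'(θᵢ)`, `m = 0, 1, 2`, vanish (`mem_desingKummer_iff`,
`Cone.onCone`). The skew matrices `Wᵢ` form an orthogonal basis of the space of skew `4 × 4`
matrices for the polar form of the Pfaffian, with `pf(Wᵢ, Wᵢ) = 2 F'(θᵢ)` (`isFrame_omega`). So the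
two skew matrices `∑ (tᵢ / F'(θᵢ)) Wᵢ` attached to `P` and to `X P` are isotropic and orthogonal:
they are two lines of `ℙ³` that meet, and they span a pencil of lines, which has a centre (a point)
and a plane. The centre is `κ⁻¹(P)` and the plane is `κ*⁻¹(P)`. Both are given by quadratic forms in
`P` without common zeros on `𝒮` (`IsFrame.exists_col`), so both blow-downs are defined everywhere.

The involution `ε⁽ⁱ⁾` changes the sign of `tᵢ`, so it acts on skew matrices as the reflection
`L ↦ L - (pf(L, Wᵢ) / F'(θᵢ)) Wᵢ`. This swaps the two families of planes on the Klein quadric, and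
the Clifford relation shows that `Wᵢ` maps the centre of the pencil of `P` to the plane of the pencil of
`ε⁽ⁱ⁾ P` (`IsFrame.isCentre_reflect`). This is the commutative square, at all points of `𝒮`.

To compare this with the definitions by closures and birational maps, one needs that the centre of
the pencil of `κ(ξ)` is `ξ` and that its plane is the gradient of the quartic equation of `𝒦` at `ξ`
(`isCentre_pointCoord`, `isCentre_planeCoord`, `eval_pderiv_quartic`), that forms vanishing on `𝒦`
are multiples of the quartic up to a power of its leading coefficient (`exists_quartic_mul`), and
that the image of `κ` is dense in `𝒮`. For the last point the cone over `𝒮` is shown to be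
irreducible, by Kummer theory for the square roots of the six forms `q(θᵢ)` (`cone_irreducible`).
The lift of `Wᵢ` is unique because `κ⁻¹` is injective over the general points of `𝒦`
(`KappaData.eq_smul_of_isCentre`), and `Wᵢ` maps `𝒦` onto `𝒦*` because it and its inverse do so at
general points. The statements on nodes and tropes are identities between the symmetric functions
of the roots.
-/

namespace KummerDuality

open Polynomial

/-! ### Skew forms on a four-dimensional space and the Klein quadric -/

section Skew

variable {K : Type*} [Field K]

/-- The antisymmetric `4 × 4` matrix with the entries
`(a₀₁, a₀₂, a₀₃, a₁₂, a₁₃, a₂₃)` above the diagonal. -/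
def skew (l : Fin 6 → K) : Matrix (Fin 4) (Fin 4) K :=
  !![0, l 0, l 1, l 2; -l 0, 0, l 3, l 4; -l 1, -l 3, 0, l 5; -l 2, -l 4, -l 5, 0]

/-- The Pfaffian adjoint `l*` of a skew form: `skew l* * skew l` is minus the Pfaffian of `l`. -/
def pfAdj (l : Fin 6 → K) : Fin 6 → K := ![l 5, -l 4, l 3, l 2, -l 1, l 0]

/-- The polar form of the Pfaffian. A nonzero skew form has rank `2`, so represents a line of
`ℙ³`, if and only if `pf l l = 0` (this is the Klein quadric). -/
def pf (l m : Fin 6 → K) : K :=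
  l 0 * m 5 + l 5 * m 0 - l 1 * m 4 - l 4 * m 1 + l 2 * m 3 + l 3 * m 2

theorem pfAdj_add (l m : Fin 6 → K) : pfAdj (l + m) = pfAdj l + pfAdj m := by
  funext i; fin_cases i <;> simp [pfAdj] <;> ring

theorem pfAdj_smul (c : K) (l : Fin 6 → K) : pfAdj (c • l) = c • pfAdj l := by
  funext i; fin_cases i <;> simp [pfAdj]

theorem pf_pfAdj_pfAdj (l m : Fin 6 → K) : pf (pfAdj l) (pfAdj m) = pf l m := by
  simp [pf, pfAdj]; ring

theorem skew_add (l m : Fin 6 → K) : skew (l + m) = skew l + skew m := by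
  ext i j; fin_cases i <;> fin_cases j <;> simp [skew] <;> ring

theorem skew_smul (c : K) (l : Fin 6 → K) : skew (c • l) = c • skew l := by
  ext i j; fin_cases i <;> fin_cases j <;> simp [skew]

/-- `v` lies in the kernels of both skew forms: if it is nonzero, it represents a common point of
the two lines. -/
def Common (l m : Fin 6 → K) (v : Fin 4 → K) : Prop :=
  (skew l).mulVec v = 0 ∧ (skew m).mulVec v = 0

theorem skew_mulVec (l : Fin 6 → K) (v : Fin 4 → K) : (skew l).mulVec v =
    ![l 0 * v 1 + l 1 * v 2 + l 2 * v 3, -(l 0 * v 0) + l 3 * v 2 + l 4 * v 3,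
      -(l 1 * v 0) - l 3 * v 1 + l 5 * v 3, -(l 2 * v 0) - l 4 * v 1 - l 5 * v 2] := by
  funext i
  fin_cases i <;> simp [skew, Matrix.mulVec, dotProduct, Fin.sum_univ_four] <;> ring

/-- The Clifford relation: `skew` and `skew ∘ pfAdj` are the two halves of the Clifford module
of the quadratic space of skew forms with the Pfaffian. -/
theorem clifford (l m : Fin 6 → K) (v : Fin 4 → K) :
    (skew (pfAdj l)).mulVec ((skew m).mulVec v) + (skew (pfAdj m)).mulVec ((skew l).mulVec v)
      = -pf l m • v := by
  simp only [skew_mulVec]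
  funext i
  fin_cases i <;> simp [pfAdj, pf] <;> ring

/-- For two isotropic orthogonal skew forms this matrix has rank one: its columns are multiples
of the common point of the two lines. -/
def flag (l m : Fin 6 → K) : Matrix (Fin 4) (Fin 4) K := skew (pfAdj l) * skew m

theorem skew_mul_skew_pfAdj (l : Fin 6 → K) (h2 : (2 : K) ≠ 0) (h : pf l l = 0) :
    skew l * skew (pfAdj l) = 0 := by
  have h' : l 0 * l 5 - l 1 * l 4 + l 2 * l 3 = 0 := by
    refine (mul_eq_zero.1 ?_).resolve_left h2
    rw [← h]; simp only [pf]; ring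
  ext i j
  fin_cases i <;> fin_cases j <;>
    simp [skew, pfAdj, Matrix.mul_apply, Fin.sum_univ_four] <;>
    first | ring1 | linear_combination h' | linear_combination -h'

theorem skew_pfAdj_mul_skew (l m : Fin 6 → K) (h : pf l m = 0) :
    skew (pfAdj l) * skew m = -(skew (pfAdj m) * skew l) := by
  rw [eq_neg_iff_add_eq_zero]
  simp only [pf] at h
  ext i j
  fin_cases i <;> fin_cases j <;>
    simp [skew, pfAdj] <;>
    first | ring1 | linear_combination h | linear_combination -h

/-- The columns of the flag matrix of an isotropic pair lie in the kernels of both forms. -/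
theorem common_flag_col (l m : Fin 6 → K) (h2 : (2 : K) ≠ 0) (hl : pf l l = 0) (hm : pf m m = 0)
    (hlm : pf l m = 0) (b : Fin 4) : Common l m (fun a => flag l m a b) := by
  have e1 : skew l * flag l m = 0 := by
    rw [flag, ← Matrix.mul_assoc, skew_mul_skew_pfAdj l h2 hl, Matrix.zero_mul]
  have e2 : skew m * flag l m = 0 := by
    rw [flag, skew_pfAdj_mul_skew l m hlm, Matrix.mul_neg, ← Matrix.mul_assoc,
      skew_mul_skew_pfAdj m h2 hm, Matrix.zero_mul, neg_zero]
  constructor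
  · funext a; exact congrFun (congrFun e1 a) b
  · funext a; exact congrFun (congrFun e2 a) b

/-- Conversely each common kernel vector is proportional to the columns of the flag matrix. -/
theorem Common.flag_mul {l m : Fin 6 → K} {v : Fin 4 → K} (h : Common l m v) (a c b : Fin 4) :
    v a * flag l m c b = v c * flag l m a b := by
  obtain ⟨h1, h3⟩ := h
  rw [skew_mulVec] at h1 h3
  have e0 := congrFun h1 0
  have e1 := congrFun h1 1
  have e2 := congrFun h1 2
  have e3 := congrFun h1 3
  have g0 := congrFun h3 0
  have g1 := congrFun h3 1
  have g2 := congrFun h3 2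
  have g3 := congrFun h3 3
  simp at e0 e1 e2 e3 g0 g1 g2 g3
  -- `v ∧ l* = 0` because `v` is in the kernel of `skew l`
  have key : ∀ a c : Fin 4, ∀ d, v a * skew (pfAdj l) c d + v c * skew (pfAdj l) d a
      + v d * skew (pfAdj l) a c = 0 := by
    intro a c d
    fin_cases a <;> fin_cases c <;> fin_cases d <;> simp [skew, pfAdj] <;>
      first | ring1 | linear_combination e0 | linear_combination -e0 | linear_combination e1 |
        linear_combination -e1 | linear_combination e2 | linear_combination -e2 |
        linear_combination e3 | linear_combination -e3
  have anti : ∀ a c : Fin 4, skew (pfAdj l) a c = - skew (pfAdj l) c a := by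
    intro a c
    fin_cases a <;> fin_cases c <;> simp [skew]
  have k3 : ∑ d, v d * skew m d b = 0 := by
    fin_cases b <;> simp [skew, Fin.sum_univ_four]
    · linear_combination -g0
    · linear_combination -g1
    · linear_combination -g2
    · linear_combination -g3
  have : v a * flag l m c b - v c * flag l m a b
      = ∑ d, (-(skew (pfAdj l) a c)) * (v d * skew m d b) := by
    simp only [flag, Matrix.mul_apply, Finset.mul_sum]
    rw [← Finset.sum_sub_distrib]
    refine Finset.sum_congr rfl fun d _ => ?_
    linear_combination skew m d b * key a c d - v c * skew m d b * anti d a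
  rw [← Finset.mul_sum, k3, mul_zero] at this
  exact sub_eq_zero.1 this

/-- The two by two minors of the pair `l, m` are linear combinations of the entries of the flag
matrix; this is the isomorphism of `Λ²(Λ² V)` with the traceless endomorphisms of `V`. -/
theorem minor_eq_zero_of_flag_eq_zero (l m : Fin 6 → K) (h2 : (2 : K) ≠ 0) (h : flag l m = 0)
    (i j : Fin 6) : l i * m j = l j * m i := by
  have e : ∀ a b, flag l m a b = 0 := fun a b => by rw [h]; rfl
  simp only [flag, Matrix.mul_apply, Fin.sum_univ_four] at e
  have e00 := e 0 0
  have e01 := e 0 1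
  have e02 := e 0 2
  have e03 := e 0 3
  have e10 := e 1 0
  have e11 := e 1 1
  have e12 := e 1 2
  have e13 := e 1 3
  have e20 := e 2 0
  have e21 := e 2 1
  have e22 := e 2 2
  have e23 := e 2 3
  have e30 := e 3 0
  have e31 := e 3 1
  have e32 := e 3 2
  have e33 := e 3 3
  clear e h
  simp [skew, pfAdj] at *
  apply mul_left_cancel₀ h2
  fin_cases i <;> fin_cases j <;> simp <;> grind

end Skew

/-! ### The Klein frame belonging to six points -/

section Frame

variable {K : Type*} [Field K]

/-- The residue weight `F'(θᵢ)`. -/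
noncomputable def wt (θ : Fin 6 → K) (i : Fin 6) : K := (cofactor θ i).eval (θ i)

theorem wt_ne_zero {θ : Fin 6 → K} (hθ : Function.Injective θ) (i : Fin 6) : wt θ i ≠ 0 :=
  cofactor_eval_ne_zero hθ i

theorem sextic_eval_root (θ : Fin 6 → K) (i : Fin 6) : (sextic θ).eval (θ i) = 0 := by
  rw [sextic_dvd θ i]; simp

theorem sextic_deriv_eval (θ : Fin 6 → K) (i : Fin 6) :
    (derivative (sextic θ)).eval (θ i) = wt θ i := by
  rw [sextic_dvd θ i]
  simp [derivative_mul, wt]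

theorem sextic_coeff_six (θ : Fin 6 → K) : (sextic θ).coeff 6 = 1 := by
  have := (sextic_monic θ).coeff_natDegree
  rwa [sextic_natDegree] at this

theorem sextic_eval (θ : Fin 6 → K) (x : K) :
    (sextic θ).eval x = (sextic θ).coeff 0 + (sextic θ).coeff 1 * x + (sextic θ).coeff 2 * x ^ 2
      + (sextic θ).coeff 3 * x ^ 3 + (sextic θ).coeff 4 * x ^ 4 + (sextic θ).coeff 5 * x ^ 5
      + x ^ 6 := by
  conv_lhs => rw [sextic_expand θ]
  simp

theorem sextic_deriv (θ : Fin 6 → K) (x : K) :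
    (derivative (sextic θ)).eval x = (sextic θ).coeff 1 + 2 * (sextic θ).coeff 2 * x
      + 3 * (sextic θ).coeff 3 * x ^ 2 + 4 * (sextic θ).coeff 4 * x ^ 3
      + 5 * (sextic θ).coeff 5 * x ^ 4 + 6 * x ^ 5 := by
  conv_lhs => rw [sextic_expand θ]
  simp
  ring

theorem sextic_dvd_iff {θ : Fin 6 → K} (hθ : Function.Injective θ) (P : K[X]) :
    sextic θ ∣ P ↔ ∀ i, P.eval (θ i) = 0 := by
  constructor
  · rintro ⟨q, rfl⟩ i
    simp [sextic_eval_root]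
  · intro h
    refine Finset.prod_dvd_of_coprime ?_ fun i _ => dvd_iff_isRoot.2 (h i)
    intro i _ j _ hij
    exact isCoprime_X_sub_C_of_isUnit_sub (sub_ne_zero.2 (hθ.ne hij)).isUnit

theorem eq_zero_of_eval_roots {θ : Fin 6 → K} (hθ : Function.Injective θ) {P : K[X]}
    (hd : P.natDegree ≤ 5) (h : ∀ i, P.eval (θ i) = 0) : P = 0 := by
  refine eq_zero_of_dvd_of_natDegree_lt ((sextic_dvd_iff hθ P).2 h) ?_
  rw [sextic_natDegree]; omega

theorem cofactor_natDegree (θ : Fin 6 → K) (i : Fin 6) : (cofactor θ i).natDegree = 5 := by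
  simp [cofactor, natDegree_prod_of_monic _ _ fun i _ => monic_X_sub_C (θ i)]

theorem cofactor_coeff_five (θ : Fin 6 → K) (i : Fin 6) : (cofactor θ i).coeff 5 = 1 := by
  have : (cofactor θ i).Monic := monic_prod_of_monic _ _ fun i _ => monic_X_sub_C (θ i)
  have h := this.coeff_natDegree
  rwa [cofactor_natDegree] at h

theorem cofactor_eval_of_ne (θ : Fin 6 → K) {i j : Fin 6} (h : j ≠ i) :
    (cofactor θ i).eval (θ j) = 0 := by
  rw [cofactor, eval_prod]
  exact Finset.prod_eq_zero (Finset.mem_erase.2 ⟨h, Finset.mem_univ j⟩) (by simp)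

/-- The residue `∑ zᵢ / F'(θᵢ)`: the coefficient of `X⁵` of the polynomial of degree at most `5`
with the values `zᵢ` at the `θᵢ`. -/
noncomputable def res (θ z : Fin 6 → K) : K := ∑ i, z i / wt θ i

/-- The polynomial of degree at most `5` with prescribed values at the roots. -/
noncomputable def interp (θ z : Fin 6 → K) : K[X] := ∑ i, C (z i / wt θ i) * cofactor θ i

theorem interp_natDegree (θ z : Fin 6 → K) : (interp θ z).natDegree ≤ 5 :=
  natDegree_sum_le_of_forall_le _ _ fun i _ =>
    (natDegree_C_mul_le _ _).trans (cofactor_natDegree θ i).le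

theorem interp_eval {θ : Fin 6 → K} (hθ : Function.Injective θ) (z : Fin 6 → K) (j : Fin 6) :
    (interp θ z).eval (θ j) = z j := by
  rw [interp, eval_finsetSum, Finset.sum_eq_single j]
  · rw [eval_mul, eval_C]; exact div_mul_cancel₀ _ (wt_ne_zero hθ j)
  · intro i _ hij
    rw [eval_mul, cofactor_eval_of_ne θ hij.symm, mul_zero]
  · simp

theorem interp_coeff_five (θ z : Fin 6 → K) : (interp θ z).coeff 5 = res θ z := by
  simp [interp, finsetSum_coeff, cofactor_coeff_five, res]

theorem res_eval {θ : Fin 6 → K} (hθ : Function.Injective θ) {P : K[X]} (hP : P.natDegree ≤ 5) :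
    res θ (fun i => P.eval (θ i)) = P.coeff 5 := by
  rw [← interp_coeff_five]
  congr 1
  refine sub_eq_zero.1 (eq_zero_of_eval_roots hθ ?_ ?_)
  · exact (natDegree_sub_le _ _).trans (max_le (interp_natDegree _ _) hP)
  · intro i; rw [eval_sub, interp_eval hθ, sub_self]

/-- If the first `r` residue moments of `z` vanish, the interpolating polynomial has degree at most
`5 - r`: the moments are its top coefficients, up to multiples of the preceding ones. -/
theorem exists_interp_degree {θ : Fin 6 → K} (hθ : Function.Injective θ) (z : Fin 6 → K) (r : ℕ)
    (hr : r ≤ 5) (h : ∀ m < r, res θ (fun i => θ i ^ m * z i) = 0) :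
    ∃ P : K[X], P.natDegree ≤ 5 - r ∧ ∀ i, P.eval (θ i) = z i := by
  refine ⟨interp θ z, ?_, interp_eval hθ z⟩
  induction r with
  | zero => exact interp_natDegree θ z
  | succ r ih =>
    have h1 := ih (by omega) fun m hm => h m (by omega)
    have h3 : (X ^ r * interp θ z).natDegree ≤ 5 := by
      refine natDegree_mul_le.trans ?_
      rw [natDegree_X_pow]; omega
    have h4 := res_eval hθ h3
    simp only [eval_mul, eval_pow, eval_X, interp_eval hθ] at h4
    rw [h r (by omega)] at h4
    have h5 : (X ^ r * interp θ z).coeff 5 = (interp θ z).coeff (5 - r) := by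
      rw [coeff_X_pow_mul', if_pos (by omega)]
    rw [h5] at h4
    rw [natDegree_le_iff_coeff_eq_zero]
    intro N hN
    rcases Nat.lt_or_ge (5 - r) N with h6 | h6
    · exact coeff_eq_zero_of_natDegree_lt (by omega)
    · have : N = 5 - r := by omega
      rw [this, ← h4]

/-- Euler's identities: the residues of polynomials of degree at most `4` vanish. -/
theorem res_moment_eq_zero {θ : Fin 6 → K} (hθ : Function.Injective θ) {P : K[X]} {m : ℕ}
    (h : P.natDegree + m ≤ 4) : res θ (fun i => θ i ^ m * P.eval (θ i)) = 0 := by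
  have h3 : (X ^ m * P).natDegree ≤ 4 := by
    refine natDegree_mul_le.trans ?_
    rw [natDegree_X_pow]; omega
  have h4 := res_eval hθ (h3.trans (by norm_num))
  simp only [eval_mul, eval_pow, eval_X] at h4
  rw [h4]
  exact coeff_eq_zero_of_natDegree_lt (by omega)

theorem res_mul_left (θ : Fin 6 → K) (c : K) (z : Fin 6 → K) :
    res θ (fun i => c * z i) = c * res θ z := by
  simp [res, mul_div_assoc, Finset.mul_sum]

/-- Six vectors of the Klein space, orthogonal for the Pfaffian, with norms twice the weights. -/
def IsFrame (θ : Fin 6 → K) (ω : Fin 6 → Fin 6 → K) : Prop :=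
  ∀ i j, pf (ω i) (ω j) = if i = j then 2 * wt θ i else 0

/-- The vector of the Klein space with the residue coordinates `tᵢ / F'(θᵢ)`. -/
noncomputable def line (θ : Fin 6 → K) (ω : Fin 6 → Fin 6 → K) (t : Fin 6 → K) : Fin 6 → K :=
  fun a => res θ (fun i => t i * ω i a)

/-- The conditions on the values `tᵢ = P(θᵢ)` saying that `P² mod F` has degree at most `2`. -/
def OnCone (θ t : Fin 6 → K) : Prop := ∀ m < 3, res θ (fun i => θ i ^ m * t i ^ 2) = 0

theorem line_eq_sum (θ : Fin 6 → K) (ω : Fin 6 → Fin 6 → K) (t : Fin 6 → K) :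
    line θ ω t = ∑ i, (t i / wt θ i) • ω i := by
  funext a
  simp only [line, res, Finset.sum_apply, Pi.smul_apply, smul_eq_mul]
  exact Finset.sum_congr rfl fun i _ => by ring

theorem pf_comm (l m : Fin 6 → K) : pf l m = pf m l := by
  simp [pf]; ring

theorem pf_line_left (θ : Fin 6 → K) (ω : Fin 6 → Fin 6 → K) (t n : Fin 6 → K) :
    pf (line θ ω t) n = res θ (fun i => t i * pf (ω i) n) := by
  simp only [line, pf, res, Finset.sum_mul, ← Finset.sum_add_distrib, ← Finset.sum_sub_distrib]
  exact Finset.sum_congr rfl fun i _ => by ring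

theorem IsFrame.pf_line {θ : Fin 6 → K} {ω : Fin 6 → Fin 6 → K} (h : IsFrame θ ω)
    (hθ : Function.Injective θ) (t : Fin 6 → K) (j : Fin 6) :
    pf (line θ ω t) (ω j) = 2 * t j := by
  rw [pf_line_left, res, Finset.sum_eq_single j]
  · rw [h j j, if_pos rfl]
    field_simp [wt_ne_zero hθ j]
  · intro i _ hij
    rw [h i j, if_neg hij]; simp
  · simp

theorem IsFrame.pf_line_line {θ : Fin 6 → K} {ω : Fin 6 → Fin 6 → K} (h : IsFrame θ ω)
    (hθ : Function.Injective θ) (t t' : Fin 6 → K) :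
    pf (line θ ω t) (line θ ω t') = 2 * res θ (fun i => t i * t' i) := by
  rw [pf_comm, pf_line_left, ← res_mul_left]
  congr 1
  funext i
  rw [pf_comm, h.pf_line hθ]; ring

theorem IsFrame.pfAdj {θ : Fin 6 → K} {ω : Fin 6 → Fin 6 → K} (h : IsFrame θ ω) :
    IsFrame θ (fun i => pfAdj (ω i)) := fun i j => by
  simp only [pf_pfAdj_pfAdj, h i j]

theorem line_pfAdj (θ : Fin 6 → K) (ω : Fin 6 → Fin 6 → K) (t : Fin 6 → K) :
    line θ (fun i => pfAdj (ω i)) t = pfAdj (line θ ω t) := by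
  funext a
  fin_cases a <;> simp [line, pfAdj, res, neg_div]

/-- The values of `X P`. -/
def shift (θ t : Fin 6 → K) : Fin 6 → K := fun i => θ i * t i

/-- The flag matrix of the pencil of lines spanned by `P` and `X P`. -/
noncomputable def pencil (θ : Fin 6 → K) (ω : Fin 6 → Fin 6 → K) (t : Fin 6 → K) :
    Matrix (Fin 4) (Fin 4) K := flag (line θ ω t) (line θ ω (shift θ t))

/-- `v` represents the centre of the pencil of lines spanned by `P` and `X P`. -/
def IsCentre (θ : Fin 6 → K) (ω : Fin 6 → Fin 6 → K) (t : Fin 6 → K) (v : Fin 4 → K) : Prop :=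
  Common (line θ ω t) (line θ ω (shift θ t)) v

/-- On the cone the vectors attached to `P` and `X P` are isotropic and orthogonal, so they span a
pencil of lines: this is what the three conditions in `OnCone` say. -/
theorem IsFrame.isotropic {θ : Fin 6 → K} {ω : Fin 6 → Fin 6 → K} (h : IsFrame θ ω)
    (hθ : Function.Injective θ) {t : Fin 6 → K} (ht : OnCone θ t) :
    pf (line θ ω t) (line θ ω t) = 0 ∧
    pf (line θ ω (shift θ t)) (line θ ω (shift θ t)) = 0 ∧
    pf (line θ ω t) (line θ ω (shift θ t)) = 0 := by
  have h0 := ht 0 (by norm_num)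
  have h1 := ht 1 (by norm_num)
  have h3 := ht 2 (by norm_num)
  refine ⟨?_, ?_, ?_⟩ <;> rw [h.pf_line_line hθ]
  · rw [mul_eq_zero]; right; rw [← h0]; congr 1; funext i; ring
  · rw [mul_eq_zero]; right; rw [← h3]; congr 1; funext i; simp only [shift]; ring
  · rw [mul_eq_zero]; right; rw [← h1]; congr 1; funext i; simp only [shift]; ring

/-- The pencil does not degenerate: if `P` and `X P` were proportional, only one value `tᵢ` could be
nonzero, which is impossible for `t ≠ 0` on the cone. -/
theorem IsFrame.pencil_ne_zero {θ : Fin 6 → K} {ω : Fin 6 → Fin 6 → K} (h : IsFrame θ ω)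
    (hθ : Function.Injective θ) (h2 : (2 : K) ≠ 0) {t : Fin 6 → K} (ht : OnCone θ t)
    (h0 : t ≠ 0) : pencil θ ω t ≠ 0 := by
  intro hN
  have hm := minor_eq_zero_of_flag_eq_zero _ _ h2 hN
  set l := line θ ω t with hl
  set m := line θ ω (shift θ t) with hm'
  have key : ∀ n n' : Fin 6 → K, pf l n * pf m n' = pf l n' * pf m n := by
    intro n n'
    simp only [pf]
    have : ∀ i j, l i * m j - l j * m i = 0 := fun i j => sub_eq_zero.2 (hm i j)
    linear_combination (n 5 * n' 4 * -this 0 1 + n 5 * n' 3 * this 0 2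
      + n 5 * n' 2 * this 0 3 - n 5 * n' 1 * this 0 4 + n 5 * n' 0 * this 0 5)
      + (- n 4 * n' 5 * this 1 0 - n 4 * n' 3 * this 1 2
      - n 4 * n' 2 * this 1 3 + n 4 * n' 1 * this 1 4 - n 4 * n' 0 * this 1 5)
      + (n 3 * n' 5 * this 2 0 - n 3 * n' 4 * this 2 1
      + n 3 * n' 2 * this 2 3 - n 3 * n' 1 * this 2 4 + n 3 * n' 0 * this 2 5)
      + (n 2 * n' 5 * this 3 0 - n 2 * n' 4 * this 3 1
      + n 2 * n' 3 * this 3 2 - n 2 * n' 1 * this 3 4 + n 2 * n' 0 * this 3 5)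
      + (-n 1 * n' 5 * this 4 0 + n 1 * n' 4 * this 4 1
      - n 1 * n' 3 * this 4 2 - n 1 * n' 2 * this 4 3 - n 1 * n' 0 * this 4 5)
      + (n 0 * n' 5 * this 5 0 - n 0 * n' 4 * this 5 1
      + n 0 * n' 3 * this 5 2 + n 0 * n' 2 * this 5 3 - n 0 * n' 1 * this 5 4)
  have hij : ∀ i j, i ≠ j → t i * t j = 0 := by
    intro i j hij
    have := key (ω i) (ω j)
    rw [hl, hm', h.pf_line hθ, h.pf_line hθ, h.pf_line hθ, h.pf_line hθ] at this
    simp only [shift] at this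
    have h3 : (2 * 2 * (θ j - θ i)) * (t i * t j) = 0 := by linear_combination this
    exact (mul_eq_zero.1 h3).resolve_left
      (mul_ne_zero (mul_ne_zero h2 h2) (sub_ne_zero.2 (hθ.ne hij.symm)))
  obtain ⟨i, hi⟩ := Function.ne_iff.1 h0
  have hr := ht 0 (by norm_num)
  rw [res, Finset.sum_eq_single i] at hr
  · simp [wt_ne_zero hθ i] at hr
    exact hi hr
  · intro j _ hji
    have := (mul_eq_zero.1 (hij i j hji.symm)).resolve_left hi
    simp [this]
  · simp

theorem IsFrame.isCentre_col {θ : Fin 6 → K} {ω : Fin 6 → Fin 6 → K} (h : IsFrame θ ω)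
    (hθ : Function.Injective θ) (h2 : (2 : K) ≠ 0) {t : Fin 6 → K} (ht : OnCone θ t)
    (b : Fin 4) : IsCentre θ ω t (fun a => pencil θ ω t a b) := by
  obtain ⟨h1, h3, h4⟩ := h.isotropic hθ ht
  exact common_flag_col _ _ h2 h1 h3 h4 b

theorem IsFrame.exists_col {θ : Fin 6 → K} {ω : Fin 6 → Fin 6 → K} (h : IsFrame θ ω)
    (hθ : Function.Injective θ) (h2 : (2 : K) ≠ 0) {t : Fin 6 → K} (ht : OnCone θ t)
    (h0 : t ≠ 0) : ∃ b, (fun a => pencil θ ω t a b) ≠ 0 := by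
  by_contra! hc
  refine h.pencil_ne_zero hθ h2 ht h0 ?_
  ext a b
  exact congrFun (hc b) a

/-- The pencil of lines attached to a point of the surface has only one centre. -/
theorem IsFrame.centre_unique {θ : Fin 6 → K} {ω : Fin 6 → Fin 6 → K} (h : IsFrame θ ω)
    (hθ : Function.Injective θ) (h2 : (2 : K) ≠ 0) {t : Fin 6 → K} (ht : OnCone θ t)
    (h0 : t ≠ 0) {v v' : Fin 4 → K} (hv : IsCentre θ ω t v) (hv' : IsCentre θ ω t v')
    (hv0 : v ≠ 0) : ∃ c : K, v' = c • v := by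
  obtain ⟨b, hb⟩ := h.exists_col hθ h2 ht h0
  obtain ⟨a, ha⟩ := Function.ne_iff.1 hb
  have hv1 := fun c => Common.flag_mul hv c a b
  have hv2 := fun c => Common.flag_mul hv' c a b
  set n := fun a => pencil θ ω t a b with hn
  change ∀ c, v c * n a = v a * n c at hv1
  change ∀ c, v' c * n a = v' a * n c at hv2
  have ha' : n a ≠ 0 := ha
  have hva : v a ≠ 0 := by
    intro h3
    apply hv0
    funext c
    have := hv1 c
    rw [h3, zero_mul] at this
    exact (mul_eq_zero.1 this).resolve_right ha'
  refine ⟨v' a / v a, ?_⟩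
  funext c
  apply mul_right_cancel₀ ha'
  rw [hv2 c, Pi.smul_apply, smul_eq_mul, mul_assoc, hv1 c]
  field_simp

theorem skew_line_mulVec (θ : Fin 6 → K) (ω : Fin 6 → Fin 6 → K) (t : Fin 6 → K)
    (v : Fin 4 → K) (a : Fin 4) : (skew (line θ ω t)).mulVec v a
      = res θ (fun i => t i * (skew (ω i)).mulVec v a) := by
  simp only [skew_mulVec]
  simp only [line, res]
  fin_cases a <;>
    simp only [Fin.zero_eta, Fin.mk_one, Fin.reduceFinMk, Matrix.cons_val, Finset.sum_mul,
      ← Finset.sum_add_distrib, ← Finset.sum_sub_distrib, ← Finset.sum_neg_distrib] <;>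
    exact Finset.sum_congr rfl fun i _ => by ring

/-- A criterion for being a centre: on each row the products with `P` have degree at most `3`
modulo `F`. -/
theorem isCentre_of_rows {θ : Fin 6 → K} (hθ : Function.Injective θ) (ω : Fin 6 → Fin 6 → K)
    (t : Fin 6 → K) (v : Fin 4 → K) (Z : Fin 4 → K[X]) (hd : ∀ a, (Z a).natDegree ≤ 3)
    (h : ∀ i a, t i * (skew (ω i)).mulVec v a = (Z a).eval (θ i)) : IsCentre θ ω t v := by
  constructor
  · funext a
    rw [skew_line_mulVec, Pi.zero_apply,
      ← res_moment_eq_zero hθ (P := Z a) (m := 0) ((hd a).trans (by norm_num))]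
    congr 1
    funext i
    rw [h, pow_zero, one_mul]
  · funext a
    rw [skew_line_mulVec, Pi.zero_apply,
      ← res_moment_eq_zero hθ (P := Z a) (m := 1) (Nat.add_le_add_right (hd a) 1)]
    congr 1
    funext i
    rw [← h, pow_one, shift, mul_assoc]

/-- Two centres coincide only if the polynomials are orthogonal for the first three moments: the
four lines pass through one point, so they meet pairwise, and the Clifford relation applies. -/
theorem IsFrame.moments_of_common_centre {θ : Fin 6 → K} {ω : Fin 6 → Fin 6 → K}
    (h : IsFrame θ ω) (hθ : Function.Injective θ) (h2 : (2 : K) ≠ 0) {t t' : Fin 6 → K}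
    {v : Fin 4 → K} (hv0 : v ≠ 0) (hv : IsCentre θ ω t v) (hv' : IsCentre θ ω t' v) :
    ∀ m < 3, res θ (fun i => θ i ^ m * (t i * t' i)) = 0 := by
  have key : ∀ s s' : Fin 6 → K, (skew (line θ ω s)).mulVec v = 0 →
      (skew (line θ ω s')).mulVec v = 0 → res θ (fun i => s i * s' i) = 0 := by
    intro s s' hs hs'
    have := clifford (line θ ω s) (line θ ω s') v
    rw [hs, hs', Matrix.mulVec_zero, Matrix.mulVec_zero, add_zero, eq_comm, smul_eq_zero,
      neg_eq_zero, h.pf_line_line hθ] at this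
    exact (mul_eq_zero.1 (this.resolve_right hv0)).resolve_left h2
  intro m hm
  interval_cases m
  · simpa using key t t' hv.1 hv'.1
  · rw [← key t (shift θ t') hv.1 hv'.2]
    congr 1; funext i; simp only [shift]; ring
  · rw [← key (shift θ t) (shift θ t') hv.2 hv'.2]
    congr 1; funext i; simp only [shift]; ring

/-- Changing the sign of `tᵢ` is the reflection in `ωᵢ`; it interchanges the two families of
planes on the Klein quadric, so the skew matrix of `ωᵢ` maps the centre of the pencil to the plane
of the reflected pencil. -/
theorem IsFrame.isCentre_reflect {θ : Fin 6 → K} {ω : Fin 6 → Fin 6 → K} (h : IsFrame θ ω)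
    (hθ : Function.Injective θ) {t : Fin 6 → K} {v : Fin 4 → K} (hv : IsCentre θ ω t v)
    (i : Fin 6) : IsCentre θ (fun j => KummerDuality.pfAdj (ω j)) (Function.update t i (-t i))
      ((skew (ω i)).mulVec v) := by
  have key : ∀ s : Fin 6 → K, (skew (line θ ω s)).mulVec v = 0 →
      (skew (line θ (fun j => KummerDuality.pfAdj (ω j)) (Function.update s i (-s i)))).mulVec
        ((skew (ω i)).mulVec v) = 0 := by
    intro s hs
    have e : line θ ω s = line θ ω (Function.update s i (-s i)) + (2 * s i / wt θ i) • ω i := by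
      rw [line_eq_sum, line_eq_sum, ← Finset.add_sum_erase _ _ (Finset.mem_univ i),
        ← Finset.add_sum_erase (a := i)
          (f := fun j => (Function.update s i (-s i) j / wt θ j) • ω j)
          _ (Finset.mem_univ i), Function.update_self, add_right_comm, ← add_smul]
      congr 1
      · congr 1; ring
      · refine Finset.sum_congr rfl fun j hj => ?_
        rw [Function.update_of_ne (Finset.ne_of_mem_erase hj)]
    have e' : line θ ω (Function.update s i (-s i)) = line θ ω s + (-(2 * s i / wt θ i)) • ω i := by
      rw [e]; rw [add_assoc, ← add_smul]; simp
    have c1 := clifford (line θ ω s) (ω i) v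
    have c2 := clifford (ω i) (ω i) v
    rw [hs, Matrix.mulVec_zero, add_zero, h.pf_line hθ] at c1
    rw [h i i, if_pos rfl] at c2
    rw [line_pfAdj, e', pfAdj_add, pfAdj_smul, skew_add, skew_smul, Matrix.add_mulVec,
      Matrix.smul_mulVec, c1]
    funext a
    have c3 := congrFun c2 a
    simp only [Pi.add_apply, Pi.smul_apply, smul_eq_mul, Pi.zero_apply] at c3 ⊢
    have hw := wt_ne_zero hθ i
    have hs2 : 2 * s i / wt θ i * wt θ i = 2 * s i := div_mul_cancel₀ _ hw
    by_cases h2 : (2 : K) = 0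
    · rw [h2]; ring
    · apply mul_left_cancel₀ h2
      linear_combination (-(2 * s i / wt θ i)) * c3 + 2 * v a * hs2
  refine ⟨key t hv.1, ?_⟩
  have := key (shift θ t) hv.2
  convert this using 4
  funext j
  by_cases hj : j = i
  · subst hj; simp [shift]
  · simp [shift, hj]

/-- The coordinates of the skew matrix `Wᵢ`. -/
noncomputable def omega (θ : Fin 6 → K) (i : Fin 6) : Fin 6 → K :=
  ![(sextic θ).coeff 1 + 2 * (sextic θ).coeff 2 * θ i + 2 * (sextic θ).coeff 3 * θ i ^ 2
      + 2 * (sextic θ).coeff 4 * θ i ^ 3 + 2 * (sextic θ).coeff 5 * θ i ^ 4 + 2 * θ i ^ 5,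
    θ i * ((sextic θ).coeff 3 + 2 * (sextic θ).coeff 4 * θ i
      + 2 * (sextic θ).coeff 5 * θ i ^ 2 + 2 * θ i ^ 3),
    θ i ^ 2, θ i ^ 2 * ((sextic θ).coeff 5 + 2 * θ i), -θ i, 1]

theorem skew_omega (θ : Fin 6 → K) (i : Fin 6) :
    skew (omega θ i) = weierstrassMatrix (sextic θ) (θ i) := by
  ext a b
  fin_cases a <;> fin_cases b <;> simp [skew, omega, weierstrassMatrix]

/-- The matrices `Wᵢ` are orthogonal for the Pfaffian form. For `i ≠ j` the product
`(θᵢ - θⱼ) pf(Wᵢ, Wⱼ)` is `2 F(θᵢ) - 2 F(θⱼ) = 0`, and `pf(Wᵢ, Wᵢ) = 2 F'(θᵢ)`. -/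
theorem isFrame_omega {θ : Fin 6 → K} (hθ : Function.Injective θ) : IsFrame θ (omega θ) := by
  intro i j
  by_cases hij : i = j
  · subst hij
    rw [if_pos rfl, ← sextic_deriv_eval, sextic_deriv]
    simp [pf, omega]
    ring
  · rw [if_neg hij]
    have h1 := sextic_eval_root θ i
    have h3 := sextic_eval_root θ j
    rw [sextic_eval] at h1 h3
    have : θ i - θ j ≠ 0 := sub_ne_zero.2 (hθ.ne hij)
    apply mul_left_cancel₀ this
    rw [mul_zero]
    simp only [pf, omega, Matrix.cons_val]
    linear_combination 2 * h1 - 2 * h3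

end Frame

/-! ### Irreducibility of the surface -/

section SquareRoots

/-- Linear independence of products of square roots: if no nonempty product of the `rᵢ` is a
quotient of elements of `E`, these products are independent over `E`. -/
theorem sqrt_products_independent {L ι : Type*} [Field L] [DecidableEq ι] (h2 : (2 : L) ≠ 0)
    (r : ι → L) (T : Finset ι) : ∀ E : Subring L, (∀ i ∈ T, r i ^ 2 ∈ E) →
      (∀ J ⊆ T, J.Nonempty → ∀ d ∈ E, d ≠ 0 → d * ∏ j ∈ J, r j ∉ E) →
      ∀ c : Finset ι → L, (∀ I ⊆ T, c I ∈ E) → ∑ I ∈ T.powerset, c I * ∏ i ∈ I, r i = 0 →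
      ∀ I ⊆ T, c I = 0 := by
  induction T using Finset.induction with
  | empty =>
    intro E _ _ c _ hs I hI
    rw [Finset.subset_empty.1 hI]
    simpa using hs
  | insert a T ha ih =>
    intro E hr hJ c hc hs
    have hra : r a ^ 2 ∈ E := hr a (Finset.mem_insert_self a T)
    have hsub : T ⊆ insert a T := Finset.subset_insert a T
    -- the quadratic extension `E[rₐ]`
    let E' : Subring L :=
      { carrier := {z | ∃ x ∈ E, ∃ y ∈ E, z = x + y * r a}
        mul_mem' := by
          rintro _ _ ⟨x, hx, y, hy, rfl⟩ ⟨x', hx', y', hy', rfl⟩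
          exact ⟨x * x' + y * y' * r a ^ 2, E.add_mem (E.mul_mem hx hx')
            (E.mul_mem (E.mul_mem hy hy') hra), x * y' + y * x',
            E.add_mem (E.mul_mem hx hy') (E.mul_mem hy hx'), by ring⟩
        one_mem' := ⟨1, E.one_mem, 0, E.zero_mem, by ring⟩
        add_mem' := by
          rintro _ _ ⟨x, hx, y, hy, rfl⟩ ⟨x', hx', y', hy', rfl⟩
          exact ⟨x + x', E.add_mem hx hx', y + y', E.add_mem hy hy', by ring⟩
        zero_mem' := ⟨0, E.zero_mem, 0, E.zero_mem, by ring⟩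
        neg_mem' := by
          rintro _ ⟨x, hx, y, hy, rfl⟩
          exact ⟨-x, E.neg_mem hx, -y, E.neg_mem hy, by ring⟩ }
    have hE : ∀ {z}, z ∈ E → z ∈ E' := fun {z} hz => ⟨z, hz, 0, E.zero_mem, by ring⟩
    have hsingle : ∀ d ∈ E, d * r a ∈ E → d = 0 := by
      intro d hd hda
      by_contra h0
      refine hJ {a} (by simp) (by simp) d hd h0 ?_
      simpa using hda
    -- a relation over `E[rₐ]` gives a relation over `E`
    have hJ1 : ∀ J ⊆ T, J.Nonempty → ∀ d ∈ E, d ≠ 0 → d * ∏ j ∈ J, r j ∉ E' := by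
      rintro J hJT hne d hd h0 ⟨x, hx, y, hy, hxy⟩
      have hp : (∏ j ∈ J, r j) ^ 2 ∈ E := by
        rw [← Finset.prod_pow]
        exact E.prod_mem fun j hj => hr j (hsub (hJT hj))
      have h2E : (2 : L) ∈ E := by
        have := E.add_mem E.one_mem E.one_mem
        rwa [one_add_one_eq_two] at this
      have h3 : (2 * x * y) * r a ∈ E := by
        have : (2 * x * y) * r a = d ^ 2 * (∏ j ∈ J, r j) ^ 2 - x ^ 2 - y ^ 2 * r a ^ 2 := by
          linear_combination (-(d * ∏ j ∈ J, r j) - x - y * r a) * hxy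
        rw [this]
        exact E.sub_mem (E.sub_mem (E.mul_mem (E.pow_mem hd 2) hp) (E.pow_mem hx 2))
          (E.mul_mem (E.pow_mem hy 2) hra)
      have h4 := hsingle _ (E.mul_mem (E.mul_mem h2E hx) hy) h3
      rcases mul_eq_zero.1 h4 with h5 | h5
      · have h6 := (mul_eq_zero.1 h5).resolve_left h2
        refine hJ (insert a J) (Finset.insert_subset_insert a hJT) (by simp) d hd h0 ?_
        rw [Finset.prod_insert fun h => ha (hJT h)]
        have : d * (r a * ∏ j ∈ J, r j) = y * r a ^ 2 := by
          rw [h6] at hxy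
          linear_combination r a * hxy
        rw [this]
        exact E.mul_mem hy hra
      · refine hJ J (hJT.trans hsub) hne d hd h0 ?_
        rw [hxy, h5]
        simpa using hx
    have hJ' : ∀ J ⊆ T, J.Nonempty → ∀ d ∈ E', d ≠ 0 → d * ∏ j ∈ J, r j ∉ E' := by
      rintro J hJT hne d ⟨x, hx, y, hy, rfl⟩ h0 hmem
      have hn : (x - y * r a) * (x + y * r a) ∈ E := by
        have : (x - y * r a) * (x + y * r a) = x ^ 2 - y ^ 2 * r a ^ 2 := by ring
        rw [this]
        exact E.sub_mem (E.pow_mem hx 2) (E.mul_mem (E.pow_mem hy 2) hra)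
      have hn0 : (x - y * r a) * (x + y * r a) ≠ 0 := by
        refine mul_ne_zero ?_ h0
        intro h
        have h3 : y * r a = x := (sub_eq_zero.1 h).symm
        have h4 := hsingle y hy (h3 ▸ hx)
        apply h0
        rw [← h3, h4]; ring
      refine hJ1 J hJT hne _ hn hn0 ?_
      rw [mul_assoc]
      refine E'.mul_mem ⟨x, hx, -y, E.neg_mem hy, by ring⟩ hmem
    rw [Finset.sum_powerset_insert ha, ← Finset.sum_add_distrib] at hs
    have hs' : ∑ I ∈ T.powerset, (c I + c (insert a I) * r a) * ∏ i ∈ I, r i = 0 := by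
      rw [← hs]
      refine Finset.sum_congr rfl fun I hI => ?_
      rw [Finset.prod_insert fun h => ha (Finset.mem_powerset.1 hI h)]
      ring
    have key := ih E' (fun i hi => hE (hr i (hsub hi))) hJ' (fun I => c I + c (insert a I) * r a)
      (fun I hI => ⟨c I, hc I (hI.trans hsub), c (insert a I),
        hc _ (Finset.insert_subset_insert a hI), rfl⟩) hs'
    have key' : ∀ I ⊆ T, c (insert a I) = 0 ∧ c I = 0 := by
      intro I hI
      have h3 := key I hI
      have h4 : c (insert a I) = 0 := by
        refine hsingle _ (hc _ (Finset.insert_subset_insert a hI)) ?_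
        have : c (insert a I) * r a = -c I := by linear_combination h3
        rw [this]
        exact E.neg_mem (hc I (hI.trans hsub))
      rw [h4, zero_mul, add_zero] at h3
      exact ⟨h4, h3⟩
    intro I hI
    by_cases haI : a ∈ I
    · rw [← Finset.insert_erase haI]
      exact (key' _ (Finset.subset_insert_iff.1 hI)).1
    · exact (key' I ((Finset.subset_insert_iff_of_notMem haI).1 hI)).2

/-- A combination of the products of the `sᵢ` that vanishes for all choices `sᵢ = ±tᵢ` of the signs
has zero coefficients. -/
theorem coeff_eq_zero_of_all_signs {K ι : Type*} [Field K] [DecidableEq ι] (h2 : (2 : K) ≠ 0)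
    (T : Finset ι) : ∀ (t : ι → K), (∀ i, t i ≠ 0) → ∀ c : Finset ι → K,
      (∀ s : ι → K, (∀ i, s i ^ 2 = t i ^ 2) → ∑ I ∈ T.powerset, c I * ∏ i ∈ I, s i = 0) →
      ∀ I ⊆ T, c I = 0 := by
  induction T using Finset.induction with
  | empty =>
    intro t _ c hs I hI
    rw [Finset.subset_empty.1 hI]
    simpa using hs t fun _ => rfl
  | insert a T ha ih =>
    intro t ht c hs
    have key : ∀ s : ι → K, (∀ i, s i ^ 2 = t i ^ 2) →
        (∑ I ∈ T.powerset, c I * ∏ i ∈ I, s i = 0) ∧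
        ∑ I ∈ T.powerset, c (insert a I) * ∏ i ∈ I, s i = 0 := by
      intro s hst
      have h1 := hs s hst
      have h3 := hs (Function.update s a (-s a)) fun i => by
        by_cases hi : i = a
        · subst hi; simp [hst]
        · simp [hi, hst]
      rw [Finset.sum_powerset_insert ha] at h1 h3
      have e1 : ∑ I ∈ T.powerset, c (insert a I) * ∏ i ∈ insert a I, s i
          = s a * ∑ I ∈ T.powerset, c (insert a I) * ∏ i ∈ I, s i := by
        rw [Finset.mul_sum]
        refine Finset.sum_congr rfl fun I hI => ?_
        rw [Finset.prod_insert fun h => ha (Finset.mem_powerset.1 hI h)]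
        ring
      have e0 : ∀ I ∈ T.powerset, ∏ i ∈ I, Function.update s a (-s a) i = ∏ i ∈ I, s i := by
        intro I hI
        refine Finset.prod_congr rfl fun i hi => ?_
        rw [Function.update_of_ne]
        rintro rfl
        exact ha (Finset.mem_powerset.1 hI hi)
      have e2 : ∑ I ∈ T.powerset, c (insert a I) * ∏ i ∈ insert a I, Function.update s a (-s a) i
          = -(s a * ∑ I ∈ T.powerset, c (insert a I) * ∏ i ∈ I, s i) := by
        rw [Finset.mul_sum, ← Finset.sum_neg_distrib]
        refine Finset.sum_congr rfl fun I hI => ?_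
        rw [Finset.prod_insert fun h => ha (Finset.mem_powerset.1 hI h), e0 I hI,
          Function.update_self]
        ring
      have e3 : ∑ I ∈ T.powerset, c I * ∏ i ∈ I, Function.update s a (-s a) i
          = ∑ I ∈ T.powerset, c I * ∏ i ∈ I, s i :=
        Finset.sum_congr rfl fun I hI => by rw [e0 I hI]
      rw [e1] at h1
      rw [e2, e3] at h3
      have hsa : s a ≠ 0 := fun h => ht a (by
        have := hst a
        rw [h] at this
        exact pow_eq_zero_iff (two_ne_zero) |>.1 (by rw [← this]; ring))
      constructor
      · apply mul_left_cancel₀ h2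
        linear_combination h1 + h3
      · apply mul_left_cancel₀ (mul_ne_zero h2 hsa)
        linear_combination h1 - h3
    intro I hI
    by_cases haI : a ∈ I
    · rw [← Finset.insert_erase haI]
      exact ih t ht (fun I => c (insert a I)) (fun s hst => (key s hst).2) _
        (Finset.subset_insert_iff.1 hI)
    · exact ih t ht c (fun s hst => (key s hst).1) I
        ((Finset.subset_insert_iff_of_notMem haI).1 hI)

end SquareRoots

section Irreducible

variable {K : Type*} [Field K]

/-- The value of a quadratic polynomial with indeterminate coefficients at `θᵢ`. -/
noncomputable def ell (θ : Fin 6 → K) (i : Fin 6) : MvPolynomial (Fin 3) K :=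
  MvPolynomial.X 0 + MvPolynomial.C (θ i) * MvPolynomial.X 1
    + MvPolynomial.C (θ i ^ 2) * MvPolynomial.X 2

theorem eval_ell (θ : Fin 6 → K) (i : Fin 6) (q : Fin 3 → K) :
    MvPolynomial.eval q (ell θ i) = q 0 + θ i * q 1 + θ i ^ 2 * q 2 := by
  simp [ell]

/-- A nonempty product of the forms `ℓⱼ` is not a square in the field of rational functions. -/
theorem mul_prod_ell_ne_sq {θ : Fin 6 → K} (hθ : Function.Injective θ) {J : Finset (Fin 6)}
    (hJ : J.Nonempty) {d e : MvPolynomial (Fin 3) K} (hd : d ≠ 0) :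
    d ^ 2 * ∏ j ∈ J, ell θ j ≠ e ^ 2 := by
  intro h
  obtain ⟨j, hj⟩ := hJ
  set φ := MvPolynomial.finSuccEquiv K 2
  set c : Fin 6 → MvPolynomial (Fin 2) K := fun i =>
    -(MvPolynomial.C (θ i) * MvPolynomial.X 0 + MvPolynomial.C (θ i ^ 2) * MvPolynomial.X 1) with hc
  have hell : ∀ i, φ (ell θ i) = X - C (c i) := by
    intro i
    have e1 : (1 : Fin 3) = Fin.succ 0 := rfl
    have e2 : (2 : Fin 3) = Fin.succ 1 := rfl
    simp only [φ, ell, hc, map_add, map_mul, e1, e2, map_neg, MvPolynomial.finSuccEquiv_apply,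
      MvPolynomial.eval₂Hom_C, MvPolynomial.eval₂Hom_X', Fin.cases_zero, Fin.cases_succ,
      RingHom.comp_apply]
    ring
  have hinj : ∀ i, i ≠ j → c j ≠ c i := by
    intro i hij hcc
    have := congrArg (MvPolynomial.eval ![1, 0]) hcc
    simp [hc] at this
    exact hij (hθ this.symm)
  have h' := congrArg φ h
  rw [map_mul, map_pow, map_pow, map_prod] at h'
  simp only [hell] at h'
  rw [← Finset.mul_prod_erase _ _ hj] at h'
  have hd' : φ d ≠ 0 := by simpa using hd
  have hr : ¬ (∏ i ∈ J.erase j, (X - C (c i))).IsRoot (c j) := by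
    rw [IsRoot.def, eval_prod, Finset.prod_eq_zero_iff]
    rintro ⟨i, hi, h0⟩
    rw [eval_sub, eval_X, eval_C, sub_eq_zero] at h0
    exact hinj i (Finset.ne_of_mem_erase hi) h0
  have hr0 : (∏ i ∈ J.erase j, (X - C (c i))) ≠ 0 := by
    intro h0; rw [h0] at hr; simp at hr
  have hne : φ d ^ 2 * ((X - C (c j)) * ∏ i ∈ J.erase j, (X - C (c i))) ≠ 0 :=
    mul_ne_zero (pow_ne_zero 2 hd') (mul_ne_zero (X_sub_C_ne_zero _) hr0)
  have he : φ e * φ e ≠ 0 := by rw [← pow_two, ← h']; exact hne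
  have hm := congrArg (rootMultiplicity (c j)) h'
  rw [rootMultiplicity_mul hne, pow_two, pow_two, rootMultiplicity_mul he,
    rootMultiplicity_mul (mul_ne_zero hd' hd'),
    rootMultiplicity_mul (mul_ne_zero (X_sub_C_ne_zero _) hr0),
    rootMultiplicity_X_sub_C_self, rootMultiplicity_eq_zero hr] at hm
  omega

/-- Modulo the relations `tᵢ² = ℓᵢ(q)` each polynomial in `q` and `t` is a combination of the
squarefree products of the `tᵢ`. -/
theorem exists_normal_form.{u} {K : Type u} [Field K] (θ : Fin 6 → K)
    (f : MvPolynomial (Fin 3 ⊕ Fin 6) K) :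
    ∃ c : Finset (Fin 6) → MvPolynomial (Fin 3) K, ∀ (A : Type u) [CommRing A] [Algebra K A]
      (q : Fin 3 → A) (t : Fin 6 → A), (∀ i, t i ^ 2 = MvPolynomial.aeval q (ell θ i)) →
      MvPolynomial.aeval (Sum.elim q t) f
        = ∑ I ∈ Finset.univ.powerset, MvPolynomial.aeval q (c I) * ∏ i ∈ I, t i := by
  induction f using MvPolynomial.induction_on with
  | C a =>
    refine ⟨fun I => if I = ∅ then MvPolynomial.C a else 0, ?_⟩
    intro A _ _ q t _
    rw [Finset.sum_eq_single ∅]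
    · simp
    · intro I _ hI
      simp [hI]
    · simp
  | add f g hf hg =>
    obtain ⟨c, hc⟩ := hf
    obtain ⟨c', hc'⟩ := hg
    refine ⟨fun I => c I + c' I, ?_⟩
    intro A _ _ q t ht
    rw [map_add, hc A q t ht, hc' A q t ht, ← Finset.sum_add_distrib]
    exact Finset.sum_congr rfl fun I _ => by rw [map_add, add_mul]
  | mul_X f n hf =>
    obtain ⟨c, hc⟩ := hf
    rcases n with n | n
    · refine ⟨fun I => c I * MvPolynomial.X n, ?_⟩
      intro A _ _ q t ht
      rw [map_mul, hc A q t ht, MvPolynomial.aeval_X, Sum.elim_inl, Finset.sum_mul]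
      refine Finset.sum_congr rfl fun I _ => ?_
      rw [map_mul, MvPolynomial.aeval_X]; ring
    · refine ⟨fun I => if n ∈ I then c (I.erase n) else c (insert n I) * ell θ n, ?_⟩
      intro A _ _ q t ht
      rw [map_mul, hc A q t ht, MvPolynomial.aeval_X, Sum.elim_inr, Finset.sum_mul]
      refine Finset.sum_bij' (fun I _ => if n ∈ I then I.erase n else insert n I)
        (fun I _ => if n ∈ I then I.erase n else insert n I) (by simp) (by simp) ?_ ?_ ?_
      · intro I _
        by_cases hn : n ∈ I <;> simp [hn]
      · intro I _
        by_cases hn : n ∈ I <;> simp [hn]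
      · intro I _
        by_cases hn : n ∈ I
        · simp only [hn, if_true, Finset.mem_erase, ne_eq, not_true_eq_false, false_and, if_false,
            Finset.insert_erase, map_mul, ← ht]
          rw [← Finset.mul_prod_erase I t hn]; ring
        · simp only [hn, if_false, Finset.mem_insert_self, if_true, Finset.erase_insert,
            not_false_eq_true, Finset.prod_insert]
          ring

/-- The points `(q, t)` with `tᵢ² = q₀ + q₁ θᵢ + q₂ θᵢ²`. -/
def Cone (θ : Fin 6 → K) (q : Fin 3 → K) (t : Fin 6 → K) : Prop :=
  ∀ i, t i ^ 2 = q 0 + θ i * q 1 + θ i ^ 2 * q 2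

theorem ell_ne_zero (θ : Fin 6 → K) (i : Fin 6) : ell θ i ≠ 0 := by
  intro h
  have := congrArg (MvPolynomial.eval ![1, 0, 0]) h
  rw [eval_ell] at this
  simp at this

/-- The cone over the surface is irreducible: its function field is obtained from the rational
functions in `q` by adjoining the square roots of the six forms `ℓᵢ`, and the squarefree products
of these roots are linearly independent. -/
theorem cone_irreducible.{u} {K : Type u} [Field K] [IsAlgClosed K] (h2 : (2 : K) ≠ 0)
    {θ : Fin 6 → K} (hθ : Function.Injective θ) (f g : MvPolynomial (Fin 3 ⊕ Fin 6) K)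
    (hfg : ∀ q t, Cone θ q t →
      MvPolynomial.eval (Sum.elim q t) f * MvPolynomial.eval (Sum.elim q t) g = 0) :
    (∀ q t, Cone θ q t → MvPolynomial.eval (Sum.elim q t) f = 0) ∨
    (∀ q t, Cone θ q t → MvPolynomial.eval (Sum.elim q t) g = 0) := by
  obtain ⟨a, ha⟩ := exists_normal_form θ f
  obtain ⟨b, hb⟩ := exists_normal_form θ g
  obtain ⟨c, hc⟩ := exists_normal_form θ (f * g)
  have hsq : ∀ z : K, ∃ y, y ^ 2 = z := fun z => IsAlgClosed.exists_pow_nat_eq z (by norm_num)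
  -- the normal form of the product vanishes
  have hc0 : ∀ I, c I = 0 := by
    intro I
    have hprod : c I * ∏ i, ell θ i = 0 := by
      refine MvPolynomial.funext fun q => ?_
      rw [map_mul, map_zero, map_prod]
      by_cases hq : ∏ i, MvPolynomial.eval q (ell θ i) = 0
      · rw [hq, mul_zero]
      rw [Finset.prod_eq_zero_iff] at hq
      push Not at hq
      choose t ht using fun i => hsq (MvPolynomial.eval q (ell θ i))
      have ht0 : ∀ i, t i ≠ 0 := by
        intro i h0
        apply hq i (Finset.mem_univ i)
        rw [← ht, h0]; ring
      rw [coeff_eq_zero_of_all_signs h2 Finset.univ t ht0 (fun I => MvPolynomial.eval q (c I)) ?_ I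
        (Finset.subset_univ I), zero_mul]
      intro s hs
      have hs' : ∀ i, s i ^ 2 = MvPolynomial.aeval q (ell θ i) := by
        intro i; rw [hs, ht]; rfl
      have h3 := hc K q s hs'
      have h4 := hfg q s fun i => by rw [← eval_ell]; exact hs' i
      rw [← map_mul] at h4
      rw [← MvPolynomial.coe_aeval_eq_eval] at h4
      exact h3.symm.trans h4
    exact (mul_eq_zero.1 hprod).resolve_right
      (Finset.prod_ne_zero_iff.2 fun i _ => ell_ne_zero θ i)
  -- the square roots of the forms `ℓᵢ` in an algebraic closure of the rational function field
  let R := MvPolynomial (Fin 3) K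
  let L := AlgebraicClosure (FractionRing R)
  let q : Fin 3 → L := fun i => algebraMap R L (MvPolynomial.X i)
  have hinj : Function.Injective (algebraMap R L) := by
    rw [IsScalarTower.algebraMap_eq R (FractionRing R) L]
    exact (algebraMap (FractionRing R) L).injective.comp (IsFractionRing.injective R _)
  have hq : ∀ p : R, MvPolynomial.aeval q p = algebraMap R L p := by
    intro p
    have : (MvPolynomial.aeval q : R →ₐ[K] L) = IsScalarTower.toAlgHom K R L := by
      refine MvPolynomial.algHom_ext fun i => ?_
      simp only [q, MvPolynomial.aeval_X]
      rfl
    rw [this]; rfl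
  choose r hr using fun i => IsAlgClosed.exists_pow_nat_eq (algebraMap R L (ell θ i))
    (n := 2) (by norm_num)
  have hr' : ∀ i, r i ^ 2 = MvPolynomial.aeval q (ell θ i) := fun i => by rw [hr, hq]
  have h2L : (2 : L) ≠ 0 := by
    have : (2 : L) = algebraMap K L 2 := by rw [map_ofNat]
    rw [this]
    exact (_root_.map_ne_zero _).2 h2
  have hind : ∀ a : Finset (Fin 6) → R,
      ∑ I ∈ Finset.univ.powerset, MvPolynomial.aeval q (a I) * ∏ i ∈ I, r i = 0 →
      ∀ I, a I = 0 := by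
    intro a hs I
    refine hinj ?_
    rw [map_zero, ← hq]
    refine sqrt_products_independent h2L r Finset.univ (algebraMap R L).range
      (fun i _ => ⟨ell θ i, (hr i).symm⟩) ?_ (fun I => MvPolynomial.aeval q (a I))
      (fun I _ => ⟨a I, (hq _).symm⟩) hs I (Finset.subset_univ I)
    rintro J _ hJ _ ⟨d, rfl⟩ hd0 ⟨e, he⟩
    refine mul_prod_ell_ne_sq hθ hJ (d := d) (e := e) (fun h => hd0 (by rw [h, map_zero])) ?_
    apply hinj
    rw [map_pow, he, mul_pow, map_mul, map_pow, map_prod, ← Finset.prod_pow]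
    simp only [hr]
  have h0 : MvPolynomial.aeval (Sum.elim q r) f * MvPolynomial.aeval (Sum.elim q r) g = 0 := by
    rw [← map_mul, hc L q r hr']
    simp [hc0]
  refine (mul_eq_zero.1 h0).imp (fun h => ?_) (fun h => ?_)
  · rw [ha L q r hr'] at h
    intro q t ht
    refine (ha K q t fun i => (ht i).trans (eval_ell θ i q).symm).trans ?_
    simp [hind a h]
  · rw [hb L q r hr'] at h
    intro q t ht
    refine (hb K q t fun i => (ht i).trans (eval_ell θ i q).symm).trans ?_
    simp [hind b h]

end Irreducible

/-! ### The coordinates of the centre and of its tangent plane -/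

section Coordinates

variable {K : Type*} [Field K]

/-- The identity `F = M² - H² Q` with `M = m₀ + ⋯ + m₃ X³`, `H = X² - s X + p` and
`Q = q₀ + q₁ X + q₂ X²`, written out in coefficients. -/
structure NormIdentity (F : K[X]) (m : Fin 4 → K) (q : Fin 3 → K) (s p : K) : Prop where
  c0 : F.coeff 0 = m 0 ^ 2 - p ^ 2 * q 0
  c1 : F.coeff 1 = 2 * m 0 * m 1 + 2 * s * p * q 0 - p ^ 2 * q 1
  c2 : F.coeff 2 = 2 * m 0 * m 2 + m 1 ^ 2 - (s ^ 2 + 2 * p) * q 0 + 2 * s * p * q 1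
    - p ^ 2 * q 2
  c3 : F.coeff 3 = 2 * m 0 * m 3 + 2 * m 1 * m 2 + 2 * s * q 0 - (s ^ 2 + 2 * p) * q 1
    + 2 * s * p * q 2
  c4 : F.coeff 4 = m 2 ^ 2 + 2 * m 1 * m 3 - q 0 + 2 * s * q 1 - (s ^ 2 + 2 * p) * q 2
  c5 : F.coeff 5 = 2 * m 2 * m 3 - q 1 + 2 * s * q 2
  c6 : q 2 = m 3 ^ 2 - 1

/-- The fourth Kummer coordinate `β₀` of the divisor cut out by `H = 0`, `Y = M`. -/
def betaCoord (m : Fin 4 → K) (q : Fin 3 → K) (s p : K) : K :=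
  -2 * m 0 * m 2 - 2 * m 1 * m 3 * p - 2 * m 0 * m 3 * s + 2 * p * q 0 - p * s * q 1
    + 2 * p ^ 2 * q 2

/-- The Kummer coordinates of the divisor cut out by `H = 0`, `Y = M`. -/
def pointCoord (m : Fin 4 → K) (q : Fin 3 → K) (s p : K) : Fin 4 → K :=
  ![1, s, p, betaCoord m q s p]

/-- The coordinates of the tangent plane at `pointCoord`, see `eval_pderiv_quartic`. -/
def planeCoord (m : Fin 4 → K) (q : Fin 3 → K) (s p : K) : Fin 4 → K :=
  ![2 * m 0 * m 2 - 2 * p * q 0 + p * s * q 1, 2 * m 0 * m 3 - p * q 1,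
    2 * m 1 * m 3 - 2 * p * q 2 + s * q 1, 1]

theorem isCentre_of_coeffs {θ : Fin 6 → K} (hθ : Function.Injective θ) (ω : Fin 6 → Fin 6 → K)
    (t : Fin 6 → K) (v : Fin 4 → K) (z : Fin 4 → Fin 4 → K)
    (h : ∀ i a, t i * (skew (ω i)).mulVec v a
      = z a 3 * θ i ^ 3 + z a 2 * θ i ^ 2 + z a 1 * θ i + z a 0) : IsCentre θ ω t v := by
  refine isCentre_of_rows hθ ω t v
    (fun a => C (z a 3) * X ^ 3 + C (z a 2) * X ^ 2 + C (z a 1) * X + C (z a 0))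
    (fun a => natDegree_cubic_le) fun i a => ?_
  rw [h]; simp

/-- The pencil of lines attached to `P` has its centre at the point `ξ` with `κ(ξ) = P`. -/
theorem isCentre_pointCoord {θ : Fin 6 → K} (hθ : Function.Injective θ) {m : Fin 4 → K}
    {q : Fin 3 → K} {s p : K} (hF : NormIdentity (sextic θ) m q s p) {t : Fin 6 → K}
    (ht : ∀ i, t i * (θ i ^ 2 - s * θ i + p)
      = m 0 + m 1 * θ i + m 2 * θ i ^ 2 + m 3 * θ i ^ 3) (hc : Cone θ q t) :
    IsCentre θ (omega θ) t (pointCoord m q s p) := by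
  obtain ⟨c0, c1, c2, c3, c4, c5, c6⟩ := hF
  set e := m 2 + m 3 * s with he
  set n := m 1 - m 3 * p with hn
  set T0 := 2 * q 0 - s * q 1 + 2 * p * q 2 - 2 * m 1 * m 3 with hT0
  set y0 := -2 * s * q 0 - 2 * m 0 * m 3 + p * q 1 with hy0
  set β := betaCoord m q s p with hβ
  let z1 : Fin 4 → K := ![m 0 * y0 - 2 * n * p * q 0,
    m 1 * y0 + m 0 * (2 * q 0 - 2 * s * q 1) - 2 * (m 2 * p * q 0 + n * (-s * q 0 + p * q 1)),
    m 2 * y0 + m 1 * (2 * q 0 - 2 * s * q 1) + m 0 * (2 * q 1 - 2 * s * q 2)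
      - 2 * (m 3 * p * q 0 + m 2 * (-s * q 0 + p * q 1) + n * (q 0 - s * q 1 + p * q 2)),
    m 3 * y0 + m 2 * (2 * q 0 - 2 * s * q 1) + m 1 * (2 * q 1 - 2 * s * q 2) + m 0 * 2 * q 2
      - 2 * (m 3 * (-s * q 0 + p * q 1) + m 2 * (q 0 - s * q 1 + p * q 2) + n * (q 1 - s * q 2))]
  let z2 : Fin 4 → K := ![m 0 * T0 - 2 * e * p * q 0,
    m 1 * T0 + 2 * m 0 * q 1 - 2 * (m 3 * p * q 0 + e * (-s * q 0 + p * q 1)),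
    m 2 * T0 + 2 * m 1 * q 1 + 2 * m 0 * q 2
      - 2 * (m 3 * (-s * q 0 + p * q 1) + e * (q 0 - s * q 1 + p * q 2)),
    m 3 * T0 + 2 * m 2 * q 1 + 2 * m 1 * q 2
      - 2 * (m 3 * (q 0 - s * q 1 + p * q 2) + e * (q 1 - s * q 2))]
  refine isCentre_of_coeffs hθ _ t _
    ![fun k => -(s * z1 k + p * z2 k - β * m k), z1, z2, fun k => -m k] fun i a => ?_
  have h1 := ht i
  have h3 := hc i
  -- the row `L₂ = -2 M (m₃ X + e) + H T`, and likewise `L₁`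
  have r2 : t i * (skew (omega θ i)).mulVec (pointCoord m q s p) 2
      = z2 3 * θ i ^ 3 + z2 2 * θ i ^ 2 + z2 1 * θ i + z2 0 := by
    rw [skew_mulVec]
    simp only [omega, pointCoord, Matrix.cons_val, z2, c1, c2, c3, c4, c5, hT0, he,
      betaCoord]
    rw [c6] at h3 ⊢
    linear_combination (2 * (m 3 ^ 2 - 1) * θ i ^ 2 + 2 * q 1 * θ i
      + (2 * q 0 - s * q 1 + 2 * p * (m 3 ^ 2 - 1) - 2 * m 1 * m 3)) * h1
      - 2 * (m 2 + m 3 * s + m 3 * θ i) * (-t i * h1 + (θ i ^ 2 - s * θ i + p) * h3)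
  have r1 : t i * (skew (omega θ i)).mulVec (pointCoord m q s p) 1
      = z1 3 * θ i ^ 3 + z1 2 * θ i ^ 2 + z1 1 * θ i + z1 0 := by
    rw [skew_mulVec]
    simp only [omega, pointCoord, Matrix.cons_val, z1, c1, c2, c3, c4, c5, hy0, hn,
      betaCoord]
    rw [c6] at h3 ⊢
    linear_combination (2 * (θ i - s) * (q 0 + q 1 * θ i + (m 3 ^ 2 - 1) * θ i ^ 2)
      - 2 * m 0 * m 3 + p * q 1) * h1
      - 2 * (m 3 * θ i ^ 2 + m 2 * θ i + m 1 - m 3 * p)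
        * (-t i * h1 + (θ i ^ 2 - s * θ i + p) * h3)
  have r3 : t i * (skew (omega θ i)).mulVec (pointCoord m q s p) 3
      = -m 3 * θ i ^ 3 + -m 2 * θ i ^ 2 + -m 1 * θ i + -m 0 := by
    rw [skew_mulVec]
    simp only [omega, pointCoord, Matrix.cons_val]
    linear_combination -h1
  have r0 : (skew (omega θ i)).mulVec (pointCoord m q s p) 0
      = -(s * (skew (omega θ i)).mulVec (pointCoord m q s p) 1
        + p * (skew (omega θ i)).mulVec (pointCoord m q s p) 2
        + β * (skew (omega θ i)).mulVec (pointCoord m q s p) 3) := by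
    rw [skew_mulVec]
    simp only [pointCoord, Matrix.cons_val]
    ring
  fin_cases a
  · simp only [Fin.zero_eta, Matrix.cons_val_zero]
    rw [r0]
    linear_combination -s * r1 - p * r2 - β * r3
  · exact r1
  · exact r2
  · exact r3

/-- The plane of the pencil of lines attached to `P` has the coordinates `planeCoord`; it is found
as the centre of the pencil for the Pfaffian adjoint frame. -/
theorem isCentre_planeCoord {θ : Fin 6 → K} (hθ : Function.Injective θ) {m : Fin 4 → K}
    {q : Fin 3 → K} {s p : K} (hF : NormIdentity (sextic θ) m q s p) {t : Fin 6 → K}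
    (ht : ∀ i, t i * (θ i ^ 2 - s * θ i + p)
      = m 0 + m 1 * θ i + m 2 * θ i ^ 2 + m 3 * θ i ^ 3) (hc : Cone θ q t) :
    IsCentre θ (fun i => pfAdj (omega θ i)) t (planeCoord m q s p) := by
  obtain ⟨c0, c1, c2, c3, c4, c5, c6⟩ := hF
  set η0 := 2 * m 0 * m 2 - 2 * p * q 0 + p * s * q 1 with hη0
  set η1 := 2 * m 0 * m 3 - p * q 1 with hη1
  set η2 := 2 * m 1 * m 3 - 2 * p * q 2 + s * q 1 with hη2
  -- the coefficients of `H Q`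
  set a0 := p * q 0 with ha0
  set a1 := -s * q 0 + p * q 1 with ha1
  set a2 := q 0 - s * q 1 + p * q 2 with ha2
  set a3 := q 1 - s * q 2 with ha3
  let z0 : Fin 4 → K := ![2 * m 3 * a0 - m 0 * q 1, 2 * m 3 * a1 - m 1 * q 1 - 2 * m 0 * q 2,
    2 * m 3 * a2 - m 2 * q 1 - 2 * m 1 * q 2, 2 * m 3 * a3 - m 3 * q 1 - 2 * m 2 * q 2]
  let z1 : Fin 4 → K := ![-(2 * m 2 * a0 + m 0 * (-2 * q 0 + s * q 1)),
    -(2 * m 3 * a0 + 2 * m 2 * a1 + m 1 * (-2 * q 0 + s * q 1) + m 0 * (-2 * q 1 + 2 * s * q 2)),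
    -(2 * m 3 * a1 + 2 * m 2 * a2 + m 2 * (-2 * q 0 + s * q 1) + m 1 * (-2 * q 1 + 2 * s * q 2)
      + m 0 * (-2 * q 2)),
    -(2 * m 3 * a2 + 2 * m 2 * a3 + m 3 * (-2 * q 0 + s * q 1) + m 2 * (-2 * q 1 + 2 * s * q 2)
      + m 1 * (-2 * q 2))]
  let z2 : Fin 4 → K := ![2 * m 1 * a0 + m 0 * (2 * s * q 0 - p * q 1),
    2 * m 2 * a0 + 2 * m 1 * a1 + m 1 * (2 * s * q 0 - p * q 1)
      + m 0 * (-2 * q 0 + 2 * s * q 1 - 2 * p * q 2),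
    2 * m 3 * a0 + 2 * m 2 * a1 + 2 * m 1 * a2 + m 2 * (2 * s * q 0 - p * q 1)
      + m 1 * (-2 * q 0 + 2 * s * q 1 - 2 * p * q 2) + m 0 * (-2 * q 1 + 2 * s * q 2),
    2 * m 3 * a1 + 2 * m 2 * a2 + 2 * m 1 * a3 + m 3 * (2 * s * q 0 - p * q 1)
      + m 2 * (-2 * q 0 + 2 * s * q 1 - 2 * p * q 2) + m 1 * (-2 * q 1 + 2 * s * q 2)
      + m 0 * (-2 * q 2)]
  refine isCentre_of_coeffs hθ _ t _
    ![z0, z1, z2, fun k => -(η0 * z0 k + η1 * z1 k + η2 * z2 k)] fun i a => ?_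
  have h1 := ht i
  have h3 := hc i
  set v := planeCoord m q s p with hv
  have r0 : t i * (skew (pfAdj (omega θ i))).mulVec v 0
      = z0 3 * θ i ^ 3 + z0 2 * θ i ^ 2 + z0 1 * θ i + z0 0 := by
    rw [skew_mulVec]
    simp only [omega, pfAdj, hv, planeCoord, Matrix.cons_val, z0, c1, c2, c3, c4, c5, ha0,
      ha1, ha2, ha3]
    rw [c6] at h3 ⊢
    linear_combination (-2 * (m 3 ^ 2 - 1) * θ i - q 1) * h1
      + 2 * m 3 * (-t i * h1 + (θ i ^ 2 - s * θ i + p) * h3)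
  have r1 : t i * (skew (pfAdj (omega θ i))).mulVec v 1
      = z1 3 * θ i ^ 3 + z1 2 * θ i ^ 2 + z1 1 * θ i + z1 0 := by
    rw [skew_mulVec]
    simp only [omega, pfAdj, hv, planeCoord, Matrix.cons_val, z1, c1, c2, c3, c4, c5, ha0,
      ha1, ha2, ha3]
    rw [c6] at h3 ⊢
    linear_combination -(-2 * (m 3 ^ 2 - 1) * θ i ^ 2 + (-2 * q 1 + 2 * s * (m 3 ^ 2 - 1)) * θ i
        - 2 * q 0 + s * q 1) * h1
      - 2 * (m 3 * θ i + m 2) * (-t i * h1 + (θ i ^ 2 - s * θ i + p) * h3)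
  have r2 : t i * (skew (pfAdj (omega θ i))).mulVec v 2
      = z2 3 * θ i ^ 3 + z2 2 * θ i ^ 2 + z2 1 * θ i + z2 0 := by
    rw [skew_mulVec]
    simp only [omega, pfAdj, hv, planeCoord, Matrix.cons_val, z2, c1, c2, c3, c4, c5, ha0,
      ha1, ha2, ha3]
    rw [c6] at h3 ⊢
    linear_combination (-2 * (m 3 ^ 2 - 1) * θ i ^ 3 + (-2 * q 1 + 2 * s * (m 3 ^ 2 - 1)) * θ i ^ 2
        + (-2 * q 0 + 2 * s * q 1 - 2 * p * (m 3 ^ 2 - 1)) * θ i + 2 * s * q 0 - p * q 1) * h1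
      + 2 * (m 3 * θ i ^ 2 + m 2 * θ i + m 1) * (-t i * h1 + (θ i ^ 2 - s * θ i + p) * h3)
  have r3 : (skew (pfAdj (omega θ i))).mulVec v 3
      = -(η0 * (skew (pfAdj (omega θ i))).mulVec v 0
        + η1 * (skew (pfAdj (omega θ i))).mulVec v 1
        + η2 * (skew (pfAdj (omega θ i))).mulVec v 2) := by
    rw [skew_mulVec]
    simp only [hv, planeCoord, Matrix.cons_val]
    ring
  fin_cases a
  · exact r0
  · exact r1
  · exact r2
  · simp only [Fin.reduceFinMk, Matrix.cons_val]
    rw [r3]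
    linear_combination -η0 * r0 - η1 * r1 - η2 * r2

end Coordinates

end KummerDuality

namespace KummerDuality

open MvPolynomial

/-! ### The quartic equation of the Kummer surface -/

section Quartic

variable {K : Type*} [Field K]

/-- The leading coefficient, in `ξ₃`, of the equation of the Kummer surface: the discriminant of
`ξ₀ X² - ξ₁ X + ξ₂`. -/
noncomputable def quarticR : MvPolynomial (Fin 4) K := X 1 ^ 2 - C 4 * X 0 * X 2

/-- The linear coefficient of the equation of the Kummer surface. -/
noncomputable def quarticS (F : Polynomial K) : MvPolynomial (Fin 4) K :=
  C (-2) * (C (2 * F.coeff 0) * X 0 ^ 3 + C (F.coeff 1) * X 0 ^ 2 * X 1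
    + C (2 * F.coeff 2) * X 0 ^ 2 * X 2 + C (F.coeff 3) * X 0 * X 1 * X 2
    + C (2 * F.coeff 4) * X 0 * X 2 ^ 2 + C (F.coeff 5) * X 1 * X 2 ^ 2 + C 2 * X 2 ^ 3)

/-- The constant coefficient of the equation of the Kummer surface. -/
noncomputable def quarticT (F : Polynomial K) : MvPolynomial (Fin 4) K :=
  C (F.coeff 1 ^ 2 - 4 * F.coeff 0 * F.coeff 2) * X 0 ^ 4
    - C (4 * F.coeff 0 * F.coeff 3) * X 0 ^ 3 * X 1
    - C (2 * F.coeff 1 * F.coeff 3) * X 0 ^ 3 * X 2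
    - C (4 * F.coeff 0 * F.coeff 4) * X 0 ^ 2 * X 1 ^ 2
    + C (4 * (F.coeff 0 * F.coeff 5 - F.coeff 1 * F.coeff 4)) * X 0 ^ 2 * X 1 * X 2
    + C (F.coeff 3 ^ 2 + 2 * F.coeff 1 * F.coeff 5 - 4 * F.coeff 2 * F.coeff 4
      - 4 * F.coeff 0) * X 0 ^ 2 * X 2 ^ 2
    - C (4 * F.coeff 0 * F.coeff 5) * X 0 * X 1 ^ 3
    + C (4 * (2 * F.coeff 0 - F.coeff 1 * F.coeff 5)) * X 0 * X 1 ^ 2 * X 2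
    + C (4 * (F.coeff 1 - F.coeff 2 * F.coeff 5)) * X 0 * X 1 * X 2 ^ 2
    - C (2 * F.coeff 3 * F.coeff 5) * X 0 * X 2 ^ 3
    - C (4 * F.coeff 0) * X 1 ^ 4 - C (4 * F.coeff 1) * X 1 ^ 3 * X 2
    - C (4 * F.coeff 2) * X 1 ^ 2 * X 2 ^ 2 - C (4 * F.coeff 3) * X 1 * X 2 ^ 3
    + C (F.coeff 5 ^ 2 - 4 * F.coeff 4) * X 2 ^ 4

/-- The quartic equation of the Kummer surface of `Y² = F(X)`, for a monic sextic `F`. -/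
noncomputable def quartic (F : Polynomial K) : MvPolynomial (Fin 4) K :=
  quarticR * X 3 ^ 2 + quarticS F * X 3 + quarticT F

/-- The norm of `M` in `K[X]/(H)`, that is `M(x) M(u)` if `x, u` are the roots of `H`. -/
def normM (m : Fin 4 → K) (s p : K) : K :=
  m 0 ^ 2 + m 1 ^ 2 * p + m 2 ^ 2 * p ^ 2 + m 3 ^ 2 * p ^ 3 + m 0 * m 1 * s + m 1 * m 2 * p * s
    + m 2 * m 3 * p ^ 2 * s + m 0 * m 2 * (s ^ 2 - 2 * p) + m 1 * m 3 * p * (s ^ 2 - 2 * p)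
    + m 0 * m 3 * (s ^ 3 - 3 * p * s)

/-- The gradient of the quartic at a general point is a multiple of the plane of its pencil. -/
theorem eval_pderiv_quartic {F : Polynomial K} {m : Fin 4 → K} {q : Fin 3 → K} {s p : K}
    (hF : NormIdentity F m q s p) (c : K) (j : Fin 4) :
    eval (c • pointCoord m q s p) (pderiv j (quartic F))
      = (-4 * c ^ 3 * normM m s p) * planeCoord m q s p j := by
  obtain ⟨c0, c1, c2, c3, c4, c5, c6⟩ := hF
  fin_cases j <;>
  · simp [quartic, quarticR, quarticS, quarticT, pderiv_X,
      Derivation.leibniz, Derivation.leibniz_pow, pointCoord, planeCoord, normM,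
      c0, c1, c2, c3, c4, c5, c6, betaCoord]
    ring

end Quartic

end KummerDuality

namespace KummerDuality

open Polynomial

/-! ### The birational map from the Kummer surface -/

section Values

variable {K : Type*} [Field K]

/-- The values `P(θᵢ)` of the polynomial with the coefficients `p`. -/
noncomputable def ev (θ p : Fin 6 → K) : Fin 6 → K := fun i => (toPoly p).eval (θ i)

theorem ev_apply (θ p : Fin 6 → K) (i : Fin 6) : ev θ p i = ∑ j, p j * θ i ^ (j : ℕ) := by
  simp [ev, toPoly, eval_finsetSum]

theorem ev_smul (θ p : Fin 6 → K) (c : K) : ev θ (c • p) = c • ev θ p := by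
  funext i
  simp [ev]

theorem toPoly_natDegree (p : Fin 6 → K) : (toPoly p).natDegree ≤ 5 := by
  change (∑ j : Fin 6, C (p j) * X ^ (j : ℕ)).natDegree ≤ 5
  refine natDegree_sum_le_of_forall_le _ _ fun i _ => ?_
  exact (natDegree_C_mul_X_pow_le _ _).trans (by omega)

theorem toPoly_injective : Function.Injective (toPoly : (Fin 6 → K) →ₗ[K] K[X]) := by
  intro p p' h
  funext j
  rw [← coeff_toPoly p j, h, coeff_toPoly]

theorem ev_injective {θ : Fin 6 → K} (hθ : Function.Injective θ) :
    Function.Injective (ev θ) := by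
  intro p p' h
  apply toPoly_injective
  refine sub_eq_zero.1 (eq_zero_of_eval_roots hθ ?_ fun i => ?_)
  · exact (natDegree_sub_le _ _).trans (max_le (toPoly_natDegree p) (toPoly_natDegree p'))
  · rw [eval_sub, sub_eq_zero]; exact congrFun h i

theorem ev_zero (θ : Fin 6 → K) : ev θ 0 = 0 := by
  funext i; simp [ev]

theorem ev_ne_zero {θ : Fin 6 → K} (hθ : Function.Injective θ) {p : Fin 6 → K} (hp : p ≠ 0) :
    ev θ p ≠ 0 := fun h => hp (ev_injective hθ (h.trans (ev_zero θ).symm))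

/-- The coefficients of the polynomial with given values. -/
noncomputable def coeffsOf (θ t : Fin 6 → K) : Fin 6 → K := fun j => (interp θ t).coeff j

theorem toPoly_coeffsOf (θ t : Fin 6 → K) : toPoly (coeffsOf θ t) = interp θ t := by
  refine toPoly_coeff _ ?_
  exact (degree_le_of_natDegree_le (interp_natDegree θ t)).trans_lt
    (by exact_mod_cast (by norm_num : 5 < 6))

theorem ev_coeffsOf {θ : Fin 6 → K} (hθ : Function.Injective θ) (t : Fin 6 → K) :
    ev θ (coeffsOf θ t) = t := by
  funext i
  rw [ev, toPoly_coeffsOf, interp_eval hθ]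

theorem coeffsOf_ev {θ : Fin 6 → K} (hθ : Function.Injective θ) (p : Fin 6 → K) :
    coeffsOf θ (ev θ p) = p := ev_injective hθ (ev_coeffsOf hθ _)

theorem coeffsOf_apply (θ t : Fin 6 → K) (j : Fin 6) :
    coeffsOf θ t j = ∑ i, t i * ((cofactor θ i).coeff j / wt θ i) := by
  simp only [coeffsOf, interp, finsetSum_coeff, coeff_C_mul]
  exact Finset.sum_congr rfl fun i _ => by ring

/-- In terms of the values `tᵢ = P(θᵢ)` the involution `ε⁽ⁱ⁾` changes the sign of `tᵢ`, because
`gᵢ(θⱼ) = 1` for `j ≠ i` and `gᵢ(θᵢ) = -1`. -/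
theorem ev_epsLin {θ : Fin 6 → K} (hθ : Function.Injective θ) (i : Fin 6) (p : Fin 6 → K) :
    ev θ (epsLin θ i p) = Function.update (ev θ p) i (-ev θ p i) := by
  funext j
  have h : (toPoly (epsLin θ i p)).eval (θ j) = (gPoly θ i * toPoly p).eval (θ j) := by
    rw [toPoly_epsLin]
    conv_rhs => rw [← modByMonic_add_div (gPoly θ i * toPoly p) (sextic θ)]
    rw [eval_add, eval_mul (p := sextic θ), sextic_eval_root, zero_mul, add_zero]
  simp only [ev]
  rw [h]
  by_cases hj : j = i
  · subst hj
    rw [Function.update_self, eval_mul, gPoly, eval_sub, eval_mul, eval_C, eval_one,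
      div_mul_cancel₀ _ (cofactor_eval_ne_zero hθ j)]
    ring
  · rw [Function.update_of_ne hj, eval_mul, gPoly, eval_sub, eval_mul, eval_C, eval_one,
      cofactor_eval_of_ne θ hj, mul_zero, sub_zero, one_mul]
    rfl

theorem Cone.onCone {θ : Fin 6 → K} (hθ : Function.Injective θ) {q : Fin 3 → K} {t : Fin 6 → K}
    (h : Cone θ q t) : OnCone θ t := by
  intro m hm
  rw [← res_moment_eq_zero hθ (P := C (q 2) * X ^ 2 + C (q 1) * X + C (q 0)) (m := m)]
  · congr 1
    funext i
    rw [h i]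
    simp only [eval_add, eval_mul, eval_C, eval_X, eval_pow]
    ring
  · have : (C (q 2) * X ^ 2 + C (q 1) * X + C (q 0)).natDegree ≤ 2 := natDegree_quadratic_le
    omega

theorem exists_quadratic {P : K[X]} (h : P.natDegree ≤ 2) :
    P = C (P.coeff 0) + C (P.coeff 1) * X + C (P.coeff 2) * X ^ 2 := by
  conv_lhs => rw [P.as_sum_range' 3 (by omega)]
  simp [Finset.sum_range_succ, ← C_mul_X_pow_eq_monomial]

theorem exists_cubic {P : K[X]} (h : P.natDegree ≤ 3) :
    P = C (P.coeff 0) + C (P.coeff 1) * X + C (P.coeff 2) * X ^ 2 + C (P.coeff 3) * X ^ 3 := by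
  conv_lhs => rw [P.as_sum_range' 4 (by omega)]
  simp [Finset.sum_range_succ, ← C_mul_X_pow_eq_monomial]

/-- The surface in terms of the values at the roots. -/
theorem mem_desingKummer_iff {θ : Fin 6 → K} (hθ : Function.Injective θ) (p : Fin 6 → K)
    (hp : p ≠ 0) : (Projectivization.mk K p hp : PSpace K 5) ∈ desingKummer θ ↔
      ∃ q, Cone θ q (ev θ p) := by
  rw [mk_mem_desingKummer]
  constructor
  · intro h
    have hd : (toPoly p ^ 2 %ₘ sextic θ).natDegree ≤ 2 := natDegree_le_of_degree_le h
    have he := exists_quadratic hd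
    set Q := toPoly p ^ 2 %ₘ sextic θ with hQ
    refine ⟨fun j => Q.coeff j, fun i => ?_⟩
    have h3 : Q.eval (θ i) = (toPoly p ^ 2).eval (θ i) := by
      conv_rhs => rw [← modByMonic_add_div (toPoly p ^ 2) (sextic θ)]
      rw [eval_add, eval_mul, sextic_eval_root, zero_mul, add_zero]
    rw [he] at h3
    simp only [eval_add, eval_mul, eval_C, eval_X, eval_pow] at h3
    simp only [ev, Fin.val_zero, Fin.val_one, Fin.val_two]
    linear_combination -h3
  · rintro ⟨q, hq⟩
    set Q := C (q 2) * X ^ 2 + C (q 1) * X + C (q 0) with hQ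
    have hd : Q.degree ≤ 2 := degree_quadratic_le
    have : toPoly p ^ 2 %ₘ sextic θ = Q := by
      have h1 : Q %ₘ sextic θ = Q := by
        rw [modByMonic_eq_self_iff (sextic_monic θ), degree_eq_natDegree (sextic_monic θ).ne_zero,
          sextic_natDegree]
        exact hd.trans_lt (by exact_mod_cast (by norm_num : 2 < 6))
      rw [← h1]
      refine modByMonic_eq_of_dvd_sub (sextic_monic θ) ((sextic_dvd_iff hθ _).2 fun i => ?_)
      rw [eval_sub, eval_pow, hQ]
      have := hq i
      simp only [ev] at this
      rw [this]; simp; ring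
    rw [this]
    exact hd

end Values

section Kappa

variable {K : Type*} [Field K]

theorem sq_dvd_of_eval {P : K[X]} {x : K} (h : P.eval x = 0) (h' : (derivative P).eval x = 0) :
    (X - C x) ^ 2 ∣ P := by
  obtain ⟨R, rfl⟩ := dvd_iff_isRoot.2 h
  simp only [derivative_mul, derivative_sub, derivative_X, derivative_C, sub_zero, one_mul,
    eval_add, eval_mul, eval_sub, eval_X, eval_C, sub_self, zero_mul, add_zero] at h'
  rw [pow_two]
  exact mul_dvd_mul_left _ (dvd_iff_isRoot.2 h')

/-- The data of `IsKappa` in terms of coefficients: `m` are the coefficients of `M`, `q` those of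
`(M² - F) / ((X - x)(X - u))²`, which is congruent to `P²`, and `t` are the values of `P` at the
roots. -/
structure KappaData (θ : Fin 6 → K) (x y u v : K) (m : Fin 4 → K) (q : Fin 3 → K)
    (t : Fin 6 → K) : Prop where
  norm : NormIdentity (sextic θ) m q (x + u) (x * u)
  values : ∀ i, t i * (θ i ^ 2 - (x + u) * θ i + x * u)
    = m 0 + m 1 * θ i + m 2 * θ i ^ 2 + m 3 * θ i ^ 3
  cone : Cone θ q t
  coord : kummerCoord (sextic θ) x y u v = pointCoord m q (x + u) (x * u)
  left : y = m 0 + m 1 * x + m 2 * x ^ 2 + m 3 * x ^ 3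
  right : v = m 0 + m 1 * u + m 2 * u ^ 2 + m 3 * u ^ 3
  left_sq : y ^ 2 = (sextic θ).eval x
  right_sq : v ^ 2 = (sextic θ).eval u
  mul_ne : y * v ≠ 0
  ne : x ≠ u

theorem normM_eq (m : Fin 4 → K) (x u : K) : normM m (x + u) (x * u)
    = (m 0 + m 1 * x + m 2 * x ^ 2 + m 3 * x ^ 3)
      * (m 0 + m 1 * u + m 2 * u ^ 2 + m 3 * u ^ 3) := by
  simp only [normM]; ring

theorem exists_kappaData {θ : Fin 6 → K} {x y u v : K} {M : K[X]} {p : Fin 6 → K}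
    (hy : y ^ 2 = (sextic θ).eval x) (hv : v ^ 2 = (sextic θ).eval u) (hyv : y * v ≠ 0)
    (hxu : x ≠ u) (hM : M.natDegree ≤ 3) (hMx : M.eval x = y) (hMu : M.eval u = v)
    (hx2 : (X - C x) ^ 2 ∣ M ^ 2 - sextic θ) (hu2 : (X - C u) ^ 2 ∣ M ^ 2 - sextic θ)
    (hP : sextic θ ∣ (X - C x) * (X - C u) * toPoly p - M) :
    ∃ m q, KappaData θ x y u v m q (ev θ p) := by
  have hcop : IsCoprime ((X - C x) ^ 2) ((X - C u) ^ 2) :=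
    (isCoprime_X_sub_C_of_isUnit_sub (sub_ne_zero.2 hxu).isUnit).pow
  obtain ⟨Q, hQ⟩ := hcop.mul_dvd hx2 hu2
  have hmon : ((X - C x) ^ 2 * (X - C u) ^ 2).Monic :=
    ((monic_X_sub_C x).pow 2).mul ((monic_X_sub_C u).pow 2)
  have hnd : ((X - C x) ^ 2 * (X - C u) ^ 2).natDegree = 4 := by
    rw [((monic_X_sub_C x).pow 2).natDegree_mul ((monic_X_sub_C u).pow 2)]
    simp [natDegree_pow]
  have hQd : Q.natDegree ≤ 2 := by
    by_cases hQ0 : Q = 0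
    · simp [hQ0]
    have h1 := congrArg natDegree hQ
    rw [hmon.natDegree_mul' hQ0, hnd] at h1
    have h3 : (M ^ 2 - sextic θ).natDegree ≤ 6 := by
      refine (natDegree_sub_le _ _).trans (max_le ?_ (sextic_natDegree θ).le)
      exact natDegree_pow_le.trans (by omega)
    omega
  have eM := exists_cubic hM
  have eQ := exists_quadratic hQd
  set m : Fin 4 → K := fun j => M.coeff j with hm
  set q : Fin 3 → K := fun j => Q.coeff j with hq
  have eM' : M = C (m 0) + C (m 1) * X + C (m 2) * X ^ 2 + C (m 3) * X ^ 3 := eM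
  have eQ' : Q = C (q 0) + C (q 1) * X + C (q 2) * X ^ 2 := eQ
  clear_value m q
  set s := x + u with hs
  set r := x * u with hr
  have hF : sextic θ = C (m 0 ^ 2 - r ^ 2 * q 0)
      + C (2 * m 0 * m 1 + 2 * s * r * q 0 - r ^ 2 * q 1) * X
      + C (2 * m 0 * m 2 + m 1 ^ 2 - (s ^ 2 + 2 * r) * q 0 + 2 * s * r * q 1
        - r ^ 2 * q 2) * X ^ 2
      + C (2 * m 0 * m 3 + 2 * m 1 * m 2 + 2 * s * q 0 - (s ^ 2 + 2 * r) * q 1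
        + 2 * s * r * q 2) * X ^ 3
      + C (m 2 ^ 2 + 2 * m 1 * m 3 - q 0 + 2 * s * q 1 - (s ^ 2 + 2 * r) * q 2) * X ^ 4
      + C (2 * m 2 * m 3 - q 1 + 2 * s * q 2) * X ^ 5 + C (m 3 ^ 2 - q 2) * X ^ 6 := by
    have : sextic θ = M ^ 2 - (X - C x) ^ 2 * (X - C u) ^ 2 * Q := by rw [← hQ]; ring
    rw [this, eM', eQ']
    simp only [hs, hr, map_add, map_sub, map_mul, map_pow, map_ofNat]
    ring
  have hcoef : ∀ n, (sextic θ).coeff n = _ := fun n => congrArg (fun P => coeff P n) hF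
  have c0 := hcoef 0
  have c1 := hcoef 1
  have c2 := hcoef 2
  have c3 := hcoef 3
  have c4 := hcoef 4
  have c5 := hcoef 5
  have c6 := hcoef 6
  clear hcoef
  simp only [coeff_add, coeff_C_mul, coeff_X_pow, coeff_C, coeff_X] at c0 c1 c2 c3 c4 c5 c6
  norm_num at c0 c1 c2 c3 c4 c5 c6
  rw [sextic_coeff_six] at c6
  have hN : NormIdentity (sextic θ) m q s r :=
    ⟨c0, c1, c2, c3, c4, c5, by linear_combination c6⟩
  have hx' : y = m 0 + m 1 * x + m 2 * x ^ 2 + m 3 * x ^ 3 := by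
    rw [← hMx, eM']; simp
  have hu' : v = m 0 + m 1 * u + m 2 * u ^ 2 + m 3 * u ^ 3 := by
    rw [← hMu, eM']; simp
  have hval : ∀ i, ev θ p i * (θ i ^ 2 - s * θ i + r)
      = m 0 + m 1 * θ i + m 2 * θ i ^ 2 + m 3 * θ i ^ 3 := by
    intro i
    obtain ⟨E, hE⟩ := hP
    have := congrArg (Polynomial.eval (θ i)) hE
    rw [eval_mul (p := sextic θ), sextic_eval_root, zero_mul, eM'] at this
    simp only [eval_sub, eval_add, eval_mul, eval_X, eval_C, eval_pow] at this
    simp only [ev, hs, hr]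
    linear_combination this
  refine ⟨m, q, hN, hval, fun i => ?_, ?_, hx', hu', hy, hv, hyv, hxu⟩
  · -- `H(θᵢ) ≠ 0`, because the roots of `H` are not roots of `F`
    have hH : ∀ z w, w ≠ 0 → w ^ 2 = (sextic θ).eval z → θ i - z ≠ 0 := by
      intro z w hw hz h0
      rw [← sub_eq_zero.1 h0, sextic_eval_root] at hz
      exact hw (pow_eq_zero_iff two_ne_zero |>.1 hz)
    have h1 := hH x y (left_ne_zero_of_mul hyv) hy
    have h3 := hH u v (right_ne_zero_of_mul hyv) hv
    have h4 := congrArg (Polynomial.eval (θ i)) hQ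
    rw [eval_sub, sextic_eval_root, eM', eQ'] at h4
    simp only [eval_add, eval_mul, eval_X, eval_C, eval_pow, eval_sub] at h4
    have h5 := hval i
    have h6 : ((θ i - x) * (θ i - u)) ^ 2 ≠ 0 := pow_ne_zero 2 (mul_ne_zero h1 h3)
    apply mul_left_cancel₀ h6
    rw [← h5] at h4
    simp only [hs, hr] at h4
    linear_combination h4
  · have hd : (x - u) ^ 2 ≠ 0 := pow_ne_zero 2 (sub_ne_zero.2 hxu)
    have hβ : (F₀ (sextic θ) x u - 2 * y * v) / (x - u) ^ 2 = betaCoord m q s r := by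
      rw [div_eq_iff hd, F₀, c0, c1, c2, c3, c4, c5, sextic_coeff_six, hx', hu', betaCoord]
      have c6' : q 2 = m 3 ^ 2 - 1 := by linear_combination c6
      rw [c6']
      simp only [hs, hr]
      ring
    rw [kummerCoord, pointCoord, hβ]

theorem IsKappa.exists_data {θ : Fin 6 → K} {ξ : PSpace K 3} {s : PSpace K 5}
    (h : IsKappa θ ξ s) : ∃ x y u v m q, ∃ (p : Fin 6 → K) (hp : p ≠ 0),
      KappaData θ x y u v m q (ev θ p) ∧ ξ = kummerPoint (sextic θ) x y u v ∧
      s = Projectivization.mk K p hp := by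
  obtain ⟨x, y, u, v, M, p, hp, h1, h3, h4, h5, h6, h7, h8, h9, h10, h11, h12, h13⟩ := h
  obtain ⟨m, q, hd⟩ := exists_kappaData h1 h3 h4 h5 h6 h7 h8 h9 h10 h11
  exact ⟨x, y, u, v, m, q, p, hp, hd, h12, h13⟩

/-- Each general point of the Kummer surface has an image in the surface in `ℙ⁵`: the cubic `M` is
found by Hermite interpolation, and `P` by interpolating `M / H` at the roots. -/
theorem exists_isKappa {θ : Fin 6 → K} (hθ : Function.Injective θ) (h2 : (2 : K) ≠ 0)
    {x y u v : K} (hy : y ^ 2 = (sextic θ).eval x) (hv : v ^ 2 = (sextic θ).eval u)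
    (hyv : y * v ≠ 0) (hxu : x ≠ u) : ∃ (p : Fin 6 → K) (hp : p ≠ 0),
      IsKappa θ (kummerPoint (sextic θ) x y u v) (Projectivization.mk K p hp) := by
  have hy0 := left_ne_zero_of_mul hyv
  have hv0 := right_ne_zero_of_mul hyv
  set a := (derivative (sextic θ)).eval x / (2 * y) with ha
  set c := (derivative (sextic θ)).eval u / (2 * v) with hc
  have ha' : 2 * y * a = (derivative (sextic θ)).eval x := by
    rw [ha]; field_simp
  have hc' : 2 * v * c = (derivative (sextic θ)).eval u := by
    rw [hc]; field_simp
  have hd : u - x ≠ 0 := sub_ne_zero.2 hxu.symm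
  set d := u - x with hd'
  set A := (v - y - a * d) / d ^ 2 with hA
  have hA' : A * d ^ 2 = v - y - a * d := by rw [hA]; field_simp
  set B := (c - a - 2 * A * d) / d ^ 2 with hB
  have hB' : B * d ^ 2 = c - a - 2 * A * d := by rw [hB]; field_simp
  let M : K[X] := C y + C a * (X - C x) + C A * (X - C x) ^ 2 + C B * (X - C x) ^ 2 * (X - C u)
  have hMd : M.natDegree ≤ 3 := by
    simp only [M]; compute_degree
  have hMx : M.eval x = y := by simp [M]
  have hMu : M.eval u = v := by
    simp [M]
    linear_combination hA'
  have hMx' : (derivative M).eval x = a := by simp [M, derivative_pow]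
  have hMu' : (derivative M).eval u = c := by
    simp [M, derivative_pow]
    linear_combination hB'
  have hx2 : (X - C x) ^ 2 ∣ M ^ 2 - sextic θ := by
    refine sq_dvd_of_eval ?_ ?_
    · rw [eval_sub, eval_pow, hMx, hy, sub_self]
    · rw [derivative_sub, derivative_pow, eval_sub, ← ha']
      simp [hMx, hMx']
  have hu2 : (X - C u) ^ 2 ∣ M ^ 2 - sextic θ := by
    refine sq_dvd_of_eval ?_ ?_
    · rw [eval_sub, eval_pow, hMu, hv, sub_self]
    · rw [derivative_sub, derivative_pow, eval_sub, ← hc']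
      simp [hMu, hMu']
  have hH : ∀ i z w, w ≠ 0 → w ^ 2 = (sextic θ).eval z → θ i - z ≠ 0 := by
    intro i z w hw hz h0
    rw [← sub_eq_zero.1 h0, sextic_eval_root] at hz
    exact hw (pow_eq_zero_iff two_ne_zero |>.1 hz)
  set t : Fin 6 → K := fun i => M.eval (θ i) / ((θ i - x) * (θ i - u)) with ht
  have hP : sextic θ ∣ (X - C x) * (X - C u) * toPoly (coeffsOf θ t) - M := by
    rw [sextic_dvd_iff hθ]
    intro i
    have h1 := congrFun (ev_coeffsOf hθ t) i
    simp only [ev] at h1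
    rw [eval_sub, eval_mul, h1, ht]
    simp only [eval_mul, eval_sub, eval_X, eval_C]
    rw [mul_div_cancel₀ _ (mul_ne_zero (hH i x y hy0 hy) (hH i u v hv0 hv)), sub_self]
  have hp : coeffsOf θ t ≠ 0 := by
    intro h0
    rw [h0, map_zero, mul_zero, zero_sub, dvd_neg] at hP
    have := eq_zero_of_dvd_of_natDegree_lt hP (by rw [sextic_natDegree]; omega)
    rw [this] at hMx
    exact hy0 (by rw [← hMx]; simp)
  exact ⟨coeffsOf θ t, hp, x, y, u, v, M, coeffsOf θ t, hp, hy, hv, hyv, hxu, hMd, hMx, hMu,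
    hx2, hu2, hP, rfl, rfl⟩

theorem KappaData.isCentre {θ : Fin 6 → K} (hθ : Function.Injective θ) {x y u v : K}
    {m : Fin 4 → K} {q : Fin 3 → K} {t : Fin 6 → K} (h : KappaData θ x y u v m q t) :
    IsCentre θ (omega θ) t (kummerCoord (sextic θ) x y u v) := by
  rw [h.coord]
  exact isCentre_pointCoord hθ h.norm h.values h.cone

/-- If `v` is the centre of the pencil of `P`, then `P` times the quadratic polynomial attached to
`v` is a polynomial of degree at most `3` modulo `F`. -/
theorem exists_cubic_of_isCentre {θ : Fin 6 → K} (hθ : Function.Injective θ) {t : Fin 6 → K}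
    {v : Fin 4 → K} (h : IsCentre θ (omega θ) t v) : ∃ M : K[X], M.natDegree ≤ 3 ∧
      ∀ i, M.eval (θ i) = t i * (v 0 * θ i ^ 2 - v 1 * θ i + v 2) := by
  have h1 := congrFun h.1 3
  have h3 := congrFun h.2 3
  rw [skew_line_mulVec] at h1 h3
  simp only [skew_mulVec, omega, Matrix.cons_val, Pi.zero_apply] at h1 h3
  refine exists_interp_degree hθ _ 2 (by norm_num) fun k hk => ?_
  interval_cases k
  · rw [← neg_eq_zero, ← h1, ← neg_one_mul, ← res_mul_left]
    congr 1; funext i; ring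
  · rw [← neg_eq_zero, ← h3, ← neg_one_mul, ← res_mul_left]
    congr 1; funext i; simp only [shift]; ring

/-- A point of the surface whose pencil has the centre `v` is in the image of `κ` if the
quadratic polynomial attached to `v` and the residue of `P²` have nonzero discriminants. -/
theorem isKappa_of_disc_ne_zero [IsAlgClosed K] {θ : Fin 6 → K} (hθ : Function.Injective θ)
    {q : Fin 3 → K} {p : Fin 6 → K} (hp : p ≠ 0) (hc : Cone θ q (ev θ p)) {v : Fin 4 → K}
    (hv : IsCentre θ (omega θ) (ev θ p) v) (hq : q 1 ^ 2 - 4 * q 0 * q 2 ≠ 0)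
    (hv0 : v 0 ≠ 0) (hvd : v 1 ^ 2 - 4 * v 0 * v 2 ≠ 0) :
    ∃ ξ, IsKappa θ ξ (Projectivization.mk K p hp) := by
  -- the roots `x`, `u` of the quadratic polynomial `H`
  obtain ⟨x, hx⟩ : ∃ x, v 0 * x ^ 2 - v 1 * x + v 2 = 0 := by
    have hdeg : (C (v 0) * X ^ 2 + C (-v 1) * X + C (v 2)).degree ≠ 0 := by
      rw [degree_quadratic hv0]; decide
    obtain ⟨x, hx⟩ := IsAlgClosed.exists_root _ hdeg
    refine ⟨x, ?_⟩
    simp only [IsRoot.def, eval_add, eval_mul, eval_C, eval_pow, eval_X] at hx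
    linear_combination hx
  set u := v 1 / v 0 - x with hu
  have hv1 : v 1 = v 0 * (x + u) := by rw [hu]; field_simp; ring
  have hv2 : v 2 = v 0 * (x * u) := by rw [hv1] at hx; linear_combination hx
  have hxu : x ≠ u := by
    rintro h
    apply hvd
    rw [hv1, hv2, ← h]; ring
  obtain ⟨M, hM, hMe⟩ := exists_cubic_of_isCentre hθ hv
  set H : K[X] := (X - C x) * (X - C u) with hHdef
  have hHm : H.Monic := (monic_X_sub_C x).mul (monic_X_sub_C u)
  have hHd : H.natDegree = 2 := by
    rw [hHdef, (monic_X_sub_C x).natDegree_mul (monic_X_sub_C u)]; simp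
  set Q : K[X] := C (q 2) * X ^ 2 + C (q 1) * X + C (q 0) with hQ
  have hQd : Q.natDegree ≤ 2 := natDegree_quadratic_le
  have hMe' : ∀ i, M.eval (θ i) = v 0 * ev θ p i * H.eval (θ i) := by
    intro i
    rw [hMe, hHdef, hv1, hv2]; simp; ring
  have hQe : ∀ i, Q.eval (θ i) = ev θ p i ^ 2 := by
    intro i
    rw [hc i, hQ]; simp; ring
  -- divide by the leading coefficient of the quadratic polynomial; `N² - H² Q` is then a constant
  -- multiple of `F`, by the degrees
  set N : K[X] := C (v 0)⁻¹ * M with hN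
  have hNd : N.natDegree ≤ 3 := (natDegree_C_mul_le _ _).trans hM
  have hNe : ∀ i, N.eval (θ i) = ev θ p i * H.eval (θ i) := by
    intro i
    rw [hN, eval_mul, eval_C, hMe']; field_simp
  obtain ⟨E, hE⟩ := (sextic_dvd_iff hθ (N ^ 2 - H ^ 2 * Q)).2 fun i => by
    rw [eval_sub, eval_mul, eval_pow, eval_pow, hNe, hQe]; ring
  have hEd : E.natDegree = 0 := by
    by_cases hE0 : E = 0
    · simp [hE0]
    have h1 := congrArg natDegree hE
    rw [(sextic_monic θ).natDegree_mul' hE0, sextic_natDegree] at h1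
    have h3 : (N ^ 2 - H ^ 2 * Q).natDegree ≤ 6 := by
      refine (natDegree_sub_le _ _).trans (max_le ?_ ?_)
      · exact natDegree_pow_le.trans (by omega)
      · refine natDegree_mul_le.trans ?_
        have : (H ^ 2).natDegree ≤ 4 := natDegree_pow_le.trans (by omega)
        omega
    omega
  obtain ⟨e, rfl⟩ := natDegree_eq_zero.1 hEd
  have he : e ≠ 0 := by
    -- otherwise `Q` would be the square of a linear polynomial
    rintro rfl
    rw [C_0, mul_zero, sub_eq_zero] at hE
    have hroot : ∀ z, H.eval z = 0 → N.eval z = 0 := by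
      intro z hz
      have := congrArg (Polynomial.eval z) hE
      rw [eval_mul, eval_pow, eval_pow, hz] at this
      exact pow_eq_zero_iff two_ne_zero |>.1 (this.trans (by ring))
    have hdvd : H ∣ N := (isCoprime_X_sub_C_of_isUnit_sub (sub_ne_zero.2 hxu).isUnit).mul_dvd
      (dvd_iff_isRoot.2 (hroot x (by simp [hHdef]))) (dvd_iff_isRoot.2 (hroot u (by simp [hHdef])))
    obtain ⟨R, hR⟩ := hdvd
    have hRd : R.natDegree ≤ 1 := by
      by_cases hR0 : R = 0
      · simp [hR0]
      have h1 := congrArg natDegree hR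
      rw [hHm.natDegree_mul' hR0, hHd] at h1
      omega
    have hQR : Q = R ^ 2 := by
      apply mul_left_cancel₀ (pow_ne_zero 2 hHm.ne_zero)
      rw [← hE, hR]; ring
    rw [eq_X_add_C_of_natDegree_le_one hRd] at hQR
    have hQR' : Q = C (R.coeff 1 ^ 2) * X ^ 2 + C (2 * R.coeff 0 * R.coeff 1) * X
        + C (R.coeff 0 ^ 2) := by
      rw [hQR]; simp only [map_mul, map_pow, map_ofNat]; ring
    have k2 := congrArg (fun P => coeff P 2) hQR'
    have k1 := congrArg (fun P => coeff P 1) hQR'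
    have k0 := congrArg (fun P => coeff P 0) hQR'
    simp only [hQ, coeff_add, coeff_C_mul, coeff_X_pow, coeff_X, coeff_C] at k0 k1 k2
    norm_num at k0 k1 k2
    apply hq
    rw [k0, k1, k2]; ring
  obtain ⟨r, hr⟩ := IsAlgClosed.exists_pow_nat_eq e (n := 2) (by norm_num)
  have hr0 : r ≠ 0 := by rintro rfl; exact he (by rw [← hr]; ring)
  set L : K[X] := C r⁻¹ * N with hL
  have hrr : (C r⁻¹ * C r : K[X]) = 1 := by rw [← C_mul, inv_mul_cancel₀ hr0, C_1]
  have hLF : L ^ 2 - sextic θ = H ^ 2 * (C r⁻¹ ^ 2 * Q) := by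
    rw [hL]
    have : (C e : K[X]) = C r ^ 2 := by rw [← hr, C_pow]
    rw [this] at hE
    linear_combination C r⁻¹ ^ 2 * hE + sextic θ * (C r⁻¹ * C r + 1) * hrr
  have hLd : L.natDegree ≤ 3 := (natDegree_C_mul_le _ _).trans hNd
  have hx2 : (X - C x) ^ 2 ∣ L ^ 2 - sextic θ := by
    rw [hLF, hHdef]; exact ⟨(X - C u) ^ 2 * (C r⁻¹ ^ 2 * Q), by ring⟩
  have hu2 : (X - C u) ^ 2 ∣ L ^ 2 - sextic θ := by
    rw [hLF, hHdef]; exact ⟨(X - C x) ^ 2 * (C r⁻¹ ^ 2 * Q), by ring⟩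
  -- a common root of `H` and `L` would be a double root of `F`
  have hne : ∀ z, (X - C z) ^ 2 ∣ L ^ 2 - sextic θ → L.eval z ≠ 0 := by
    intro z hz h0
    have h1 : (X - C z) ^ 2 ∣ L ^ 2 := pow_dvd_pow_of_dvd (dvd_iff_isRoot.2 h0) 2
    have h3 : (X - C z) ^ 2 ∣ sextic θ := by
      have := dvd_sub h1 hz
      rwa [sub_sub_cancel] at this
    obtain ⟨R, hR⟩ := h3
    have h4 : (sextic θ).eval z = 0 := by rw [hR]; simp
    rw [sextic, eval_prod, Finset.prod_eq_zero_iff] at h4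
    obtain ⟨i, _, hi⟩ := h4
    rw [eval_sub, eval_X, eval_C, sub_eq_zero] at hi
    have h5 : (derivative (sextic θ)).eval z = 0 := by
      rw [hR]; simp [derivative_mul, derivative_pow]
    rw [hi, sextic_deriv_eval] at h5
    exact wt_ne_zero hθ i h5
  have hsq : ∀ z, (X - C z) ^ 2 ∣ L ^ 2 - sextic θ → L.eval z ^ 2 = (sextic θ).eval z := by
    rintro z ⟨R, hR⟩
    have := congrArg (Polynomial.eval z) hR
    simp only [eval_sub, eval_pow, eval_mul, eval_X, eval_C, sub_self] at this
    linear_combination this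
  refine ⟨kummerPoint (sextic θ) x (L.eval x) u (L.eval u), x, L.eval x, u, L.eval u, L, r⁻¹ • p,
    smul_ne_zero (inv_ne_zero hr0) hp, hsq x hx2, hsq u hu2, mul_ne_zero (hne x hx2) (hne u hu2),
    hxu, hLd, rfl, rfl, hx2, hu2, ?_, rfl, ?_⟩
  · rw [sextic_dvd_iff hθ]
    intro i
    have h1 : L.eval (θ i) = r⁻¹ * (ev θ p i * H.eval (θ i)) := by
      rw [hL, eval_mul, eval_C, hNe]
    rw [map_smul, ← hHdef, eval_sub, eval_mul, eval_smul, h1, smul_eq_mul]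
    simp only [ev]; ring
  · exact ((Projectivization.mk_eq_mk_iff' K _ _ _ _).2 ⟨r, by
      rw [smul_smul, mul_inv_cancel₀ hr0, one_smul]⟩)

/-- The map to the Kummer surface is injective over general points: if `P` and `P'` have the same
centre, then `M M' - H² Q` is a constant multiple of `F`, which forces `M'` to be the same multiple
of `M`. -/
theorem KappaData.eq_smul_of_isCentre {θ : Fin 6 → K} (hθ : Function.Injective θ)
    (h2 : (2 : K) ≠ 0) {x y u v : K}
    {m : Fin 4 → K} {q : Fin 3 → K} {t : Fin 6 → K} (h : KappaData θ x y u v m q t)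
    {t' : Fin 6 → K} (h' : IsCentre θ (omega θ) t' (kummerCoord (sextic θ) x y u v)) :
    ∃ c : K, t' = c • t := by
  have hmom := (isFrame_omega hθ).moments_of_common_centre hθ h2
    (kummerCoord_ne_zero (sextic θ) x y u v) (h.isCentre hθ) h'
  obtain ⟨Q, hQd, hQ⟩ := exists_interp_degree hθ _ 3 (by norm_num) hmom
  obtain ⟨M', hM'd, hM'⟩ := exists_cubic_of_isCentre hθ h'
  simp only [kummerCoord, Matrix.cons_val] at hM'
  set M : K[X] := C (m 0) + C (m 1) * X + C (m 2) * X ^ 2 + C (m 3) * X ^ 3 with hM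
  have hMd : M.natDegree ≤ 3 := by rw [hM]; compute_degree
  set H : K[X] := (X - C x) * (X - C u) with hHdef
  have hHm : H.Monic := (monic_X_sub_C x).mul (monic_X_sub_C u)
  have hHd : H.natDegree = 2 := by
    rw [hHdef, (monic_X_sub_C x).natDegree_mul (monic_X_sub_C u)]; simp
  have hMe : ∀ i, M.eval (θ i) = t i * H.eval (θ i) := by
    intro i
    have := h.values i
    rw [hM, hHdef]; simp; linear_combination -this
  have hM'e : ∀ i, M'.eval (θ i) = t' i * H.eval (θ i) := by
    intro i
    rw [hM', hHdef]
    simp only [eval_mul, eval_sub, eval_X, eval_C]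
    ring
  have hMF : H ^ 2 ∣ M ^ 2 - sextic θ := by
    set Q' : K[X] := C (q 0) + C (q 1) * X + C (q 2) * X ^ 2 with hQ'
    refine ⟨Q', ?_⟩
    obtain ⟨c0, c1, c2, c3, c4, c5, c6⟩ := h.norm
    have c6' : m 3 ^ 2 - q 2 = 1 := by linear_combination -c6
    have h1 : (C (m 3 ^ 2 - q 2) : K[X]) = 1 := by rw [c6', C_1]
    rw [sextic_expand, c0, c1, c2, c3, c4, c5, hM, hHdef, hQ']
    simp only [map_add, map_sub, map_mul, map_pow, map_ofNat] at h1 ⊢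
    linear_combination X ^ 6 * h1
  obtain ⟨E, hE⟩ := (sextic_dvd_iff hθ (M * M' - H ^ 2 * Q)).2 fun i => by
    rw [eval_sub, eval_mul, eval_mul, eval_pow, hMe, hM'e, hQ]; ring
  have hEd : E.natDegree = 0 := by
    by_cases hE0 : E = 0
    · simp [hE0]
    have h1 := congrArg natDegree hE
    rw [(sextic_monic θ).natDegree_mul' hE0, sextic_natDegree] at h1
    have h3 : (M * M' - H ^ 2 * Q).natDegree ≤ 6 := by
      refine (natDegree_sub_le _ _).trans (max_le ?_ ?_)
      · exact natDegree_mul_le.trans (by omega)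
      · refine natDegree_mul_le.trans ?_
        have : (H ^ 2).natDegree ≤ 4 := natDegree_pow_le.trans (by omega)
        omega
    omega
  obtain ⟨e, rfl⟩ := natDegree_eq_zero.1 hEd
  have hdvd : H ^ 2 ∣ M * (M' - C e * M) := by
    obtain ⟨R, hR⟩ := hMF
    exact ⟨Q - C e * R, by linear_combination hE - C e * hR⟩
  have hcop : IsCoprime (H ^ 2) M := by
    refine IsCoprime.pow_left (IsCoprime.mul_left ?_ ?_)
    · refine (irreducible_X_sub_C x).coprime_iff_not_dvd.2 fun hd => ?_
      have := dvd_iff_isRoot.1 hd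
      rw [IsRoot.def, hM] at this
      simp only [eval_add, eval_mul, eval_C, eval_X, eval_pow] at this
      rw [← h.left] at this
      exact left_ne_zero_of_mul h.mul_ne this
    · refine (irreducible_X_sub_C u).coprime_iff_not_dvd.2 fun hd => ?_
      have := dvd_iff_isRoot.1 hd
      rw [IsRoot.def, hM] at this
      simp only [eval_add, eval_mul, eval_C, eval_X, eval_pow] at this
      rw [← h.right] at this
      exact right_ne_zero_of_mul h.mul_ne this
  have hz : M' - C e * M = 0 := by
    refine eq_zero_of_dvd_of_natDegree_lt (hcop.dvd_of_dvd_mul_left hdvd) ?_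
    rw [hHm.natDegree_pow, hHd]
    refine lt_of_le_of_lt ((natDegree_sub_le _ _).trans
      (max_le hM'd ((natDegree_C_mul_le _ _).trans hMd))) (by norm_num)
  refine ⟨e, funext fun i => ?_⟩
  have hHi : H.eval (θ i) ≠ 0 := by
    have hH : ∀ z w, w ≠ 0 → w ^ 2 = (sextic θ).eval z → θ i - z ≠ 0 := by
      intro z w hw hz h0
      rw [← sub_eq_zero.1 h0, sextic_eval_root] at hz
      exact hw (pow_eq_zero_iff two_ne_zero |>.1 hz)
    rw [hHdef]
    simp only [eval_mul, eval_sub, eval_X, eval_C]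
    exact mul_ne_zero (hH x y (left_ne_zero_of_mul h.mul_ne) h.left_sq)
      (hH u v (right_ne_zero_of_mul h.mul_ne) h.right_sq)
  apply mul_right_cancel₀ hHi
  have := congrArg (Polynomial.eval (θ i)) hz
  rw [eval_sub, eval_mul, eval_C, eval_zero, hMe, hM'e] at this
  rw [Pi.smul_apply, smul_eq_mul]
  linear_combination this

end Kappa

/-! ### Density of the image of the birational map -/

section PolyFun

variable {K : Type*} [Field K]

/-- Polynomial functions of the coefficients `q` of `P² mod F` and of the values `t` of `P`. -/
def IsPolyFun (f : (Fin 3 → K) → (Fin 6 → K) → K) : Prop :=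
  ∃ G : MvPolynomial (Fin 3 ⊕ Fin 6) K, ∀ q t, MvPolynomial.eval (Sum.elim q t) G = f q t

theorem isPolyFun_const (c : K) : IsPolyFun (fun _ _ => c) :=
  ⟨MvPolynomial.C c, fun q t => by simp⟩

theorem isPolyFun_left (j : Fin 3) : IsPolyFun (fun (q : Fin 3 → K) _ => q j) :=
  ⟨MvPolynomial.X (Sum.inl j), fun q t => by simp⟩

theorem isPolyFun_right (i : Fin 6) : IsPolyFun (fun _ (t : Fin 6 → K) => t i) :=
  ⟨MvPolynomial.X (Sum.inr i), fun q t => by simp⟩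

theorem IsPolyFun.add {f g : (Fin 3 → K) → (Fin 6 → K) → K} (hf : IsPolyFun f)
    (hg : IsPolyFun g) : IsPolyFun (fun q t => f q t + g q t) := by
  obtain ⟨G, hG⟩ := hf
  obtain ⟨G', hG'⟩ := hg
  exact ⟨G + G', fun q t => by rw [map_add, hG, hG']⟩

theorem IsPolyFun.mul {f g : (Fin 3 → K) → (Fin 6 → K) → K} (hf : IsPolyFun f)
    (hg : IsPolyFun g) : IsPolyFun (fun q t => f q t * g q t) := by
  obtain ⟨G, hG⟩ := hf
  obtain ⟨G', hG'⟩ := hg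
  exact ⟨G * G', fun q t => by rw [map_mul, hG, hG']⟩

theorem IsPolyFun.neg {f : (Fin 3 → K) → (Fin 6 → K) → K} (hf : IsPolyFun f) :
    IsPolyFun (fun q t => -f q t) := by
  obtain ⟨G, hG⟩ := hf
  exact ⟨-G, fun q t => by rw [map_neg, hG]⟩

theorem IsPolyFun.sub {f g : (Fin 3 → K) → (Fin 6 → K) → K} (hf : IsPolyFun f)
    (hg : IsPolyFun g) : IsPolyFun (fun q t => f q t - g q t) := by
  obtain ⟨G, hG⟩ := hf
  obtain ⟨G', hG'⟩ := hg
  exact ⟨G - G', fun q t => by rw [map_sub, hG, hG']⟩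

theorem isPolyFun_sum {ι : Type*} (s : Finset ι) {f : ι → (Fin 3 → K) → (Fin 6 → K) → K}
    (hf : ∀ i, IsPolyFun (f i)) : IsPolyFun (fun q t => ∑ i ∈ s, f i q t) := by
  choose G hG using hf
  exact ⟨∑ i ∈ s, G i, fun q t => by simp [hG]⟩

theorem isPolyFun_eval {n : ℕ} (g : MvPolynomial (Fin n) K)
    {c : Fin n → (Fin 3 → K) → (Fin 6 → K) → K} (hc : ∀ a, IsPolyFun (c a)) :
    IsPolyFun (fun q t => MvPolynomial.eval (fun a => c a q t) g) := by
  induction g using MvPolynomial.induction_on with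
  | C a => simpa using isPolyFun_const a
  | add g g' hg hg' => simpa using hg.add hg'
  | mul_X g i hg => simpa using hg.mul (hc i)

theorem isPolyFun_res (θ : Fin 6 → K) {c : Fin 6 → (Fin 3 → K) → (Fin 6 → K) → K}
    (hc : ∀ a, IsPolyFun (c a)) : IsPolyFun (fun q t => res θ (fun i => c i q t)) := by
  simp only [res, div_eq_mul_inv]
  exact isPolyFun_sum _ fun i => (hc i).mul (isPolyFun_const _)

theorem isPolyFun_coeffsOf (θ : Fin 6 → K) (j : Fin 6) :
    IsPolyFun (fun _ (t : Fin 6 → K) => coeffsOf θ t j) := by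
  simp only [coeffsOf_apply]
  exact isPolyFun_sum _ fun i => (isPolyFun_right i).mul (isPolyFun_const _)

theorem isPolyFun_skew {l : (Fin 3 → K) → (Fin 6 → K) → Fin 6 → K}
    (hl : ∀ a, IsPolyFun (fun q t => l q t a)) (a b : Fin 4) :
    IsPolyFun (fun q t => skew (l q t) a b) := by
  have h0 : IsPolyFun (fun (_ : Fin 3 → K) (_ : Fin 6 → K) => (0 : K)) := isPolyFun_const 0
  fin_cases a <;> fin_cases b <;> first | exact h0 | exact hl _ | exact (hl _).neg

theorem isPolyFun_pencil (θ : Fin 6 → K) (ω : Fin 6 → Fin 6 → K) (a b : Fin 4) :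
    IsPolyFun (fun _ t => pencil θ ω t a b) := by
  have h1 : ∀ c, IsPolyFun (fun _ t => line θ ω t c) := fun c =>
    isPolyFun_res θ fun i => (isPolyFun_right i).mul (isPolyFun_const (ω i c))
  have h3 : ∀ c, IsPolyFun (fun _ t => line θ ω (shift θ t) c) := fun c =>
    isPolyFun_res θ fun i => ((isPolyFun_const (θ i)).mul (isPolyFun_right i)).mul
      (isPolyFun_const (ω i c))
  have h1' : ∀ c, IsPolyFun (fun _ t => pfAdj (line θ ω t) c) := by
    intro c
    fin_cases c <;> first | exact h1 _ | exact (h1 _).neg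
  simp only [pencil, flag, Matrix.mul_apply]
  exact isPolyFun_sum _ fun d => (isPolyFun_skew h1' a d).mul (isPolyFun_skew h3 d b)

theorem IsPolyFun.update {f : (Fin 3 → K) → (Fin 6 → K) → K} (hf : IsPolyFun f) (i : Fin 6) :
    IsPolyFun (fun q t => f q (Function.update t i (-t i))) := by
  obtain ⟨G, hG⟩ := hf
  refine ⟨MvPolynomial.bind₁ (Sum.elim (fun j => MvPolynomial.X (Sum.inl j))
    (fun j => if j = i then -MvPolynomial.X (Sum.inr j) else MvPolynomial.X (Sum.inr j))) G,
    fun q t => ?_⟩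
  change _ = f q (Function.update t i (-t i))
  rw [← hG, ← MvPolynomial.coe_aeval_eq_eval, ← MvPolynomial.coe_aeval_eq_eval]
  change MvPolynomial.aeval _ _ = MvPolynomial.aeval _ _
  rw [MvPolynomial.aeval_bind₁]
  congr 2
  funext j
  rcases j with j | j
  · simp
  · by_cases hj : j = i
    · subst hj; simp
    · simp [hj]

theorem Cone.update {θ : Fin 6 → K} {q : Fin 3 → K} {t : Fin 6 → K} (h : Cone θ q t)
    (i : Fin 6) : Cone θ q (Function.update t i (-t i)) := by
  intro j
  by_cases hj : j = i
  · subst hj; simpa using h j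
  · simpa [hj] using h j

/-- A form of `Projectivization.map_mk` with an arbitrary proof that the image is nonzero. -/
theorem map_mk_of_injective {V W : Type*} [AddCommGroup V] [AddCommGroup W] [Module K V]
    [Module K W] (f : V →ₗ[K] W) (hf : Function.Injective f) (v : V) (hv : v ≠ 0)
    (hv' : f v ≠ 0) : Projectivization.map f hf (Projectivization.mk K v hv)
      = Projectivization.mk K (f v) hv' := rfl

theorem epsProj_mk {θ : Fin 6 → K} (hθ : Function.Injective θ) (i : Fin 6) (p : Fin 6 → K)
    (hp : p ≠ 0) (hp' : epsLin θ i p ≠ 0) : epsProj hθ i (Projectivization.mk K p hp)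
      = Projectivization.mk K (epsLin θ i p) hp' :=
  map_mk_of_injective _ _ _ _ _

/-- The point `s` is in the image of `κ`. -/
def IsGeneral (θ : Fin 6 → K) (s : PSpace K 5) : Prop := ∃ ξ, IsKappa θ ξ s

variable [IsAlgClosed K]

/-- The irreducibility of the cone in terms of functions. -/
theorem IsPolyFun.eq_zero_of_dense {θ : Fin 6 → K} (hθ : Function.Injective θ)
    (h2 : (2 : K) ≠ 0) {f g : (Fin 3 → K) → (Fin 6 → K) → K} (hf : IsPolyFun f)
    (hg : IsPolyFun g) (hg0 : ∃ q t, Cone θ q t ∧ g q t ≠ 0)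
    (h : ∀ q t, Cone θ q t → g q t ≠ 0 → f q t = 0) : ∀ q t, Cone θ q t → f q t = 0 := by
  obtain ⟨G, hG⟩ := hf
  obtain ⟨G', hG'⟩ := hg
  rcases cone_irreducible h2 hθ G G' (fun q t hc => by
    rw [hG, hG']
    by_cases h0 : g q t = 0
    · rw [h0, mul_zero]
    · rw [h q t hc h0, zero_mul]) with h3 | h3
  · intro q t hc
    rw [← hG, h3 q t hc]
  · obtain ⟨q, t, hc, h0⟩ := hg0
    exact absurd (by rw [← hG', h3 q t hc]) h0

theorem IsPolyFun.mul_nonzero {θ : Fin 6 → K} (hθ : Function.Injective θ)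
    (h2 : (2 : K) ≠ 0) {f g : (Fin 3 → K) → (Fin 6 → K) → K} (hf : IsPolyFun f)
    (hg : IsPolyFun g) (hf0 : ∃ q t, Cone θ q t ∧ f q t ≠ 0)
    (hg0 : ∃ q t, Cone θ q t ∧ g q t ≠ 0) : ∃ q t, Cone θ q t ∧ f q t * g q t ≠ 0 := by
  by_contra! hc
  obtain ⟨q, t, h1, h3⟩ := hf0
  refine h3 (hf.eq_zero_of_dense hθ h2 hg hg0 (fun q t hqt hg' => ?_) q t h1)
  exact (mul_eq_zero.1 (hc q t hqt)).resolve_right hg'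

theorem exists_sq_eq (z : K) : ∃ y : K, y ^ 2 = z := IsAlgClosed.exists_pow_nat_eq z (by norm_num)

theorem exists_general_pair (θ : Fin 6 → K) : ∃ x y u v : K, y ^ 2 = (sextic θ).eval x ∧
    v ^ 2 = (sextic θ).eval u ∧ y * v ≠ 0 ∧ x ≠ u := by
  classical
  obtain ⟨x, hx⟩ := Infinite.exists_notMem_finset (Finset.univ.image θ)
  obtain ⟨u, hu⟩ := Infinite.exists_notMem_finset (insert x (Finset.univ.image θ))
  obtain ⟨y, hy⟩ := exists_sq_eq ((sextic θ).eval x)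
  obtain ⟨v, hv⟩ := exists_sq_eq ((sextic θ).eval u)
  have key : ∀ z w, z ∉ Finset.univ.image θ → w ^ 2 = (sextic θ).eval z → w ≠ 0 := by
    rintro z w hz hw rfl
    rw [zero_pow two_ne_zero, sextic, eval_prod, eq_comm, Finset.prod_eq_zero_iff] at hw
    obtain ⟨i, _, hi⟩ := hw
    rw [eval_sub, eval_X, eval_C, sub_eq_zero] at hi
    exact hz (Finset.mem_image.2 ⟨i, Finset.mem_univ i, hi.symm⟩)
  rw [Finset.mem_insert, not_or] at hu
  exact ⟨x, y, u, v, hy, hv, mul_ne_zero (key x y hx hy) (key u v hu.2 hv), fun h => hu.1 h.symm⟩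

/-- The image of `κ` contains the points where a certain polynomial function `D` does not vanish,
and there are such points: `D` is a product of the discriminant of `q`, the leading coefficient and
the discriminant of the quadratic polynomial attached to the centre. -/
theorem exists_dense_function {θ : Fin 6 → K} (hθ : Function.Injective θ) (h2 : (2 : K) ≠ 0) :
    ∃ D : (Fin 3 → K) → (Fin 6 → K) → K, IsPolyFun D ∧ (∃ q t, Cone θ q t ∧ D q t ≠ 0) ∧
      ∀ q p, Cone θ q (ev θ p) → D q (ev θ p) ≠ 0 →
        ∃ hp : p ≠ 0, IsGeneral θ (Projectivization.mk K p hp) := by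
  obtain ⟨x, y, u, v, hy, hv, hyv, hxu⟩ := exists_general_pair θ
  obtain ⟨p, hp, hk⟩ := exists_isKappa hθ h2 hy hv hyv hxu
  obtain ⟨x, y, u, v, m, q, p, hp, hd, -, -⟩ := hk.exists_data
  have hω := isFrame_omega hθ
  have hcone := hd.cone.onCone hθ
  have ht0 := ev_ne_zero hθ hp
  obtain ⟨b, hb⟩ := hω.exists_col hθ h2 hcone ht0
  obtain ⟨c, hc⟩ := hω.centre_unique hθ h2 hcone ht0 (hd.isCentre hθ)
    (hω.isCentre_col hθ h2 hcone b) (kummerCoord_ne_zero _ _ _ _ _)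
  have hc0 : c ≠ 0 := by
    rintro rfl
    exact hb (by rw [hc, zero_smul])
  have hn : ∀ a, IsPolyFun (fun _ t => pencil θ (omega θ) t a b) := fun a =>
    isPolyFun_pencil θ _ a b
  have h1 : IsPolyFun (fun q (_ : Fin 6 → K) => q 1 * q 1 - 4 * q 0 * q 2) :=
    ((isPolyFun_left 1).mul (isPolyFun_left 1)).sub
      (((isPolyFun_const 4).mul (isPolyFun_left 0)).mul (isPolyFun_left 2))
  have h3 : IsPolyFun (fun _ t => pencil θ (omega θ) t 0 b *
      (pencil θ (omega θ) t 1 b * pencil θ (omega θ) t 1 b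
        - 4 * pencil θ (omega θ) t 0 b * pencil θ (omega θ) t 2 b)) :=
    (hn 0).mul (((hn 1).mul (hn 1)).sub (((isPolyFun_const 4).mul (hn 0)).mul (hn 2)))
  refine ⟨_, h1.mul h3, h1.mul_nonzero hθ h2 h3 ?_ ?_, ?_⟩
  · choose t ht using fun i => exists_sq_eq (θ i ^ 2 - 1)
    refine ⟨![-1, 0, 1], t, fun i => ?_, ?_⟩
    · rw [ht]; simp; ring
    · simp
      have : (4 : K) = 2 * 2 := by norm_num
      rw [this]
      exact mul_ne_zero h2 h2
  · refine ⟨q, ev θ p, hd.cone, ?_⟩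
    have e := fun a => congrFun hc a
    have e0 := e 0
    have e1 := e 1
    have e2 := e 2
    simp only [kummerCoord, Pi.smul_apply, Matrix.cons_val, smul_eq_mul] at e0 e1 e2
    rw [e0, e1, e2]
    have : c * 1 * (c * (x + u) * (c * (x + u)) - 4 * (c * 1) * (c * (x * u)))
        = c ^ 3 * (x - u) ^ 2 := by ring
    rw [this]
    exact mul_ne_zero (pow_ne_zero 3 hc0) (pow_ne_zero 2 (sub_ne_zero.2 hd.ne))
  · intro q p hcone hne
    have hp : p ≠ 0 := by
      rintro rfl
      apply hne
      have : pencil θ (omega θ) (ev θ 0) 0 b = 0 := by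
        have hl : line θ (omega θ) (ev θ 0) = 0 := by
          funext a; simp [line, res, ev_zero]
        have : skew (pfAdj (0 : Fin 6 → K)) = 0 := by
          ext i j; fin_cases i <;> fin_cases j <;> simp [skew, pfAdj]
        rw [pencil, flag, hl, this]; simp
      rw [this]; ring
    refine ⟨hp, isKappa_of_disc_ne_zero hθ hp hcone
      (hω.isCentre_col hθ h2 (hcone.onCone hθ) b) ?_ ?_ ?_⟩
    · intro h0; apply hne
      have : q 1 * q 1 - 4 * q 0 * q 2 = 0 := by rw [← h0]; ring
      rw [this, zero_mul]
    · intro h0; apply hne; rw [h0]; ring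
    · intro h0; apply hne
      have : pencil θ (omega θ) (ev θ p) 1 b * pencil θ (omega θ) (ev θ p) 1 b
        - 4 * pencil θ (omega θ) (ev θ p) 0 b * pencil θ (omega θ) (ev θ p) 2 b = 0 := by
        rw [← h0]; ring
      rw [this]; ring

/-- The preimage under `ε⁽ⁱ⁾` of the image of `κ` is dense in the same sense as in
`exists_dense_function`. -/
theorem exists_dense_function₂ {θ : Fin 6 → K} (hθ : Function.Injective θ) (h2 : (2 : K) ≠ 0)
    (i : Fin 6) :
    ∃ D : (Fin 3 → K) → (Fin 6 → K) → K, IsPolyFun D ∧ (∃ q t, Cone θ q t ∧ D q t ≠ 0) ∧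
      ∀ q p, Cone θ q (ev θ p) → D q (ev θ p) ≠ 0 →
        ∃ hp : p ≠ 0, IsGeneral θ (epsProj hθ i (Projectivization.mk K p hp)) := by
  obtain ⟨D, hD, ⟨q, t, hc, h0⟩, hDg⟩ := exists_dense_function hθ h2
  refine ⟨_, hD.update i, ⟨q, Function.update t i (-t i), hc.update i, ?_⟩, fun q p hc h3 => ?_⟩
  · rwa [Function.update_self, neg_neg, Function.update_idem, Function.update_eq_self]
  · have e := ev_epsLin hθ i p
    rw [← e] at h3
    obtain ⟨hp', hg'⟩ := hDg q (epsLin θ i p) (by rw [e]; exact hc.update i) h3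
    have hp : p ≠ 0 := by
      rintro rfl
      exact hp' (map_zero _)
    refine ⟨hp, ?_⟩
    rw [epsProj_mk hθ i p hp hp']
    exact hg'

/-- A polynomial function on the cone vanishes if it does so at the points which are, together
with their image under `ε⁽ⁱ⁾`, in the image of `κ`. -/
theorem IsPolyFun.eq_zero_of_general₂ {θ : Fin 6 → K} (hθ : Function.Injective θ)
    (h2 : (2 : K) ≠ 0) (i : Fin 6) {f : (Fin 3 → K) → (Fin 6 → K) → K} (hf : IsPolyFun f)
    (h : ∀ q p (hp : p ≠ 0), Cone θ q (ev θ p) → IsGeneral θ (Projectivization.mk K p hp) →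
      IsGeneral θ (epsProj hθ i (Projectivization.mk K p hp)) → f q (ev θ p) = 0) :
    ∀ q t, Cone θ q t → f q t = 0 := by
  obtain ⟨D, hD, hD0, hDg⟩ := exists_dense_function hθ h2
  obtain ⟨D', hD', hD0', hDg'⟩ := exists_dense_function₂ hθ h2 i
  refine hf.eq_zero_of_dense hθ h2 (hD.mul hD') (hD.mul_nonzero hθ h2 hD' hD0 hD0') ?_
  intro q t hc hne
  obtain ⟨p, rfl⟩ : ∃ p, ev θ p = t := ⟨coeffsOf θ t, ev_coeffsOf hθ t⟩
  obtain ⟨hp, hg⟩ := hDg q p hc (left_ne_zero_of_mul hne)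
  obtain ⟨hp', hg'⟩ := hDg' q p hc (right_ne_zero_of_mul hne)
  exact h q p hp hc hg hg'

theorem IsPolyFun.eq_zero_of_general {θ : Fin 6 → K} (hθ : Function.Injective θ)
    (h2 : (2 : K) ≠ 0) {f : (Fin 3 → K) → (Fin 6 → K) → K} (hf : IsPolyFun f)
    (h : ∀ q p (hp : p ≠ 0), Cone θ q (ev θ p) → IsGeneral θ (Projectivization.mk K p hp) →
      f q (ev θ p) = 0) : ∀ q t, Cone θ q t → f q t = 0 :=
  hf.eq_zero_of_general₂ hθ h2 0 fun q p hp hc hg _ => h q p hp hc hg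

end PolyFun

/-! ### Forms and regular maps -/

section Forms

variable {K : Type*} [Field K] {n : ℕ}

theorem eval_smul_of_isHomogeneous {g : MvPolynomial (Fin n) K} {d : ℕ} (hg : g.IsHomogeneous d)
    (c : K) (v : Fin n → K) :
    MvPolynomial.eval (c • v) g = c ^ d * MvPolynomial.eval v g := by
  rw [MvPolynomial.eval_eq, MvPolynomial.eval_eq, Finset.mul_sum]
  refine Finset.sum_congr rfl fun m hm => ?_
  have hd : ∑ i ∈ m.support, m i = d := (hg.degree_eq_sum_deg_support hm).symm
  simp only [Pi.smul_apply, smul_eq_mul, mul_pow, Finset.prod_mul_distrib]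
  rw [Finset.prod_pow_eq_pow_sum, hd]
  ring

theorem exists_rep_mk {v : Fin n → K} (hv : v ≠ 0) :
    ∃ c : K, c ≠ 0 ∧ (Projectivization.mk K v hv).rep = c • v := by
  obtain ⟨a, ha⟩ := Projectivization.exists_smul_eq_mk_rep K v hv
  exact ⟨a, a.ne_zero, by rw [← ha, Units.smul_def]⟩

theorem eval_rep_mk {g : MvPolynomial (Fin n) K} {d : ℕ} (hg : g.IsHomogeneous d)
    {v : Fin n → K} (hv : v ≠ 0) :
    MvPolynomial.eval (Projectivization.mk K v hv).rep g = 0 ↔ MvPolynomial.eval v g = 0 := by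
  obtain ⟨c, hc, h⟩ := exists_rep_mk hv
  rw [h, eval_smul_of_isHomogeneous hg, mul_eq_zero, or_iff_right (pow_ne_zero d hc)]

theorem mk_eq_of_minors {v w : Fin n → K} (hv : v ≠ 0) (hw : w ≠ 0)
    (h : ∀ a b, v a * w b = v b * w a) :
    Projectivization.mk K v hv = Projectivization.mk K w hw := by
  obtain ⟨b, hb⟩ := Function.ne_iff.1 hw
  refine (Projectivization.mk_eq_mk_iff' K _ _ _ _).2 ⟨v b / w b, ?_⟩
  funext a
  have hb' : w b ≠ 0 := hb
  rw [Pi.smul_apply, smul_eq_mul]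
  field_simp
  linear_combination -h a b

theorem minors_of_mk_eq {v w : Fin n → K} {hv : v ≠ 0} {hw : w ≠ 0}
    (h : Projectivization.mk K v hv = Projectivization.mk K w hw) (a b : Fin n) :
    v a * w b = v b * w a := by
  obtain ⟨c, rfl⟩ := (Projectivization.mk_eq_mk_iff' K _ _ _ _).1 h
  simp only [Pi.smul_apply, smul_eq_mul]
  ring

theorem subset_zariskiClosure (X : Set (PSpace K n)) : X ⊆ zariskiClosure X :=
  fun x hx _ _ _ hg => hg x hx

theorem VanishesOn.zariskiClosure {X : Set (PSpace K n)} {g : MvPolynomial (Fin (n + 1)) K} {d : ℕ}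
    (hd : g.IsHomogeneous d) (hg : VanishesOn g X) : VanishesOn g (zariskiClosure X) :=
  fun _ hx => hx d g hd hg

/-- The function `f` of `n` variables is given by a form of degree `d`. -/
def IsForm (d : ℕ) (f : (Fin n → K) → K) : Prop :=
  ∃ G : MvPolynomial (Fin n) K, G.IsHomogeneous d ∧ ∀ p, MvPolynomial.eval p G = f p

theorem isForm_apply (j : Fin n) : IsForm 1 (fun p : Fin n → K => p j) :=
  ⟨MvPolynomial.X j, MvPolynomial.isHomogeneous_X _ _, fun p => by simp⟩

theorem isForm_zero (d : ℕ) : IsForm d (fun _ : Fin n → K => 0) :=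
  ⟨0, MvPolynomial.isHomogeneous_zero _ _ _, fun p => by simp⟩

theorem IsForm.neg {d : ℕ} {f : (Fin n → K) → K} (hf : IsForm d f) :
    IsForm d (fun p => -f p) := by
  obtain ⟨G, hG, h⟩ := hf
  exact ⟨-G, hG.neg, fun p => by rw [map_neg, h]⟩

theorem IsForm.mul_const {d : ℕ} {f : (Fin n → K) → K} (hf : IsForm d f) (c : K) :
    IsForm d (fun p => f p * c) := by
  obtain ⟨G, hG, h⟩ := hf
  exact ⟨MvPolynomial.C c * G, hG.C_mul c, fun p => by simp [h, mul_comm]⟩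

theorem IsForm.mul {d e : ℕ} {f g : (Fin n → K) → K} (hf : IsForm d f) (hg : IsForm e g) :
    IsForm (d + e) (fun p => f p * g p) := by
  obtain ⟨G, hG, h⟩ := hf
  obtain ⟨G', hG', h'⟩ := hg
  exact ⟨G * G', hG.mul hG', fun p => by rw [map_mul, h, h']⟩

theorem isForm_sum {ι : Type*} (s : Finset ι) {d : ℕ} {f : ι → (Fin n → K) → K}
    (hf : ∀ i, IsForm d (f i)) : IsForm d (fun p => ∑ i ∈ s, f i p) := by
  choose G hG h using hf
  exact ⟨∑ i ∈ s, G i, MvPolynomial.IsHomogeneous.sum s _ d fun i _ => hG i,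
    fun p => by simp [h]⟩

theorem IsForm.comp {m d e : ℕ} {g : MvPolynomial (Fin m) K} (hg : g.IsHomogeneous d)
    {f : Fin m → (Fin n → K) → K} (hf : ∀ a, IsForm e (f a)) :
    IsForm (e * d) (fun p => MvPolynomial.eval (fun a => f a p) g) := by
  choose G hG h using hf
  refine ⟨MvPolynomial.aeval G g, hg.aeval G hG, fun p => ?_⟩
  simp only [← h]
  have hC : (MvPolynomial.eval p).comp MvPolynomial.C = RingHom.id K :=
    RingHom.ext fun c => MvPolynomial.eval_C c
  rw [MvPolynomial.map_aeval, MvPolynomial.algebraMap_eq, hC]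
  rfl

end Forms

section Regular

variable {K : Type*} [Field K] {n : ℕ}

theorem isForm_ev (θ : Fin 6 → K) (i : Fin 6) : IsForm 1 (fun p => ev θ p i) := by
  simp only [ev_apply]
  exact isForm_sum _ fun j => (isForm_apply j).mul_const _

theorem isForm_pencil (θ : Fin 6 → K) (ω : Fin 6 → Fin 6 → K) (a b : Fin 4) :
    IsForm 2 (fun p => pencil θ ω (ev θ p) a b) := by
  have hr : ∀ f : Fin 6 → (Fin 6 → K) → K, (∀ i, IsForm 1 (f i)) →
      IsForm 1 (fun p => res θ (fun i => f i p)) := fun f hf => by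
    simp only [res, div_eq_mul_inv]
    exact isForm_sum _ fun i => (hf i).mul_const _
  have h1 : ∀ c, IsForm 1 (fun p => line θ ω (ev θ p) c) := fun c =>
    hr _ fun i => (isForm_ev θ i).mul_const (ω i c)
  have h3 : ∀ c, IsForm 1 (fun p => line θ ω (shift θ (ev θ p)) c) := fun c => by
    refine hr (fun i p => shift θ (ev θ p) i * ω i c) fun i => ?_
    simp only [shift, mul_comm (θ i)]
    exact ((isForm_ev θ i).mul_const _).mul_const _
  have hs : ∀ l : (Fin 6 → K) → Fin 6 → K, (∀ c, IsForm 1 (fun p => l p c)) → ∀ a b,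
      IsForm 1 (fun p => skew (l p) a b) := by
    intro l hl a b
    have h0 : IsForm 1 (fun _ : Fin 6 → K => (0 : K)) := isForm_zero 1
    fin_cases a <;> fin_cases b <;> first | exact h0 | exact hl _ | exact (hl _).neg
  have h1' : ∀ c, IsForm 1 (fun p => pfAdj (line θ ω (ev θ p)) c) := by
    intro c
    fin_cases c <;> first | exact h1 _ | exact (h1 _).neg
  simp only [pencil, flag, Matrix.mul_apply]
  exact isForm_sum _ fun d => (hs _ h1' a d).mul (hs _ h3 d b)

theorem IsCentre.smul {θ : Fin 6 → K} {ω : Fin 6 → Fin 6 → K} {t : Fin 6 → K} {v : Fin 4 → K}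
    (h : IsCentre θ ω t v) (c : K) : IsCentre θ ω (c • t) v := by
  have e : ∀ t : Fin 6 → K, line θ ω (c • t) = c • line θ ω t := fun t => by
    rw [line_eq_sum, line_eq_sum, Finset.smul_sum]
    refine Finset.sum_congr rfl fun i _ => ?_
    rw [smul_smul, Pi.smul_apply, smul_eq_mul, mul_div_assoc]
  have e' : shift θ (c • t) = c • shift θ t := by
    funext i
    simp only [shift, Pi.smul_apply, smul_eq_mul]
    ring
  constructor
  · rw [e, skew_smul, Matrix.smul_mulVec, h.1, smul_zero]
  · rw [e', e, skew_smul, Matrix.smul_mulVec, h.2, smul_zero]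

/-- `ζ` is the centre of the pencil of lines attached to the point `s`. -/
def HasCentre (θ : Fin 6 → K) (ω : Fin 6 → Fin 6 → K) (s : PSpace K 5) (ζ : PSpace K 3) : Prop :=
  IsCentre θ ω (ev θ s.rep) ζ.rep

theorem hasCentre_mk {θ : Fin 6 → K} {ω : Fin 6 → Fin 6 → K} {p : Fin 6 → K} {v : Fin 4 → K}
    (hp : p ≠ 0) (hv : v ≠ 0) :
    HasCentre θ ω (Projectivization.mk K p hp) (Projectivization.mk K v hv) ↔
      IsCentre θ ω (ev θ p) v := by
  obtain ⟨c, hc, h⟩ := exists_rep_mk hp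
  obtain ⟨c', hc', h'⟩ := exists_rep_mk hv
  have key : ∀ (c c' : K) (t : Fin 6 → K) (v : Fin 4 → K), IsCentre θ ω t v →
      IsCentre θ ω (c • t) (c' • v) := by
    intro c c' t v hv
    have := hv.smul c
    exact ⟨by rw [Matrix.mulVec_smul, this.1, smul_zero],
      by rw [Matrix.mulVec_smul, this.2, smul_zero]⟩
  rw [HasCentre, h, h', ev_smul]
  refine ⟨fun h3 => ?_, key c c' _ _⟩
  have := key c⁻¹ c'⁻¹ _ _ h3
  rwa [smul_smul, smul_smul, inv_mul_cancel₀ hc, inv_mul_cancel₀ hc', one_smul, one_smul] at this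

theorem exists_cone {θ : Fin 6 → K} (hθ : Function.Injective θ) {s : PSpace K 5}
    (hs : s ∈ desingKummer θ) : ∃ q, Cone θ q (ev θ s.rep) := by
  rw [← mem_desingKummer_iff hθ _ s.rep_nonzero, Projectivization.mk_rep]
  exact hs

theorem IsFrame.exists_hasCentre {θ : Fin 6 → K} {ω : Fin 6 → Fin 6 → K} (h : IsFrame θ ω)
    (hθ : Function.Injective θ) (h2 : (2 : K) ≠ 0) {s : PSpace K 5} (hs : s ∈ desingKummer θ) :
    ∃ ζ, HasCentre θ ω s ζ := by
  obtain ⟨q, hq⟩ := exists_cone hθ hs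
  obtain ⟨b, hb⟩ := h.exists_col hθ h2 (hq.onCone hθ) (ev_ne_zero hθ s.rep_nonzero)
  refine ⟨Projectivization.mk K _ hb, ?_⟩
  have := (hasCentre_mk s.rep_nonzero hb).2 (h.isCentre_col hθ h2 (hq.onCone hθ) b)
  rwa [Projectivization.mk_rep] at this

theorem IsFrame.hasCentre_unique {θ : Fin 6 → K} {ω : Fin 6 → Fin 6 → K} (h : IsFrame θ ω)
    (hθ : Function.Injective θ) (h2 : (2 : K) ≠ 0) {s : PSpace K 5} (hs : s ∈ desingKummer θ)
    {ζ ζ' : PSpace K 3} (hζ : HasCentre θ ω s ζ) (hζ' : HasCentre θ ω s ζ') : ζ = ζ' := by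
  obtain ⟨q, hq⟩ := exists_cone hθ hs
  obtain ⟨c, hc⟩ := h.centre_unique hθ h2 (hq.onCone hθ) (ev_ne_zero hθ s.rep_nonzero) hζ' hζ
    ζ'.rep_nonzero
  rw [← ζ.mk_rep, ← ζ'.mk_rep]
  exact (Projectivization.mk_eq_mk_iff' K _ _ _ _).2 ⟨c, hc.symm⟩

/-- The map which sends each point to the centre of its pencil of lines is regular. -/
theorem IsFrame.isRegularMap {θ : Fin 6 → K} {ω : Fin 6 → Fin 6 → K} (h : IsFrame θ ω)
    (hθ : Function.Injective θ) (h2 : (2 : K) ≠ 0) {Y : Set (PSpace K 3)}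
    {φ : desingKummer θ → Y} (hφ : ∀ s : desingKummer θ, HasCentre θ ω s (φ s)) :
    IsRegularMap φ := by
  intro x
  choose G hG e using isForm_pencil θ ω
  obtain ⟨q, hq⟩ := exists_cone hθ x.2
  obtain ⟨b, hb⟩ := h.exists_col hθ h2 (hq.onCone hθ) (ev_ne_zero hθ x.1.rep_nonzero)
  refine ⟨2, fun a => G a b, fun a => hG a b, by simpa only [e] using hb, fun z hz => ?_⟩
  refine h.hasCentre_unique hθ h2 z.2 (hφ z) ?_
  obtain ⟨q', hq'⟩ := exists_cone hθ z.2
  have := (hasCentre_mk (θ := θ) (ω := ω) z.1.rep_nonzero hz).2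
    (by simpa only [e] using h.isCentre_col hθ h2 (hq'.onCone hθ) b)
  rwa [Projectivization.mk_rep] at this

variable [IsAlgClosed K]

theorem form_eq_zero_of_general {θ : Fin 6 → K} (hθ : Function.Injective θ) (h2 : (2 : K) ≠ 0)
    {d : ℕ} {g : MvPolynomial (Fin 6) K} (hg : g.IsHomogeneous d)
    (h : ∀ s ∈ desingKummer θ, IsGeneral θ s → MvPolynomial.eval s.rep g = 0) :
    ∀ s ∈ desingKummer θ, MvPolynomial.eval s.rep g = 0 := by
  have hp : IsPolyFun (fun _ t => MvPolynomial.eval (coeffsOf θ t) g) :=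
    isPolyFun_eval (c := fun a _ t => coeffsOf θ t a) g fun a => isPolyFun_coeffsOf θ a
  have := hp.eq_zero_of_general hθ h2 fun q p hp hc hgen => by
    rw [coeffsOf_ev hθ, ← eval_rep_mk hg hp]
    exact h _ ((mem_desingKummer_iff hθ p hp).2 ⟨q, hc⟩) hgen
  intro s hs
  obtain ⟨q, hq⟩ := exists_cone hθ hs
  simpa only [coeffsOf_ev hθ] using this q _ hq

/-- Two regular maps on the surface that agree on the image of `κ` are equal. -/
theorem IsRegularMap.ext_of_general {θ : Fin 6 → K} (hθ : Function.Injective θ)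
    (h2 : (2 : K) ≠ 0) {Y : Set (PSpace K n)} {φ ψ : desingKummer θ → Y}
    (hφ : IsRegularMap φ) (hψ : IsRegularMap ψ)
    (h : ∀ s : desingKummer θ, IsGeneral θ s → φ s = ψ s) : φ = ψ := by
  funext x
  obtain ⟨d, f, hf, hf0, hfφ⟩ := hφ x
  obtain ⟨e, g, hg, hg0, hgψ⟩ := hψ x
  apply Subtype.ext
  rw [hfφ x hf0, hgψ x hg0]
  refine mk_eq_of_minors _ _ fun a b => ?_
  have key := form_eq_zero_of_general hθ h2 (((hf a).mul (hg b)).sub ((hf b).mul (hg a)))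
    fun s hs hgen => ?_
  · have := key x x.2
    rwa [map_sub, map_mul, map_mul, sub_eq_zero] at this
  · rw [map_sub, map_mul, map_mul, sub_eq_zero]
    by_cases h1 : (fun j => MvPolynomial.eval s.rep (f j)) = 0
    · have ha := congrFun h1 a
      have hb := congrFun h1 b
      simp only [Pi.zero_apply] at ha hb
      rw [ha, hb, zero_mul, zero_mul]
    by_cases h3 : (fun j => MvPolynomial.eval s.rep (g j)) = 0
    · have ha := congrFun h3 a
      have hb := congrFun h3 b
      simp only [Pi.zero_apply] at ha hb
      rw [ha, hb, mul_zero, mul_zero]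
    have h4 := congrArg Subtype.val (h ⟨s, hs⟩ hgen)
    rw [hfφ ⟨s, hs⟩ h1, hgψ ⟨s, hs⟩ h3] at h4
    exact minors_of_mk_eq h4 a b

/-- If the centres of the general points lie in `X`, then all centres lie in its closure. Only the
points `s` for which both `s` and `ε⁽ⁱ⁾ s` are in the image of `κ` need to be considered. -/
theorem HasCentre.mem_zariskiClosure {θ : Fin 6 → K} {ω : Fin 6 → Fin 6 → K} (hω : IsFrame θ ω)
    (hθ : Function.Injective θ) (h2 : (2 : K) ≠ 0) (i : Fin 6) {X : Set (PSpace K 3)}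
    (hX : ∀ s ∈ desingKummer θ, IsGeneral θ s → IsGeneral θ (epsProj hθ i s) →
      ∃ ζ ∈ X, HasCentre θ ω s ζ) {s : PSpace K 5} (hs : s ∈ desingKummer θ) {ζ : PSpace K 3}
    (hζ : HasCentre θ ω s ζ) : ζ ∈ zariskiClosure X := by
  intro d g hg hgX
  have hcol : ∀ b, ∀ q t, Cone θ q t →
      MvPolynomial.eval (fun a => pencil θ ω t a b) g = 0 := by
    intro b
    refine IsPolyFun.eq_zero_of_general₂ hθ h2 i
      (isPolyFun_eval (c := fun a _ t => pencil θ ω t a b) g fun a => isPolyFun_pencil θ ω a b) ?_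
    intro q p hp hc h1 h3
    obtain ⟨ζ, hζX, hζ⟩ := hX _ ((mem_desingKummer_iff hθ p hp).2 ⟨q, hc⟩) h1 h3
    rw [← ζ.mk_rep, hasCentre_mk] at hζ
    obtain ⟨c, hc⟩ := hω.centre_unique hθ h2 (hc.onCone hθ) (ev_ne_zero hθ hp) hζ
      (hω.isCentre_col hθ h2 (hc.onCone hθ) b) ζ.rep_nonzero
    rw [hc, eval_smul_of_isHomogeneous hg, hgX ζ hζX, mul_zero]
  obtain ⟨q, hq⟩ := exists_cone hθ hs
  obtain ⟨b, hb⟩ := hω.exists_col hθ h2 (hq.onCone hθ) (ev_ne_zero hθ s.rep_nonzero)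
  have h3 := (hasCentre_mk s.rep_nonzero hb).2 (hω.isCentre_col hθ h2 (hq.onCone hθ) b)
  rw [Projectivization.mk_rep] at h3
  rw [hω.hasCentre_unique hθ h2 hs hζ h3, eval_rep_mk hg]
  exact hcol b q _ hq

end Regular

end KummerDuality

namespace KummerDuality

open MvPolynomial

/-! ### Forms vanishing on the Kummer surface -/

section KummerForms

variable {K : Type*} [Field K]

theorem quarticR_isHomogeneous : (quarticR : MvPolynomial (Fin 4) K).IsHomogeneous 2 :=
  ((isHomogeneous_X_pow _ _).sub
    (((isHomogeneous_C _ _).mul (isHomogeneous_X _ _)).mul (isHomogeneous_X _ _)))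

theorem isHomogeneous_of_eq {φ : MvPolynomial (Fin 4) K} {m n : ℕ} (h : φ.IsHomogeneous m)
    (e : m = n) : φ.IsHomogeneous n := e ▸ h

theorem quartic_isHomogeneous (F : Polynomial K) : (quartic F).IsHomogeneous 4 := by
  have hS : (quarticS F).IsHomogeneous 3 := by
    unfold quarticS
    refine IsHomogeneous.C_mul ?_ _
    repeat' with_reducible_and_instances apply IsHomogeneous.add
    all_goals
      apply isHomogeneous_of_eq
      · repeat' first
          | with_reducible_and_instances exact isHomogeneous_C _ _
          | with_reducible_and_instances exact isHomogeneous_X_pow _ _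
          | with_reducible_and_instances exact isHomogeneous_X _ _
          | with_reducible_and_instances apply IsHomogeneous.mul
      · rfl
  have hT : (quarticT F).IsHomogeneous 4 := by
    unfold quarticT
    repeat' first
      | with_reducible_and_instances apply IsHomogeneous.add
      | with_reducible_and_instances apply IsHomogeneous.sub
    all_goals
      apply isHomogeneous_of_eq
      · repeat' first
          | with_reducible_and_instances exact isHomogeneous_C _ _
          | with_reducible_and_instances exact isHomogeneous_X_pow _ _
          | with_reducible_and_instances exact isHomogeneous_X _ _
          | with_reducible_and_instances apply IsHomogeneous.mul
      · rfl
  exact ((quarticR_isHomogeneous.mul (isHomogeneous_X_pow _ _)).add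
    (hS.mul (isHomogeneous_X _ _))).add hT

theorem eval_quartic_kummerCoord {θ : Fin 6 → K} {x y u v : K}
    (hy : y ^ 2 = (sextic θ).eval x) (hv : v ^ 2 = (sextic θ).eval u) (hxu : x ≠ u) :
    eval (kummerCoord (sextic θ) x y u v) (quartic (sextic θ)) = 0 := by
  have hd : x - u ≠ 0 := sub_ne_zero.2 hxu
  rw [sextic_eval] at hy hv
  simp only [quartic, quarticR, quarticS, quarticT, map_add, map_sub, map_mul, map_pow, eval_X,
    eval_C, kummerCoord, Matrix.cons_val]
  set β := (F₀ (sextic θ) x u - 2 * y * v) / (x - u) ^ 2 with hβ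
  have hb : β * (x - u) ^ 2 = F₀ (sextic θ) x u - 2 * y * v :=
    div_mul_cancel₀ _ (pow_ne_zero 2 hd)
  have hF := hb
  rw [F₀, sextic_coeff_six] at hF
  apply mul_left_cancel₀ (pow_ne_zero 2 hd)
  generalize (sextic θ).coeff 0 = f0 at *
  generalize (sextic θ).coeff 1 = f1 at *
  generalize (sextic θ).coeff 2 = f2 at *
  generalize (sextic θ).coeff 3 = f3 at *
  generalize (sextic θ).coeff 4 = f4 at *
  generalize (sextic θ).coeff 5 = f5 at *
  linear_combination (β * (x - u) ^ 2 - (2 * f0 + f1 * (x + u) + 2 * f2 * (x * u)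
    + f3 * (x * u) * (x + u) + 2 * f4 * (x * u) ^ 2 + f5 * (x * u) ^ 2 * (x + u)
    + 2 * 1 * (x * u) ^ 3) - 2 * y * v) * hF + 4 * v ^ 2 * hy
    + 4 * (f0 + f1 * x + f2 * x ^ 2 + f3 * x ^ 3 + f4 * x ^ 4 + f5 * x ^ 5 + x ^ 6) * hv

/-- The polynomial `a` does not depend on the last variable. -/
def IndepLast (a : MvPolynomial (Fin 4) K) : Prop :=
  ∀ (z : Fin 4 → K) (c : K), eval (Function.update z 3 c) a = eval z a

theorem IndepLast.add {a b : MvPolynomial (Fin 4) K} (ha : IndepLast a) (hb : IndepLast b) :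
    IndepLast (a + b) := fun z c => by rw [map_add, map_add, ha, hb]

theorem IndepLast.sub {a b : MvPolynomial (Fin 4) K} (ha : IndepLast a) (hb : IndepLast b) :
    IndepLast (a - b) := fun z c => by rw [map_sub, map_sub, ha, hb]

theorem IndepLast.mul {a b : MvPolynomial (Fin 4) K} (ha : IndepLast a) (hb : IndepLast b) :
    IndepLast (a * b) := fun z c => by rw [map_mul, map_mul, ha, hb]

theorem indepLast_X {i : Fin 4} (h : i ≠ 3) : IndepLast (X i : MvPolynomial (Fin 4) K) :=
  fun z c => by rw [eval_X, eval_X, Function.update_of_ne h]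

theorem indepLast_C (c : K) : IndepLast (C c : MvPolynomial (Fin 4) K) :=
  fun z c => by rw [eval_C, eval_C]

theorem IndepLast.pow {a : MvPolynomial (Fin 4) K} (ha : IndepLast a) (n : ℕ) :
    IndepLast (a ^ n) := fun z c => by rw [map_pow, map_pow, ha]

theorem indepLast_quarticR : IndepLast (quarticR : MvPolynomial (Fin 4) K) := fun z c => by
  simp [quarticR]

theorem indepLast_quarticS (F : Polynomial K) : IndepLast (quarticS F) := fun z c => by
  simp [quarticS]

theorem indepLast_quarticT (F : Polynomial K) : IndepLast (quarticT F) := fun z c => by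
  simp [quarticT]

/-- Pseudo-division by the equation of the Kummer surface, as a polynomial in the last variable. -/
theorem exists_pseudo_division (F : Polynomial K) (g : MvPolynomial (Fin 4) K) :
    ∃ (n : ℕ) (h a b : MvPolynomial (Fin 4) K), IndepLast a ∧ IndepLast b ∧
      quarticR ^ n * g = quartic F * h + a * X 3 + b := by
  induction g using MvPolynomial.induction_on with
  | C c => exact ⟨0, 0, 0, C c, by simpa using indepLast_C (0 : K), indepLast_C c, by ring⟩
  | add g g' hg hg' =>
    obtain ⟨n, h, a, b, ha, hb, e⟩ := hg
    obtain ⟨n', h', a', b', ha', hb', e'⟩ := hg'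
    have hR := fun n => (indepLast_quarticR (K := K)).pow n
    refine ⟨n + n', quarticR ^ n' * h + quarticR ^ n * h',
      quarticR ^ n' * a + quarticR ^ n * a', quarticR ^ n' * b + quarticR ^ n * b',
      ((hR _).mul ha).add ((hR _).mul ha'), ((hR _).mul hb).add ((hR _).mul hb'), ?_⟩
    linear_combination quarticR ^ n' * e + quarticR ^ n * e'
  | mul_X g i hg =>
    obtain ⟨n, h, a, b, ha, hb, e⟩ := hg
    by_cases hi : i = 3
    · subst hi
      refine ⟨n + 1, h * quarticR * X 3 + a, quarticR * b - a * quarticS F, C 0 - a * quarticT F,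
        (indepLast_quarticR.mul hb).sub (ha.mul (indepLast_quarticS F)),
        (indepLast_C 0).sub (ha.mul (indepLast_quarticT F)), ?_⟩
      rw [C_0]
      have hq : quartic F = quarticR * X 3 ^ 2 + quarticS F * X 3 + quarticT F := rfl
      linear_combination quarticR * X 3 * e - a * hq
    · have hX := indepLast_X (K := K) hi
      refine ⟨n, h * X i, a * X i, b * X i, ha.mul hX, hb.mul hX, ?_⟩
      linear_combination X i * e

variable [IsAlgClosed K]

/-- A form vanishing at the general points of the Kummer surface is divisible by the quartic up to
a power of its leading coefficient. -/
theorem exists_quartic_mul {θ : Fin 6 → K} (h2 : (2 : K) ≠ 0) {d : ℕ}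
    {g : MvPolynomial (Fin 4) K} (hg : g.IsHomogeneous d)
    (h : ∀ x y u v, y ^ 2 = (sextic θ).eval x → v ^ 2 = (sextic θ).eval u → y * v ≠ 0 → x ≠ u →
      eval (kummerCoord (sextic θ) x y u v) g = 0) :
    ∃ n r, quarticR ^ n * g = quartic (sextic θ) * r := by
  obtain ⟨n, r, a, b, ha, hb, e⟩ := exists_pseudo_division (sextic θ) g
  refine ⟨n, r, ?_⟩
  -- at the points where the roots of the attached quadratic polynomial are general, both
  -- preimages under the projection from the node `(0 : 0 : 0 : 1)` impose a condition
  let w : MvPolynomial (Fin 4) K :=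
    X 0 * quarticR * ∏ i, (C (θ i ^ 2) * X 0 - C (θ i) * X 1 + X 2)
  have key : ∀ z, eval z w ≠ 0 → eval z a = 0 ∧ eval z b = 0 := by
    intro z hz
    simp only [w, map_mul, map_prod, map_add, map_sub, eval_X, eval_C, quarticR, map_pow] at hz
    have hz0 := left_ne_zero_of_mul (left_ne_zero_of_mul hz)
    have hzd := right_ne_zero_of_mul (left_ne_zero_of_mul hz)
    have hzi := Finset.prod_ne_zero_iff.1 (right_ne_zero_of_mul hz)
    obtain ⟨δ, hδ⟩ := exists_sq_eq (z 1 ^ 2 - 4 * z 0 * z 2)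
    have h20 : 2 * z 0 ≠ 0 := mul_ne_zero h2 hz0
    set x := (z 1 + δ) / (2 * z 0) with hx
    set u := (z 1 - δ) / (2 * z 0) with hu
    have hs : z 1 = z 0 * (x + u) := by rw [hx, hu]; field_simp; ring
    have hp : z 2 = z 0 * (x * u) := by
      apply mul_left_cancel₀ (mul_ne_zero h2 h20)
      have h1 : z 0 * 2 * x = z 1 + δ := by rw [hx]; field_simp
      have h3 : z 0 * 2 * u = z 1 - δ := by rw [hu]; field_simp
      linear_combination hδ - (z 0 * 2 * u) * h1 - (z 1 + δ) * h3
    have hxu : x ≠ u := by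
      intro h
      apply hzd
      rw [hs, hp, h]; ring
    have hroot : ∀ i, (x - θ i) * (u - θ i) ≠ 0 := by
      intro i h
      apply hzi i (Finset.mem_univ i)
      rw [hs, hp]
      linear_combination z 0 * h
    obtain ⟨y, hy⟩ := exists_sq_eq ((sextic θ).eval x)
    obtain ⟨v, hv⟩ := exists_sq_eq ((sextic θ).eval u)
    have hyv : y * v ≠ 0 := by
      have : y ^ 2 * v ^ 2 ≠ 0 := by
        rw [hy, hv, sextic, Polynomial.eval_prod, Polynomial.eval_prod, ← Finset.prod_mul_distrib,
          Finset.prod_ne_zero_iff]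
        intro i _
        simpa using hroot i
      intro h
      exact this (by rw [← mul_pow, h]; ring)
    have hpt : ∀ y', y' ^ 2 = (sextic θ).eval x → y' * v ≠ 0 →
        eval z a * (z 0 * kummerCoord (sextic θ) x y' u v 3) + eval z b = 0 := by
      intro y' hy' hyv'
      set k := kummerCoord (sextic θ) x y' u v with hk
      have hz' : z 0 • k = Function.update z 3 (z 0 * k 3) := by
        funext j
        fin_cases j
        · simp [hk, kummerCoord]
        · simp [hk, kummerCoord, hs]
        · simp [hk, kummerCoord, hp]
        · simp
      have e' := congrArg (eval (z 0 • k)) e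
      rw [map_mul, map_add, map_add, map_mul, map_mul, eval_smul_of_isHomogeneous hg,
        eval_smul_of_isHomogeneous (quartic_isHomogeneous _), h x y' u v hy' hv hyv' hxu,
        eval_quartic_kummerCoord hy' hv hxu, eval_X, hz', ha, hb, Function.update_self] at e'
      simp only [mul_zero, zero_mul, zero_add] at e'
      exact e'.symm
    have e1 := hpt y hy hyv
    have e3 := hpt (-y) (by rw [neg_sq, hy]) (by rw [neg_mul]; exact neg_ne_zero.2 hyv)
    simp only [kummerCoord, Matrix.cons_val] at e1 e3
    have hd : x - u ≠ 0 := sub_ne_zero.2 hxu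
    have e4 : eval z a * (z 0 * (2 * 2 * (y * v))) = 0 := by
      field_simp at e1 e3
      linear_combination e3 - e1
    have ha0 : eval z a = 0 := (mul_eq_zero.1 e4).resolve_right
      (mul_ne_zero hz0 (mul_ne_zero (mul_ne_zero h2 h2) hyv))
    refine ⟨ha0, ?_⟩
    rw [ha0, zero_mul, zero_add] at e1
    exact e1
  have hw : w ≠ 0 := by
    obtain ⟨x, y, u, v, hy, hv, hyv, hxu⟩ := exists_general_pair θ
    intro h0
    have h1 := congrArg (eval (kummerCoord (sextic θ) x y u v)) h0
    simp only [w, map_mul, map_prod, map_add, map_sub, eval_X, eval_C, quarticR, map_pow,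
      kummerCoord, Matrix.cons_val, map_zero] at h1
    refine absurd h1 (mul_ne_zero (mul_ne_zero one_ne_zero ?_) (Finset.prod_ne_zero_iff.2 ?_))
    · intro h3
      apply pow_ne_zero 2 (sub_ne_zero.2 hxu)
      linear_combination h3
    · intro i _ h3
      have h4 : (x - θ i) * (u - θ i) = 0 := by linear_combination h3
      apply hyv
      rcases mul_eq_zero.1 h4 with h5 | h5
      · rw [sub_eq_zero.1 h5, sextic_eval_root] at hy
        rw [pow_eq_zero_iff two_ne_zero |>.1 hy, zero_mul]
      · rw [sub_eq_zero.1 h5, sextic_eval_root] at hv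
        rw [pow_eq_zero_iff two_ne_zero |>.1 hv, mul_zero]
  have hzero : ∀ c : MvPolynomial (Fin 4) K, (∀ z, eval z w ≠ 0 → eval z c = 0) → c = 0 := by
    intro c hc
    refine (mul_eq_zero.1 (MvPolynomial.funext fun z => ?_ : w * c = 0)).resolve_left hw
    rw [map_mul, map_zero]
    by_cases hz : eval z w = 0
    · rw [hz, zero_mul]
    · rw [hc z hz, mul_zero]
  rw [e, hzero a fun z hz => (key z hz).1, hzero b fun z hz => (key z hz).2]
  ring

end KummerForms

/-! ### The tangent planes of the Kummer surface and the two blow-downs -/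

section Tangent

variable {K : Type*} [Field K]

theorem eval_quarticR_kummerCoord (F : Polynomial K) (x y u v : K) :
    eval (kummerCoord F x y u v) quarticR = (x - u) ^ 2 := by
  simp only [quarticR, map_sub, map_mul, map_pow, eval_X, eval_C, kummerCoord, Matrix.cons_val]
  ring

theorem kummerPoint_mem {θ : Fin 6 → K} {x y u v : K} (hy : y ^ 2 = (sextic θ).eval x)
    (hv : v ^ 2 = (sextic θ).eval u) (hxu : x ≠ u) :
    kummerPoint (sextic θ) x y u v ∈ kummer θ :=
  subset_zariskiClosure _ ⟨x, y, u, v, hy, hv, hxu, rfl⟩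

theorem quartic_vanishesOn (θ : Fin 6 → K) : VanishesOn (quartic (sextic θ)) (kummer θ) := by
  refine VanishesOn.zariskiClosure (quartic_isHomogeneous _) ?_
  rintro _ ⟨x, y, u, v, hy, hv, hxu, rfl⟩
  exact (eval_rep_mk (quartic_isHomogeneous _) _).2 (eval_quartic_kummerCoord hy hv hxu)

theorem planeCoord_ne_zero (m : Fin 4 → K) (q : Fin 3 → K) (s p : K) :
    planeCoord m q s p ≠ 0 := fun h => by
  have := congrFun h 3
  simp [planeCoord] at this

theorem IsTangentHyperplane.unique {n : ℕ} {X : Set (PSpace K n)} {ξ η η' : PSpace K n}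
    (h : IsTangentHyperplane X ξ η) (h' : IsTangentHyperplane X ξ η') : η = η' :=
  Projectivization.submodule_injective (h.2.symm.trans h'.2)

theorem IsTangentHyperplane.gradient {n : ℕ} {X : Set (PSpace K n)} {ξ η : PSpace K n}
    (h : IsTangentHyperplane X ξ η) {d : ℕ} {g : MvPolynomial (Fin (n + 1)) K}
    (hg : g.IsHomogeneous d) (hgX : VanishesOn g X) :
    ∃ c : K, (fun j => eval ξ.rep (pderiv j g)) = c • η.rep := by
  have : (fun j => eval ξ.rep (pderiv j g)) ∈ η.submodule := by
    rw [← h.2]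
    exact Submodule.subset_span ⟨d, g, hg, hgX, rfl⟩
  rw [Projectivization.submodule_eq, Submodule.mem_span_singleton] at this
  obtain ⟨c, hc⟩ := this
  exact ⟨c, hc.symm⟩

theorem IsTangentHyperplane.exists_gradient_ne_zero {n : ℕ} {X : Set (PSpace K n)}
    {ξ η : PSpace K n} (h : IsTangentHyperplane X ξ η) :
    ∃ (d : ℕ) (g : MvPolynomial (Fin (n + 1)) K), g.IsHomogeneous d ∧ VanishesOn g X ∧
      (fun j => eval ξ.rep (pderiv j g)) ≠ 0 := by
  by_contra! hc
  have hr : η.rep ∈ η.submodule := by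
    rw [Projectivization.submodule_eq]
    exact Submodule.mem_span_singleton_self _
  rw [← h.2, Submodule.span_eq_bot.2, Submodule.mem_bot] at hr
  · exact η.rep_nonzero hr
  · rintro _ ⟨d, g, hg, hgX, rfl⟩
    exact hc d g hg hgX

theorem isTangent_mem_kummerDual {θ : Fin 6 → K} {ξ η : PSpace K 3}
    (h : IsTangentHyperplane (kummer θ) ξ η) : η ∈ kummerDual θ :=
  subset_zariskiClosure _ ⟨ξ, h⟩

/-- Changing the sign of the value at `θᵢ` corresponds to the map `Wᵢ` on the centres. -/
theorem HasCentre.reflect {θ : Fin 6 → K} (hθ : Function.Injective θ) {s : PSpace K 5}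
    {ζ : PSpace K 3} (h : HasCentre θ (omega θ) s ζ) (i : Fin 6) :
    HasCentre θ (fun j => pfAdj (omega θ j)) (epsProj hθ i s) (weierstrassMap hθ i ζ) := by
  have h1 : epsLin θ i s.rep ≠ 0 := fun h0 => s.rep_nonzero
    (epsLin_injective hθ i (h0.trans (map_zero _).symm))
  have h3 : Matrix.toLin' (weierstrassMatrix (sextic θ) (θ i)) ζ.rep ≠ 0 := fun h0 =>
    ζ.rep_nonzero (weierstrassMatrix_injective hθ i (h0.trans (map_zero _).symm))
  have e1 := epsProj_mk hθ i s.rep s.rep_nonzero h1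
  have e3 := map_mk_of_injective _ (weierstrassMatrix_injective hθ i) ζ.rep ζ.rep_nonzero h3
  rw [Projectivization.mk_rep] at e1 e3
  have e5 : weierstrassMap hθ i ζ = _ := e3
  rw [e1, e5, hasCentre_mk, ev_epsLin hθ, Matrix.toLin'_apply, ← skew_omega]
  exact (isFrame_omega hθ).isCentre_reflect hθ h i

theorem IsKappa.mem_desingKummer {θ : Fin 6 → K} (hθ : Function.Injective θ) {ξ : PSpace K 3}
    {s : PSpace K 5} (h : IsKappa θ ξ s) : s ∈ desingKummer θ := by
  obtain ⟨x, y, u, v, m, q, p, hp, hd, -, rfl⟩ := h.exists_data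
  exact (mem_desingKummer_iff hθ p hp).2 ⟨q, hd.cone⟩

theorem IsKappa.mem_kummer {θ : Fin 6 → K} {ξ : PSpace K 3} {s : PSpace K 5}
    (h : IsKappa θ ξ s) : ξ ∈ kummer θ := by
  obtain ⟨x, y, u, v, m, q, p, hp, hd, rfl, -⟩ := h.exists_data
  exact kummerPoint_mem hd.left_sq hd.right_sq hd.ne

theorem IsKappa.hasCentre {θ : Fin 6 → K} (hθ : Function.Injective θ) {ξ : PSpace K 3}
    {s : PSpace K 5} (h : IsKappa θ ξ s) : HasCentre θ (omega θ) s ξ := by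
  obtain ⟨x, y, u, v, m, q, p, hp, hd, rfl, rfl⟩ := h.exists_data
  exact (hasCentre_mk hp _).2 (hd.isCentre hθ)

/-- The map `κ⁻¹` is injective over the general points. -/
theorem IsKappa.eq_of_hasCentre {θ : Fin 6 → K} (hθ : Function.Injective θ) (h2 : (2 : K) ≠ 0)
    {ξ : PSpace K 3} {s s' : PSpace K 5} (h : IsKappa θ ξ s)
    (h' : HasCentre θ (omega θ) s' ξ) : s' = s := by
  obtain ⟨x, y, u, v, m, q, p, hp, hd, rfl, rfl⟩ := h.exists_data
  rw [← s'.mk_rep, kummerPoint, hasCentre_mk] at h'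
  obtain ⟨c, hc⟩ := hd.eq_smul_of_isCentre hθ h2 h'
  rw [← s'.mk_rep]
  refine (Projectivization.mk_eq_mk_iff' K _ _ _ _).2 ⟨c, ev_injective hθ ?_⟩
  rw [hc, ev_smul]

variable [IsAlgClosed K]

/-- The points attached to `(x, y)`, `(u, v)` with `y v ≠ 0` are dense in the Kummer surface. -/
theorem vanishesOn_kummer {θ : Fin 6 → K} (h2 : (2 : K) ≠ 0) {d : ℕ}
    {g : MvPolynomial (Fin 4) K} (hg : g.IsHomogeneous d)
    (h : ∀ x y u v, y ^ 2 = (sextic θ).eval x → v ^ 2 = (sextic θ).eval u → y * v ≠ 0 → x ≠ u →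
      eval (kummerCoord (sextic θ) x y u v) g = 0) : VanishesOn g (kummer θ) := by
  obtain ⟨n, r, e⟩ := exists_quartic_mul h2 hg h
  refine VanishesOn.zariskiClosure hg ?_
  rintro _ ⟨x, y, u, v, hy, hv, hxu, rfl⟩
  refine (eval_rep_mk hg _).2 ?_
  have := congrArg (eval (kummerCoord (sextic θ) x y u v)) e
  rw [map_mul, map_mul, map_pow, eval_quarticR_kummerCoord, eval_quartic_kummerCoord hy hv hxu,
    zero_mul] at this
  exact (mul_eq_zero.1 this).resolve_left
    (pow_ne_zero n (pow_ne_zero 2 (sub_ne_zero.2 hxu)))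

/-- The tangent plane at a general point. By `exists_quartic_mul` the gradient of each form
vanishing on the surface is a multiple of the gradient of the quartic. -/
theorem KappaData.isTangentHyperplane {θ : Fin 6 → K} (h2 : (2 : K) ≠ 0) {x y u v : K}
    {m : Fin 4 → K} {q : Fin 3 → K} {t : Fin 6 → K} (h : KappaData θ x y u v m q t) :
    IsTangentHyperplane (kummer θ) (kummerPoint (sextic θ) x y u v)
      (Projectivization.mk K _ (planeCoord_ne_zero m q (x + u) (x * u))) := by
  refine ⟨kummerPoint_mem h.left_sq h.right_sq h.ne, ?_⟩
  rw [Projectivization.submodule_mk]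
  obtain ⟨c, hc, hrep⟩ := exists_rep_mk (kummerCoord_ne_zero (sextic θ) x y u v)
  have hrep' : (kummerPoint (sextic θ) x y u v).rep = c • kummerCoord (sextic θ) x y u v := hrep
  have hR : eval (c • kummerCoord (sextic θ) x y u v) quarticR ≠ 0 := by
    rw [eval_smul_of_isHomogeneous quarticR_isHomogeneous, eval_quarticR_kummerCoord]
    exact mul_ne_zero (pow_ne_zero 2 hc) (pow_ne_zero 2 (sub_ne_zero.2 h.ne))
  have hgrad := eval_pderiv_quartic h.norm c
  rw [← h.coord] at hgrad
  have hN : -4 * c ^ 3 * normM m (x + u) (x * u) ≠ 0 := by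
    rw [normM_eq, ← h.left, ← h.right]
    have h4 : (-4 : K) = -(2 * 2) := by norm_num
    rw [h4]
    exact mul_ne_zero (mul_ne_zero (neg_ne_zero.2 (mul_ne_zero h2 h2)) (pow_ne_zero 3 hc))
      h.mul_ne
  rw [hrep']
  apply le_antisymm
  · rw [Submodule.span_le]
    rintro _ ⟨d, g, hg, hgX, rfl⟩
    obtain ⟨n, r, e⟩ := exists_quartic_mul h2 hg fun x y u v hy hv _ hxu =>
      (eval_rep_mk hg _).1 (hgX _ (kummerPoint_mem hy hv hxu))
    refine Submodule.mem_span_singleton.2 ⟨eval (c • kummerCoord (sextic θ) x y u v) r *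
      (-4 * c ^ 3 * normM m (x + u) (x * u))
        / eval (c • kummerCoord (sextic θ) x y u v) quarticR ^ n,
      ?_⟩
    funext j
    have e' := congrArg (fun f => eval (c • kummerCoord (sextic θ) x y u v) (pderiv j f)) e
    have hg0 : eval (c • kummerCoord (sextic θ) x y u v) g = 0 := by
      rw [← hrep']
      exact hgX _ (kummerPoint_mem h.left_sq h.right_sq h.ne)
    have hQ0 : eval (c • kummerCoord (sextic θ) x y u v) (quartic (sextic θ)) = 0 := by
      rw [← hrep']
      exact quartic_vanishesOn θ _ (kummerPoint_mem h.left_sq h.right_sq h.ne)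
    simp only [Derivation.leibniz, map_add, smul_eq_mul, map_mul, hg0, hQ0, hgrad, map_pow,
      zero_mul, zero_add, add_zero] at e'
    have hRn := pow_ne_zero n hR
    rw [Pi.smul_apply, smul_eq_mul]
    field_simp
    linear_combination -e'
  · rw [Submodule.span_singleton_le_iff_mem]
    have hm := Submodule.smul_mem _ (-4 * c ^ 3 * normM m (x + u) (x * u))⁻¹
      (Submodule.subset_span (R := K) (s := {w : Fin 4 → K | ∃ (d : ℕ) (g : MvPolynomial (Fin 4) K),
        g.IsHomogeneous d ∧ VanishesOn g (kummer θ) ∧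
        w = fun j => eval (c • kummerCoord (sextic θ) x y u v) (pderiv j g)})
        ⟨4, _, quartic_isHomogeneous _, quartic_vanishesOn θ, rfl⟩)
    convert hm using 1
    funext j
    rw [Pi.smul_apply, smul_eq_mul, hgrad, inv_mul_cancel_left₀ hN]

theorem IsKappa.exists_tangent {θ : Fin 6 → K} (hθ : Function.Injective θ) (h2 : (2 : K) ≠ 0)
    {ξ : PSpace K 3} {s : PSpace K 5} (h : IsKappa θ ξ s) :
    ∃ η, IsTangentHyperplane (kummer θ) ξ η ∧ HasCentre θ (fun j => pfAdj (omega θ j)) s η := by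
  obtain ⟨x, y, u, v, m, q, p, hp, hd, rfl, rfl⟩ := h.exists_data
  exact ⟨_, hd.isTangentHyperplane h2,
    (hasCentre_mk hp _).2 (isCentre_planeCoord hθ hd.norm hd.values hd.cone)⟩

/-- The points `ξ(s)` for which both `s` and `ε⁽ⁱ⁾ s` are in the image of `κ` are dense. -/
theorem vanishesOn_kummer_of_general₂ {θ : Fin 6 → K} (hθ : Function.Injective θ)
    (h2 : (2 : K) ≠ 0) (i : Fin 6) {d : ℕ} {g : MvPolynomial (Fin 4) K} (hg : g.IsHomogeneous d)
    (h : ∀ ξ s, IsKappa θ ξ s → IsGeneral θ (epsProj hθ i s) → eval ξ.rep g = 0) :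
    VanishesOn g (kummer θ) := by
  refine vanishesOn_kummer h2 hg fun x y u v hy hv hyv hxu => ?_
  obtain ⟨p, hp, hk⟩ := exists_isKappa hθ h2 hy hv hyv hxu
  have hm := HasCentre.mem_zariskiClosure (isFrame_omega hθ) hθ h2 i
    (X := {ξ | ∃ s, IsKappa θ ξ s ∧ IsGeneral θ (epsProj hθ i s)})
    (fun s _ ⟨ξ, h1⟩ h3 => ⟨ξ, ⟨s, h1, h3⟩, h1.hasCentre hθ⟩)
    (hk.mem_desingKummer hθ) (hk.hasCentre hθ)
  exact (eval_rep_mk hg _).1 (hm d g hg fun ξ ⟨s, h1, h3⟩ => h ξ s h1 h3)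

theorem HasCentre.mem_kummer {θ : Fin 6 → K} (hθ : Function.Injective θ) (h2 : (2 : K) ≠ 0)
    {s : PSpace K 5} (hs : s ∈ desingKummer θ) {ζ : PSpace K 3} (h : HasCentre θ (omega θ) s ζ) :
    ζ ∈ kummer θ := fun d g hg hgX =>
  HasCentre.mem_zariskiClosure (isFrame_omega hθ) hθ h2 0 (X := kummer θ)
    (fun _ _ ⟨ξ, h1⟩ _ => ⟨ξ, h1.mem_kummer, h1.hasCentre hθ⟩) hs h d g hg
    (hgX.zariskiClosure hg)

theorem HasCentre.mem_kummerDual {θ : Fin 6 → K} (hθ : Function.Injective θ) (h2 : (2 : K) ≠ 0)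
    {s : PSpace K 5} (hs : s ∈ desingKummer θ) {ζ : PSpace K 3}
    (h : HasCentre θ (fun j => pfAdj (omega θ j)) s ζ) : ζ ∈ kummerDual θ :=
  HasCentre.mem_zariskiClosure (isFrame_omega hθ).pfAdj hθ h2 0
    (X := {η | ∃ ξ, IsTangentHyperplane (kummer θ) ξ η})
    (fun _ _ ⟨ξ, h1⟩ _ => by
      obtain ⟨η, h3, h4⟩ := h1.exists_tangent hθ h2
      exact ⟨η, ⟨ξ, h3⟩, h4⟩) hs h

/-- The blow-down `κ⁻¹` sends each point to the centre of its pencil of lines. -/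
theorem isBlowDown_iff {θ : Fin 6 → K} (hθ : Function.Injective θ) (h2 : (2 : K) ≠ 0)
    (f : desingKummer θ → kummer θ) :
    IsBlowDown θ f ↔ ∀ s : desingKummer θ, HasCentre θ (omega θ) s (f s) := by
  have key : ∀ f : desingKummer θ → kummer θ,
      (∀ s : desingKummer θ, HasCentre θ (omega θ) s (f s)) → IsBlowDown θ f := fun f hf =>
    ⟨(isFrame_omega hθ).isRegularMap hθ h2 hf, fun ξ s h => Subtype.ext
      ((isFrame_omega hθ).hasCentre_unique hθ h2 s.2 (hf s) (h.hasCentre hθ))⟩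
  refine ⟨fun hf => ?_, key f⟩
  choose ζ hζ using fun s : desingKummer θ => (isFrame_omega hθ).exists_hasCentre hθ h2 s.2
  let f' : desingKummer θ → kummer θ := fun s => ⟨ζ s, (hζ s).mem_kummer hθ h2 s.2⟩
  have hf' := key f' hζ
  have : f = f' := hf.1.ext_of_general hθ h2 hf'.1 fun s ⟨ξ, h⟩ => by
    rw [hf.2 ⟨ξ, h.mem_kummer⟩ s h, hf'.2 ⟨ξ, h.mem_kummer⟩ s h]
  rw [this]
  exact hζ

/-- The blow-down `κ*⁻¹` sends each point to the plane of its pencil of lines. -/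
theorem isDualBlowDown_iff {θ : Fin 6 → K} (hθ : Function.Injective θ) (h2 : (2 : K) ≠ 0)
    (f : desingKummer θ → kummerDual θ) : IsDualBlowDown θ f ↔
      ∀ s : desingKummer θ, HasCentre θ (fun j => pfAdj (omega θ j)) s (f s) := by
  have hω := (isFrame_omega hθ).pfAdj
  have key : ∀ f : desingKummer θ → kummerDual θ,
      (∀ s : desingKummer θ, HasCentre θ (fun j => pfAdj (omega θ j)) s (f s)) →
      IsDualBlowDown θ f := fun f hf =>
    ⟨hω.isRegularMap hθ h2 hf, fun ξ η s h1 h => Subtype.ext (by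
      obtain ⟨η', h3, h4⟩ := h.exists_tangent hθ h2
      rw [h1.unique h3]
      exact hω.hasCentre_unique hθ h2 s.2 (hf s) h4)⟩
  refine ⟨fun hf => ?_, key f⟩
  choose ζ hζ using fun s : desingKummer θ => hω.exists_hasCentre hθ h2 s.2
  let f' : desingKummer θ → kummerDual θ := fun s => ⟨ζ s, (hζ s).mem_kummerDual hθ h2 s.2⟩
  have hf' := key f' hζ
  have : f = f' := hf.1.ext_of_general hθ h2 hf'.1 fun s ⟨ξ, h⟩ => by
    obtain ⟨η, h3, h4⟩ := h.exists_tangent hθ h2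
    rw [hf.2 ⟨ξ, h.mem_kummer⟩ ⟨η, isTangent_mem_kummerDual h3⟩ s h3 h,
      hf'.2 ⟨ξ, h.mem_kummer⟩ ⟨η, isTangent_mem_kummerDual h3⟩ s h3 h]
  rw [this]
  exact hζ

theorem existsUnique_blowDown {θ : Fin 6 → K} (hθ : Function.Injective θ) (h2 : (2 : K) ≠ 0) :
    ∃! f, IsBlowDown θ f := by
  choose ζ hζ using fun s : desingKummer θ => (isFrame_omega hθ).exists_hasCentre hθ h2 s.2
  refine ⟨fun s => ⟨ζ s, (hζ s).mem_kummer hθ h2 s.2⟩, (isBlowDown_iff hθ h2 _).2 hζ,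
    fun f hf => funext fun s => Subtype.ext ?_⟩
  exact (isFrame_omega hθ).hasCentre_unique hθ h2 s.2 ((isBlowDown_iff hθ h2 f).1 hf s) (hζ s)

theorem existsUnique_dualBlowDown {θ : Fin 6 → K} (hθ : Function.Injective θ)
    (h2 : (2 : K) ≠ 0) : ∃! f, IsDualBlowDown θ f := by
  have hω := (isFrame_omega hθ).pfAdj
  choose ζ hζ using fun s : desingKummer θ => hω.exists_hasCentre hθ h2 s.2
  refine ⟨fun s => ⟨ζ s, (hζ s).mem_kummerDual hθ h2 s.2⟩, (isDualBlowDown_iff hθ h2 _).2 hζ,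
    fun f hf => funext fun s => Subtype.ext ?_⟩
  exact hω.hasCentre_unique hθ h2 s.2 ((isDualBlowDown_iff hθ h2 f).1 hf s) (hζ s)

end Tangent

end KummerDuality

namespace KummerDuality

open Polynomial

/-! ### The projective duality maps and the involutions -/

section Duality

variable {K : Type*} [Field K]

theorem isForm_linear {m n : ℕ} (T : (Fin n → K) →ₗ[K] (Fin m → K)) (a : Fin m) :
    IsForm 1 (fun v => T v a) := by
  have : (fun v => T v a) = fun v : Fin n → K => ∑ j, v j * T (Pi.single j 1) a := by
    funext v
    conv_lhs => rw [← Finset.univ_sum_single v]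
    rw [map_sum, Finset.sum_apply]
    refine Finset.sum_congr rfl fun j _ => ?_
    rw [← mul_one (v j), ← smul_eq_mul, Pi.single_smul, map_smul, Pi.smul_apply, smul_eq_mul,
      smul_eq_mul, mul_one]
  rw [this]
  exact isForm_sum _ fun j => (isForm_apply j).mul_const _

theorem map_eq_mk {m n : ℕ} (T : (Fin n → K) →ₗ[K] (Fin m → K)) (hT : Function.Injective T)
    {v : Fin n → K} (hv : v ≠ 0) : ∃ hv' : T v ≠ 0,
      Projectivization.map T hT (Projectivization.mk K v hv) = Projectivization.mk K (T v) hv' :=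
  have hv' : T v ≠ 0 := fun h => hv (hT (h.trans (map_zero T).symm))
  ⟨hv', map_mk_of_injective T hT v hv hv'⟩

theorem eval_rep_map {m n d : ℕ} (T : (Fin n → K) →ₗ[K] (Fin m → K)) (hT : Function.Injective T)
    {g : MvPolynomial (Fin m) K} (hg : g.IsHomogeneous d) (x : Projectivization K (Fin n → K)) :
    MvPolynomial.eval (Projectivization.map T hT x).rep g = 0 ↔
      MvPolynomial.eval (T x.rep) g = 0 := by
  obtain ⟨hv, e⟩ := map_eq_mk T hT x.rep_nonzero
  rw [Projectivization.mk_rep] at e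
  rw [e, eval_rep_mk hg]

/-- Linear maps are regular. -/
theorem isRegularMap_linear {m n : ℕ} {X : Set (PSpace K m)} {Y : Set (PSpace K n)}
    (T : (Fin (m + 1) → K) →ₗ[K] (Fin (n + 1) → K)) (hT : Function.Injective T) {φ : X → Y}
    (hφ : ∀ x, (φ x : PSpace K n) = Projectivization.map T hT x) : IsRegularMap φ := by
  choose G hG e using isForm_linear T
  intro x
  have key : ∀ z : X, (fun j => MvPolynomial.eval z.1.rep (G j)) = T z.1.rep := fun z =>
    funext fun j => e j _
  obtain ⟨hv, -⟩ := map_eq_mk T hT x.1.rep_nonzero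
  refine ⟨1, G, hG, by rwa [key], fun z hz => ?_⟩
  obtain ⟨hv', e'⟩ := map_eq_mk T hT z.1.rep_nonzero
  rw [Projectivization.mk_rep] at e'
  rw [hφ, e']
  exact (Projectivization.mk_eq_mk_iff' K _ _ _ _).2 ⟨1, by rw [key, one_smul]⟩

theorem epsilon_isAutomorphism {θ : Fin 6 → K} (hθ : Function.Injective θ) (i : Fin 6) :
    IsAutomorphism (epsilon hθ i) :=
  ⟨isRegularMap_linear (epsLin θ i) (epsLin_injective hθ i) fun _ => rfl,
    isRegularMap_linear (epsLin θ i) (epsLin_injective hθ i) fun _ => rfl⟩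

theorem epsilon_commute {θ : Fin 6 → K} (hθ : Function.Injective θ) (i j : Fin 6) :
    Commute (epsilon hθ i) (epsilon hθ j) := by
  have hlin : ∀ p, epsLin θ i (epsLin θ j p) = epsLin θ j (epsLin θ i p) := by
    intro p
    apply ev_injective hθ
    simp only [ev_epsLin hθ]
    by_cases hij : i = j
    · subst hij; rfl
    · rw [Function.update_of_ne hij, Function.update_of_ne (Ne.symm hij),
        Function.update_comm hij]
  refine Equiv.ext fun s => Subtype.ext ?_
  change epsProj hθ i (epsProj hθ j s) = epsProj hθ j (epsProj hθ i s)
  have key : ∀ i j : Fin 6, ∃ h, epsProj hθ i (epsProj hθ j s.1)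
      = Projectivization.mk K (epsLin θ i (epsLin θ j s.1.rep)) h := by
    intro i j
    obtain ⟨h1, e1⟩ := map_eq_mk (epsLin θ j) (epsLin_injective hθ j) s.1.rep_nonzero
    obtain ⟨h3, e3⟩ := map_eq_mk (epsLin θ i) (epsLin_injective hθ i) h1
    rw [Projectivization.mk_rep] at e1
    refine ⟨h3, ?_⟩
    rw [epsProj, epsProj, e1, e3]
  obtain ⟨h1, e1⟩ := key i j
  obtain ⟨h3, e3⟩ := key j i
  rw [e1, e3]
  exact (Projectivization.mk_eq_mk_iff' K _ _ _ _).2 ⟨1, by rw [one_smul, hlin]⟩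

theorem epsilon_orderOf {θ : Fin 6 → K} (hθ : Function.Injective θ) (h2 : (2 : K) ≠ 0)
    (i : Fin 6) : orderOf (epsilon hθ i) = 2 := by
  refine orderOf_eq_prime ?_ fun h => ?_
  · rw [pow_two]
    exact Equiv.ext fun s => Subtype.ext (epsProj_epsProj hθ i s)
  · -- `ε⁽ⁱ⁾` moves the point given by the polynomial `1`, whose values are all `1`
    set p := coeffsOf θ (fun _ => (1 : K)) with hp
    have hev : ev θ p = fun _ => (1 : K) := ev_coeffsOf hθ _
    have hp0 : p ≠ 0 := by
      intro h0
      have := congrFun hev i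
      rw [h0, ev_zero] at this
      exact zero_ne_one this
    have hm : (Projectivization.mk K p hp0 : PSpace K 5) ∈ desingKummer θ :=
      (mem_desingKummer_iff hθ p hp0).2 ⟨![1, 0, 0], fun j => by simp [hev]⟩
    have h1 := congrArg Subtype.val (Equiv.congr_fun h ⟨_, hm⟩)
    change epsProj hθ i (Projectivization.mk K p hp0) = Projectivization.mk K p hp0 at h1
    obtain ⟨h3, e3⟩ := map_eq_mk (epsLin θ i) (epsLin_injective hθ i) hp0
    rw [epsProj, e3] at h1
    obtain ⟨c, hc⟩ := (Projectivization.mk_eq_mk_iff' K _ _ _ _).1 h1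
    have h4 := congrArg (ev θ) hc
    rw [ev_smul, ev_epsLin hθ, hev] at h4
    obtain ⟨j, hj⟩ : ∃ j : Fin 6, j ≠ i := exists_ne i
    have h5 := congrFun h4 j
    have h6 := congrFun h4 i
    rw [Function.update_of_ne hj] at h5
    rw [Function.update_self] at h6
    simp only [Pi.smul_apply, smul_eq_mul, mul_one] at h5 h6
    apply h2
    linear_combination h6 - h5

variable [IsAlgClosed K]

/-- For general `s` the map `Wᵢ` takes `κ⁻¹(s)` to the tangent plane at `κ⁻¹(ε⁽ⁱ⁾ s)`. -/
theorem IsKappa.weierstrassMap_tangent {θ : Fin 6 → K} (hθ : Function.Injective θ)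
    (h2 : (2 : K) ≠ 0) (i : Fin 6) {ξ ξ' : PSpace K 3} {s : PSpace K 5} (h : IsKappa θ ξ s)
    (h' : IsKappa θ ξ' (epsProj hθ i s)) :
    IsTangentHyperplane (kummer θ) ξ' (weierstrassMap hθ i ξ) := by
  obtain ⟨η, h1, h3⟩ := h'.exists_tangent hθ h2
  rwa [(isFrame_omega hθ).pfAdj.hasCentre_unique hθ h2 (h'.mem_desingKummer hθ)
    ((h.hasCentre hθ).reflect hθ i) h3]

/-- `Wᵢ` maps a dense set of points of the Kummer surface to tangent planes. -/
theorem weierstrassMap_mapsTo {θ : Fin 6 → K} (hθ : Function.Injective θ) (h2 : (2 : K) ≠ 0)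
    (i : Fin 6) : Set.MapsTo (weierstrassMap hθ i) (kummer θ) (kummerDual θ) := by
  intro ξ hξ d g hg hgX
  set T := Matrix.toLin' (weierstrassMatrix (sextic θ) (θ i))
  have hT : Function.Injective T := weierstrassMatrix_injective hθ i
  obtain ⟨G, hG, e⟩ := IsForm.comp hg (isForm_linear T)
  refine (eval_rep_map T hT hg ξ).2 ((e _).symm.trans ?_)
  refine vanishesOn_kummer_of_general₂ hθ h2 i hG (fun ξ s h ⟨ξ', h'⟩ => ?_) ξ hξ
  exact (e _).trans ((eval_rep_map T hT hg ξ).1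
    (hgX _ ⟨ξ', h.weierstrassMap_tangent hθ h2 i h'⟩))

/-- The inverse of `Wᵢ` maps each tangent plane, also at a special smooth point, into the Kummer
surface: near that point the tangent plane is the gradient of one form, so the claim follows from
the one for general points. -/
theorem weierstrassMap_surjOn {θ : Fin 6 → K} (hθ : Function.Injective θ) (h2 : (2 : K) ≠ 0)
    (i : Fin 6) : Set.SurjOn (weierstrassMap hθ i) (kummer θ) (kummerDual θ) := by
  set T := Matrix.toLin' (weierstrassMatrix (sextic θ) (θ i))
  have hT : Function.Injective T := weierstrassMatrix_injective hθ i
  let E := LinearEquiv.ofInjectiveEndo T hT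
  have hE : ∀ v, T (E.symm v) = v := fun v => E.apply_symm_apply v
  set S : (Fin 4 → K) →ₗ[K] (Fin 4 → K) := E.symm.toLinearMap
  have hSinj : Function.Injective S := E.symm.injective
  have hW : ∀ η : PSpace K 3, weierstrassMap hθ i (Projectivization.map S hSinj η) = η := by
    intro η
    obtain ⟨h1, e1⟩ := map_eq_mk S hSinj η.rep_nonzero
    obtain ⟨h3, e3⟩ := map_eq_mk T hT h1
    rw [Projectivization.mk_rep] at e1
    have : weierstrassMap hθ i (Projectivization.mk K (S η.rep) h1) = _ := e3
    rw [e1, this]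
    conv_rhs => rw [← η.mk_rep]
    exact (Projectivization.mk_eq_mk_iff' K _ _ _ _).2 ⟨1, by rw [one_smul]; exact (hE _).symm⟩
  intro η hη
  refine ⟨Projectivization.map S hSinj η, fun d g hg hgX => ?_, hW η⟩
  have hgK : VanishesOn g (kummer θ) := hgX.zariskiClosure hg
  -- it suffices to treat the tangent planes
  obtain ⟨G, hG, e⟩ := IsForm.comp hg (isForm_linear S)
  refine (eval_rep_map S hSinj hg η).2 ((e _).symm.trans ?_)
  refine hη _ G hG ?_
  rintro η' ⟨ξ', hη'⟩
  refine (e _).trans ?_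
  -- the plane `η'` is given by the gradient of a form `f`, and the gradient of `f` maps general
  -- points to multiples of their tangent planes
  obtain ⟨d', f, hf, hfX, hf0⟩ := hη'.exists_gradient_ne_zero
  obtain ⟨c, hc⟩ := hη'.gradient hf hfX
  have hc0 : c ≠ 0 := by
    rintro rfl
    rw [zero_smul] at hc
    exact hf0 hc
  obtain ⟨G', hG', e'⟩ := IsForm.comp hG (f := fun j v => MvPolynomial.eval v
    (MvPolynomial.pderiv j f)) fun j => ⟨MvPolynomial.pderiv j f, hf.pderiv, fun _ => rfl⟩
  replace e : ∀ v, MvPolynomial.eval v G = MvPolynomial.eval (S v) g := e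
  replace e' : ∀ v, MvPolynomial.eval v G'
    = MvPolynomial.eval (fun j => MvPolynomial.eval v (MvPolynomial.pderiv j f)) G := e'
  have hv := vanishesOn_kummer_of_general₂ hθ h2 i hG' (fun ξ s h ⟨ξ₁, h'⟩ => by
    obtain ⟨η₁, h1, h3⟩ := h.exists_tangent hθ h2
    obtain ⟨c₁, hc₁⟩ := h1.gradient hf hfX
    have hs : epsProj hθ i (epsProj hθ i s) = s := epsProj_epsProj hθ i s
    have h4 : weierstrassMap hθ i ξ₁ = η₁ :=
      (h'.weierstrassMap_tangent hθ h2 i (ξ' := ξ) (by rwa [hs])).unique h1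
    have h5 : MvPolynomial.eval (S η₁.rep) g = 0 := by
      rw [← eval_rep_map S hSinj hg, ← h4]
      have : Projectivization.map S hSinj (weierstrassMap hθ i ξ₁) = ξ₁ :=
        Projectivization.map_injective _ (weierstrassMatrix_injective hθ i) (hW _)
      rw [this]
      exact hgK _ h'.mem_kummer
    rw [e', hc₁, eval_smul_of_isHomogeneous hG, e]
    exact mul_eq_zero_of_right _ h5) ξ' hη'.1
  rw [e', hc, eval_smul_of_isHomogeneous hG, e] at hv
  exact (mul_eq_zero.1 hv).resolve_left (pow_ne_zero _ hc0)

theorem weierstrassMap_bijOn {θ : Fin 6 → K} (hθ : Function.Injective θ) (h2 : (2 : K) ≠ 0)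
    (i : Fin 6) : Set.BijOn (weierstrassMap hθ i) (kummer θ) (kummerDual θ) :=
  ⟨weierstrassMap_mapsTo hθ h2 i,
    (Projectivization.map_injective _ (weierstrassMatrix_injective hθ i)).injOn,
    weierstrassMap_surjOn hθ h2 i⟩

theorem blowDown_square {θ : Fin 6 → K} (hθ : Function.Injective θ) (h2 : (2 : K) ≠ 0)
    {κinv : desingKummer θ → kummer θ} {κsinv : desingKummer θ → kummerDual θ}
    (h : IsBlowDown θ κinv) (h' : IsDualBlowDown θ κsinv) (i : Fin 6) (s : desingKummer θ) :
    (κsinv (epsilon hθ i s) : PSpace K 3) = weierstrassMap hθ i (κinv s) :=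
  (isFrame_omega hθ).pfAdj.hasCentre_unique hθ h2 (epsilon hθ i s).2
    ((isDualBlowDown_iff hθ h2 κsinv).1 h' _)
    (((isBlowDown_iff hθ h2 κinv).1 h s).reflect hθ i)

/-- A lift of `Wᵢ` agrees with `ε⁽ⁱ⁾` at the general points, where `κ⁻¹` is injective. -/
theorem eq_epsilon_of_square {θ : Fin 6 → K} (hθ : Function.Injective θ) (h2 : (2 : K) ≠ 0)
    {κinv : desingKummer θ → kummer θ} {κsinv : desingKummer θ → kummerDual θ}
    (h : IsBlowDown θ κinv) (h' : IsDualBlowDown θ κsinv) (i : Fin 6)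
    {φ : Equiv.Perm (desingKummer θ)} (hφ : IsAutomorphism φ)
    (hsq : ∀ s, (κsinv (φ s) : PSpace K 3) = weierstrassMap hθ i (κinv s)) :
    φ = epsilon hθ i := by
  have hεε : ∀ s, epsilon hθ i (epsilon hθ i s) = s := fun s =>
    Subtype.ext (epsProj_epsProj hθ i s)
  refine Equiv.coe_fn_injective (hφ.1.ext_of_general hθ h2 (epsilon_isAutomorphism hθ i).1
    fun s ⟨ξ, hs⟩ => ?_)
  have h1 : (κinv (epsilon hθ i (φ s)) : PSpace K 3) = κinv s := by
    apply Projectivization.map_injective _ (weierstrassMatrix_injective hθ i)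
    have e := blowDown_square hθ h2 h h' i (epsilon hθ i (φ s))
    rw [hεε, hsq] at e
    exact e.symm
  have h3 : (κinv s : PSpace K 3) = ξ := congrArg Subtype.val (h.2 ⟨ξ, hs.mem_kummer⟩ s hs)
  have h4 := (isBlowDown_iff hθ h2 κinv).1 h (epsilon hθ i (φ s))
  rw [h1, h3] at h4
  have h5 : epsilon hθ i (φ s) = s := Subtype.ext (hs.eq_of_hasCentre hθ h2 h4)
  rw [← hεε (φ s), h5]

end Duality

/-! ### Nodes and tropes -/

section Nodes

variable {K : Type*} [Field K]

/-- The last coordinate of the node attached to the roots `a`, `b` of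
`(X - a)(X - b)(X - c)(X - d)(X - e)(X - f)`. -/
def nodeCoord (a b c d e f : K) : K :=
  -(c * d * e * f + a * b * (c * d + c * e + c * f + d * e + d * f + e * f) + a ^ 2 * b ^ 2)

theorem coeff_of_roots {F : K[X]} {a b c d e f : K}
    (h : F = (X - C a) * (X - C b) * (X - C c) * (X - C d) * (X - C e) * (X - C f)) :
    F.coeff 0 = a * b * c * d * e * f ∧
    F.coeff 1 = -(a * b * c * d * e + a * b * c * d * f + a * b * c * e * f + a * b * d * e * f
      + a * c * d * e * f + b * c * d * e * f) ∧
    F.coeff 2 = a * b * c * d + a * b * c * e + a * b * c * f + a * b * d * e + a * b * d * f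
      + a * b * e * f + a * c * d * e + a * c * d * f + a * c * e * f + a * d * e * f
      + b * c * d * e + b * c * d * f + b * c * e * f + b * d * e * f + c * d * e * f ∧
    F.coeff 3 = -(a * b * c + a * b * d + a * b * e + a * b * f + a * c * d + a * c * e
      + a * c * f + a * d * e + a * d * f + a * e * f + b * c * d + b * c * e + b * c * f
      + b * d * e + b * d * f + b * e * f + c * d * e + c * d * f + c * e * f + d * e * f) ∧
    F.coeff 4 = a * b + a * c + a * d + a * e + a * f + b * c + b * d + b * e + b * f + c * d
      + c * e + c * f + d * e + d * f + e * f ∧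
    F.coeff 5 = -(a + b + c + d + e + f) ∧ F.coeff 6 = 1 := by
  have key : F = C (a * b * c * d * e * f)
    + C (-(a * b * c * d * e + a * b * c * d * f + a * b * c * e * f + a * b * d * e * f
      + a * c * d * e * f + b * c * d * e * f)) * X
    + C (a * b * c * d + a * b * c * e + a * b * c * f + a * b * d * e + a * b * d * f
      + a * b * e * f + a * c * d * e + a * c * d * f + a * c * e * f + a * d * e * f
      + b * c * d * e + b * c * d * f + b * c * e * f + b * d * e * f + c * d * e * f) * X ^ 2
    + C (-(a * b * c + a * b * d + a * b * e + a * b * f + a * c * d + a * c * e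
      + a * c * f + a * d * e + a * d * f + a * e * f + b * c * d + b * c * e + b * c * f
      + b * d * e + b * d * f + b * e * f + c * d * e + c * d * f + c * e * f + d * e * f)) * X ^ 3
    + C (a * b + a * c + a * d + a * e + a * f + b * c + b * d + b * e + b * f + c * d
      + c * e + c * f + d * e + d * f + e * f) * X ^ 4
    + C (-(a + b + c + d + e + f)) * X ^ 5 + X ^ 6 := by
    rw [h]
    simp only [map_add, map_mul, map_neg]
    ring
  rw [key]
  simp only [coeff_add, coeff_C_mul, coeff_X_pow, coeff_C, coeff_X]
  norm_num

theorem kummerCoord_of_roots {F : K[X]} {a b c d e f : K}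
    (h : F = (X - C a) * (X - C b) * (X - C c) * (X - C d) * (X - C e) * (X - C f))
    (hab : a ≠ b) :
    kummerCoord F a 0 b 0 = ![1, a + b, a * b, nodeCoord a b c d e f] := by
  obtain ⟨c0, c1, c2, c3, c4, c5, c6⟩ := coeff_of_roots h
  have hd : (a - b) ^ 2 ≠ 0 := pow_ne_zero 2 (sub_ne_zero.2 hab)
  have : (F₀ F a b - 2 * 0 * 0) / (a - b) ^ 2 = nodeCoord a b c d e f := by
    rw [div_eq_iff hd]
    simp only [F₀, c0, c1, c2, c3, c4, c5, c6, nodeCoord]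
    ring
  rw [kummerCoord, this]

/-- The pairing of the coordinate vectors of a point and of a plane. -/
def Dot (v w : Fin 4 → K) : K := ∑ a, w a * v a

theorem incident_mk {v w : Fin 4 → K} (hv : v ≠ 0) (hw : w ≠ 0) :
    Incident (Projectivization.mk K v hv) (Projectivization.mk K w hw) ↔ Dot v w = 0 := by
  obtain ⟨c, hc, e⟩ := exists_rep_mk hv
  obtain ⟨c', hc', e'⟩ := exists_rep_mk hw
  have : ∑ a, (c' • w) a * (c • v) a = c' * c * Dot v w := by
    simp only [Dot, Finset.mul_sum, Pi.smul_apply, smul_eq_mul]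
    exact Finset.sum_congr rfl fun a _ => by ring
  rw [Incident, e, e', this, mul_eq_zero, or_iff_right (mul_ne_zero hc' hc)]

theorem incident_weierstrassMap {θ : Fin 6 → K} (hθ : Function.Injective θ) (i : Fin 6)
    {v w : Fin 4 → K} (hv : v ≠ 0) (hw : w ≠ 0) :
    Incident (Projectivization.mk K v hv) (weierstrassMap hθ i (Projectivization.mk K w hw)) ↔
      Dot v ((skew (omega θ i)).mulVec w) = 0 := by
  obtain ⟨hw', e⟩ := map_eq_mk (Matrix.toLin' (weierstrassMatrix (sextic θ) (θ i)))
    (weierstrassMatrix_injective hθ i) hw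
  rw [weierstrassMap, e, incident_mk, Matrix.toLin'_apply, skew_omega]

theorem dot_skew_comm (l : Fin 6 → K) (v w : Fin 4 → K) :
    Dot v ((skew l).mulVec w) = -Dot w ((skew l).mulVec v) := by
  simp only [Dot, skew_mulVec, Fin.sum_univ_four, Matrix.cons_val]
  ring

theorem dot_skew_self (l : Fin 6 → K) (v : Fin 4 → K) : Dot v ((skew l).mulVec v) = 0 := by
  simp only [Dot, skew_mulVec, Fin.sum_univ_four, Matrix.cons_val]
  ring

theorem kummerCoord_swap (F : K[X]) (x u : K) :
    kummerCoord F x 0 u 0 = kummerCoord F u 0 x 0 := by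
  have h : F₀ F x u = F₀ F u x := by simp only [F₀]; ring
  have h' : (x - u) ^ 2 = (u - x) ^ 2 := by ring
  simp only [kummerCoord, h, h', add_comm x u, mul_comm x u]

/-- The factors of the sextic can be listed in an order with prescribed beginning. -/
theorem exists_root_order (θ : Fin 6 → K) (r : Fin 6 → Fin 6) (s : Finset (Fin 6))
    (hr : Set.InjOn r s) : ∃ σ : Equiv.Perm (Fin 6), (∀ k ∈ s, σ k = r k) ∧
      sextic θ = (X - C (θ (σ 0))) * (X - C (θ (σ 1))) * (X - C (θ (σ 2))) * (X - C (θ (σ 3)))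
        * (X - C (θ (σ 4))) * (X - C (θ (σ 5))) := by
  obtain ⟨g, hg⟩ := Finset.exists_equiv_extend_of_card_eq (t := Finset.univ) (f := r) (s := s)
    (by simp) (Finset.subset_univ _) hr
  let σ : Equiv.Perm (Fin 6) := g.trans (Equiv.subtypeUnivEquiv fun _ => Finset.mem_univ _)
  refine ⟨σ, hg, ?_⟩
  rw [sextic, ← Equiv.prod_comp σ, Fin.prod_univ_six]

theorem dot_node₀ (θ : Fin 6 → K) (i j : Fin 6) :
    Dot (kummerCoord (sextic θ) (θ i) 0 (θ j) 0) ((skew (omega θ i)).mulVec ![0, 0, 0, 1]) = 0 := by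
  simp [Dot, skew_mulVec, Fin.sum_univ_four, kummerCoord, omega]
  ring

/-- The node `Nⱼₘ` lies in the plane `Wᵢ Nᵢⱼ`. -/
theorem dot_node_adjacent {θ : Fin 6 → K} (hθ : Function.Injective θ) {i j m : Fin 6}
    (hij : i ≠ j) (him : i ≠ m) (hjm : j ≠ m) :
    Dot (kummerCoord (sextic θ) (θ j) 0 (θ m) 0)
      ((skew (omega θ i)).mulVec (kummerCoord (sextic θ) (θ i) 0 (θ j) 0)) = 0 := by
  obtain ⟨σ, hσ, h⟩ := exists_root_order θ ![i, j, m, i, i, i] {0, 1, 2} (by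
    intro a ha b hb hab
    fin_cases a <;> fin_cases b <;> simp_all)
  have h0 : σ 0 = i := by simpa using hσ 0 (by simp)
  have h1 : σ 1 = j := by simpa using hσ 1 (by simp)
  have h3 : σ 2 = m := by simpa using hσ 2 (by simp)
  rw [h0, h1, h3] at h
  obtain ⟨c0, c1, c2, c3, c4, c5, c6⟩ := coeff_of_roots h
  rw [kummerCoord_of_roots h (hθ.ne hij), kummerCoord_of_roots (a := θ j) (b := θ m) (c := θ i)
    (d := θ (σ 3)) (e := θ (σ 4)) (f := θ (σ 5)) (by rw [h]; ring) (hθ.ne hjm)]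
  simp only [Dot, skew_mulVec, Fin.sum_univ_four, Matrix.cons_val, omega, c1, c2, c3, c4, c5,
    nodeCoord]
  ring

/-- The node `Nₘₙ` lies in the plane `Wᵢ Nⱼₗ`. -/
theorem dot_node_disjoint {θ : Fin 6 → K} (hθ : Function.Injective θ) {i j l m n : Fin 6}
    (hij : i ≠ j) (hil : i ≠ l) (him : i ≠ m) (hin : i ≠ n) (hjl : j ≠ l) (hjm : j ≠ m)
    (hjn : j ≠ n) (hlm : l ≠ m) (hln : l ≠ n) (hmn : m ≠ n) :
    Dot (kummerCoord (sextic θ) (θ m) 0 (θ n) 0)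
      ((skew (omega θ i)).mulVec (kummerCoord (sextic θ) (θ j) 0 (θ l) 0)) = 0 := by
  obtain ⟨σ, hσ, h⟩ := exists_root_order θ ![i, j, l, m, n, i] {0, 1, 2, 3, 4} (by
    intro a ha b hb hab
    fin_cases a <;> fin_cases b <;> simp_all)
  have h0 : σ 0 = i := by simpa using hσ 0 (by simp)
  have h1 : σ 1 = j := by simpa using hσ 1 (by simp)
  have h3 : σ 2 = l := by simpa using hσ 2 (by simp)
  have h4 : σ 3 = m := by simpa using hσ 3 (by simp)
  have h5 : σ 4 = n := by simpa using hσ 4 (by simp)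
  rw [h0, h1, h3, h4, h5] at h
  obtain ⟨c0, c1, c2, c3, c4, c5, c6⟩ := coeff_of_roots h
  rw [kummerCoord_of_roots (a := θ j) (b := θ l) (c := θ i) (d := θ m) (e := θ n) (f := θ (σ 5))
      (by rw [h]; ring) (hθ.ne hjl),
    kummerCoord_of_roots (a := θ m) (b := θ n) (c := θ i) (d := θ j) (e := θ l) (f := θ (σ 5))
      (by rw [h]; ring) (hθ.ne hmn)]
  simp only [Dot, skew_mulVec, Fin.sum_univ_four, Matrix.cons_val, omega, c1, c2, c3, c4, c5,
    nodeCoord]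
  ring

theorem weierstrassMap_node₀ {θ : Fin 6 → K} (hθ : Function.Injective θ) (i : Fin 6) :
    IsTrope₁ θ i (weierstrassMap hθ i node₀) :=
  ⟨(incident_weierstrassMap hθ i _ _).2 (dot_skew_self _ _), fun j _ =>
    (incident_weierstrassMap hθ i _ _).2 (dot_node₀ θ i j)⟩

theorem weierstrassMap_node {θ : Fin 6 → K} (hθ : Function.Injective θ) {i j : Fin 6}
    (hji : j ≠ i) : IsTrope₁ θ j (weierstrassMap hθ i (node θ i j)) := by
  refine ⟨(incident_weierstrassMap hθ i _ _).2 ?_, fun m hm =>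
    (incident_weierstrassMap hθ i _ _).2 ?_⟩
  · rw [dot_skew_comm, dot_node₀, neg_zero]
  · by_cases hmi : m = i
    · subst hmi
      rw [kummerCoord_swap, dot_skew_self]
    · exact dot_node_adjacent hθ hji.symm (Ne.symm hmi) hm.symm

theorem weierstrassMap_node_trope₃ {θ : Fin 6 → K} (hθ : Function.Injective θ) {i j l : Fin 6}
    (hji : j ≠ i) (hli : l ≠ i) (hjl : j ≠ l) :
    IsTrope₃ θ i j l (weierstrassMap hθ i (node θ j l)) := by
  intro m n hmn h
  refine (incident_weierstrassMap hθ i _ _).2 ?_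
  have hadj : ∀ j l : Fin 6, j ≠ i → l ≠ i → j ≠ l →
      Dot (kummerCoord (sextic θ) (θ i) 0 (θ j) 0)
        ((skew (omega θ i)).mulVec (kummerCoord (sextic θ) (θ j) 0 (θ l) 0)) = 0 := by
    intro j l hji hli hjl
    rw [dot_skew_comm, dot_node_adjacent hθ hji.symm hli.symm hjl, neg_zero]
  have h1 := hadj j l hji hli hjl
  have h3 := hadj l j hli hji hjl.symm
  rw [kummerCoord_swap _ (θ l) (θ j)] at h3
  rcases h with h | h
  · have hm : m = i ∨ m = j ∨ m = l := by simpa using h (Set.mem_insert m {n})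
    have hn : n = i ∨ n = j ∨ n = l := by simpa using h (Set.mem_insert_of_mem m rfl)
    rcases hm with rfl | rfl | rfl <;> rcases hn with rfl | rfl | rfl
    · exact absurd rfl hmn
    · exact h1
    · exact h3
    · rw [kummerCoord_swap]; exact h1
    · exact absurd rfl hmn
    · exact dot_skew_self _ _
    · rw [kummerCoord_swap]; exact h3
    · rw [kummerCoord_swap]; exact dot_skew_self _ _
    · exact absurd rfl hmn
  · have hm : ¬(m = i ∨ m = j ∨ m = l) := by
      simpa using Set.disjoint_left.1 h (Set.mem_insert m {n})
    have hn : ¬(n = i ∨ n = j ∨ n = l) := by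
      simpa using Set.disjoint_left.1 h (Set.mem_insert_of_mem m rfl)
    push Not at hm hn
    exact dot_node_disjoint hθ hji.symm hli.symm hm.1.symm hn.1.symm hjl hm.2.1.symm hn.2.1.symm
      hm.2.2.symm hn.2.2.symm hmn

end Nodes

/-! ### Fields of definition -/

section Field

variable {k K : Type*} [Field k] [Field K] [Algebra k K]

theorem weierstrassMatrix_mem {F : Polynomial k} {θ : Fin 6 → K}
    (hF : F.map (algebraMap k K) = sextic θ) (i : Fin 6) (a b : Fin 4) :
    weierstrassMatrix (sextic θ) (θ i) a b ∈ IntermediateField.adjoin k {θ i} := by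
  set L := IntermediateField.adjoin k {θ i}
  have ht : θ i ∈ L := IntermediateField.mem_adjoin_simple_self k (θ i)
  have hc : ∀ n, (sextic θ).coeff n ∈ L := fun n => by
    rw [← hF, coeff_map]
    exact L.algebraMap_mem _
  have h2 : (2 : K) ∈ L := ofNat_mem L 2
  rw [← skew_omega]
  have hω : ∀ c, omega θ i c ∈ L := by
    intro c
    fin_cases c
    · exact add_mem (add_mem (add_mem (add_mem (add_mem (hc 1) (mul_mem (mul_mem h2 (hc 2)) ht))
        (mul_mem (mul_mem h2 (hc 3)) (pow_mem ht 2))) (mul_mem (mul_mem h2 (hc 4)) (pow_mem ht 3)))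
        (mul_mem (mul_mem h2 (hc 5)) (pow_mem ht 4))) (mul_mem h2 (pow_mem ht 5))
    · exact mul_mem ht (add_mem (add_mem (add_mem (hc 3) (mul_mem (mul_mem h2 (hc 4)) ht))
        (mul_mem (mul_mem h2 (hc 5)) (pow_mem ht 2))) (mul_mem h2 (pow_mem ht 3)))
    · exact pow_mem ht 2
    · exact mul_mem (pow_mem ht 2) (add_mem (hc 5) (mul_mem h2 ht))
    · exact neg_mem ht
    · exact one_mem L
  generalize omega θ i = l at hω ⊢
  fin_cases a <;> fin_cases b <;>
    first | exact zero_mem L | exact hω _ | exact neg_mem (hω _)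

/-- All polynomials in the definition of `ε⁽ⁱ⁾` come from polynomials over `k(θᵢ)`. -/
theorem epsLin_toMatrix_mem {F : Polynomial k} {θ : Fin 6 → K}
    (hF : F.map (algebraMap k K) = sextic θ) (i : Fin 6) (a b : Fin 6) :
    LinearMap.toMatrix' (epsLin θ i) a b ∈ IntermediateField.adjoin k {θ i} := by
  set L := IntermediateField.adjoin k {θ i}
  have ht : θ i ∈ L := IntermediateField.mem_adjoin_simple_self k (θ i)
  set ι := algebraMap L K
  set S : L[X] := F.map (algebraMap k L) with hSdef
  have hS : S.map ι = sextic θ := by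
    rw [hSdef, map_map, ← hF]
    rfl
  have hSm : S.Monic := by
    have := sextic_monic θ
    rw [← hS] at this
    exact monic_of_injective ι.injective this
  set D : L[X] := S /ₘ (X - C ⟨θ i, ht⟩) with hDdef
  have hD : D.map ι = cofactor θ i := by
    rw [hDdef, map_divByMonic _ (monic_X_sub_C _), hS, sextic_dvd θ i, Polynomial.map_sub, map_X,
      map_C]
    exact mul_divByMonic_cancel_left _ (monic_X_sub_C _)
  have hg : (1 - C (2 / D.eval ⟨θ i, ht⟩) * D).map ι = gPoly θ i := by
    have he : ι (D.eval ⟨θ i, ht⟩) = (cofactor θ i).eval (θ i) := by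
      rw [← hD, ← eval₂_at_apply, eval_map]
      rfl
    rw [Polynomial.map_sub, Polynomial.map_mul, map_C, Polynomial.map_one, hD, map_div₀, he,
      gPoly, map_ofNat]
  have hX : toPoly (Pi.single b (1 : K)) = (X ^ (b : ℕ) : L[X]).map ι := by
    rw [Polynomial.map_pow, map_X]
    change ∑ j : Fin 6, C ((Pi.single b (1 : K) : Fin 6 → K) j) * X ^ (j : ℕ) = _
    rw [Finset.sum_eq_single b]
    · simp
    · intro j _ hj
      simp [hj]
    · simp
  have : LinearMap.toMatrix' (epsLin θ i) a b
      = ι ((((1 - C (2 / D.eval ⟨θ i, ht⟩) * D) * X ^ (b : ℕ)) %ₘ S).coeff a) := by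
    rw [LinearMap.toMatrix'_apply, epsLin_apply, ← coeff_map, map_modByMonic _ hSm,
      Polynomial.map_mul, hg, hS, ← hX]
  rw [this]
  exact Subtype.property _

end Field

end KummerDuality

theorem corollary4p10 {k K : Type*} [Field k] [Field K] [Algebra k K] [IsAlgClosed K]
    (h2 : (2 : k) ≠ 0) (F : Polynomial k) (θ : Fin 6 → K) (hθ : Function.Injective θ)
    (hF : F.map (algebraMap k K) = sextic θ) :
    (∃! κinv : desingKummer θ → kummer θ, IsBlowDown θ κinv) ∧
    (∃! κsinv : desingKummer θ → kummerDual θ, IsDualBlowDown θ κsinv) ∧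
    -- the maps `W i` are linear isomorphisms from `𝒦` onto `𝒦*`; they move nodes to tropes as the
    -- addition of the `i`-th Weierstrass point does, and they are defined over `k(θ i)`
    (∀ i, Set.BijOn (weierstrassMap hθ i) (kummer θ) (kummerDual θ) ∧
      IsTrope₁ θ i (weierstrassMap hθ i node₀) ∧
      (∀ j, j ≠ i → IsTrope₁ θ j (weierstrassMap hθ i (node θ i j))) ∧
      (∀ j l, j ≠ i → l ≠ i → j ≠ l → IsTrope₃ θ i j l (weierstrassMap hθ i (node θ j l))) ∧
      ∀ a b, weierstrassMatrix (sextic θ) (θ i) a b ∈ IntermediateField.adjoin k {θ i}) ∧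
    -- the `ε i` are commuting involutions, and they are defined over `k(θ i)`
    (∀ i, orderOf (epsilon hθ i) = 2 ∧
      ∀ a b, LinearMap.toMatrix' (epsLin θ i) a b ∈ IntermediateField.adjoin k {θ i}) ∧
    (∀ i j, Commute (epsilon hθ i) (epsilon hθ j)) ∧
    -- the square with `ε i` commutes, and no other automorphism of `𝒮` makes it commute
    (∀ (κinv : desingKummer θ → kummer θ) (κsinv : desingKummer θ → kummerDual θ),
      IsBlowDown θ κinv → IsDualBlowDown θ κsinv → ∀ i,
        IsAutomorphism (epsilon hθ i) ∧
        (∀ s, (κsinv (epsilon hθ i s) : PSpace K 3) = weierstrassMap hθ i (κinv s)) ∧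
        ∀ φ : Equiv.Perm (desingKummer θ), IsAutomorphism φ →
          (∀ s, (κsinv (φ s) : PSpace K 3) = weierstrassMap hθ i (κinv s)) →
          φ = epsilon hθ i) := by
  have h2' : (2 : K) ≠ 0 := by
    rw [← map_ofNat (algebraMap k K) 2]
    exact (map_ne_zero _).2 h2
  exact ⟨existsUnique_blowDown hθ h2', existsUnique_dualBlowDown hθ h2',
    fun i => ⟨weierstrassMap_bijOn hθ h2' i, weierstrassMap_node₀ hθ i,
      fun j hj => weierstrassMap_node hθ hj,
      fun j l hj hl hjl => weierstrassMap_node_trope₃ hθ hj hl hjl,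
      weierstrassMatrix_mem hF i⟩,
    fun i => ⟨epsilon_orderOf hθ h2' i, epsLin_toMatrix_mem hF i⟩,
    epsilon_commute hθ,
    fun κinv κsinv h h' i => ⟨epsilon_isAutomorphism hθ i, blowDown_square hθ h2' h h' i,
      fun φ hφ hsq => eq_epsilon_of_square hθ h2' h h' i hφ hsq⟩⟩
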